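/- **Setting.** Let $Q$ be a smooth (Hausdorff) $4$-manifold with a nonholonomic Engel structure: a smooth Riemannian metric $\mathcal G=\langle\cdot,\cdot\rangle$ and a smooth rank $2$ distribution $\mathcal H\subset TQ$ such that for all vector fields $X,Y$ locally spanning $\mathcal H$ there are functions $a,b$ for which $X,\,Y,\,Z=[X,Y],\,a[X,Z]+b[Y,Z]$ is a local frame of $TQ$. Put $\mathcal H^1=\mathcal H+[\mathcal H,\mathcal H]$. A coframe at $x$ is a linear isomorphism $T_xQ\to\mathbb R^4$; matrices act on coframes by left multiplication. Let $B_0$ be the set of all coframes $g\eta$, where $\eta=(\eta^1,\dots,\eta^4)^{\rm tr}$ is an orthonormal coframe with $\eta^3,\eta^4$ annihilating $\mathcal H$ and $\eta^4$ annihilating $\mathcal H^1$, and where $g$ belongs to the group $G_0$ of matrices $$\begin{pmatrix}A_{11}&A_{12}&0&B_{14}\\A_{21}&A_{22}&0&B_{24}\\0&0&a_{33}&a_{34}\\0&0&0&a_{44}\end{pmatrix},\qquad A\in O(2),\quad a_{33}a_{44}\neq0 .$$ Let $B_{final}\subset B_0$ be the set of values of those smooth local sections $\eta$ of $B_0$ whose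 torsion coefficients in $d\eta^K=\sum_{I<J}T^K_{IJ}\,\eta^I\wedge\eta^J$ are normalized by $T^3_{12}=1$, $(T^4_{13},T^4_{23})=(0,1)$, $T^1_{23}=T^2_{23}=T^3_{23}=0$. A smooth map $f$ induces $f_1(b)=b\circ(df)^{-1}$ on coframes whenever $df$ is invertible. A symmetry of the structure is a diffeomorphism $f$ of $Q$ with $f_1(B_0)=B_0$. **Theorem.** 1. $B_{final}$ is a $G$-structure contained in $B_0$ (its fibres are $G$-orbits of coframes, and it has smooth local sections through every point of $Q$), with structure group $G=\{\mathrm{diag}(\epsilon_1\epsilon_2,\epsilon_2,\epsilon_1,\epsilon_1\epsilon_2):\epsilon_1,\epsilon_2=\pm1\}\cong\mathbb Z_2\times\mathbb Z_2$. 2. It is canonical: for a diffeomorphism $f:Q\to Q'$ between manifolds with nonholonomic Engel structures, $f_1(B_0)=B_0'$ if and only if $f_1(B_{final})=B_{final}'$, and both hold if $f$ is an isometry that carries $\mathcal H$ to $\mathcal H'$. 3. $B_{final}$, with the topology of the coframe bundle, is a smooth $4$-manifold whose projection $\pi$ to $Q$ is a local diffeomorphism and whose inclusion into the bundle $\mathrm{Hom}(TQ,\mathbb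 R^4)$ is smooth. The tautological one-form $\Omega_b(v)=b(d\pi\, v)$ is a smooth coframing of $B_{final}$, and there are smooth functions $T^K_{IJ}$ on $B_{final}$ with $$d\begin{pmatrix}\Omega^1\\\Omega^2\\\Omega^3\\\Omega^4\end{pmatrix}=\begin{pmatrix}T^1_{12}&T^1_{13}&T^1_{14}&0&T^1_{24}&T^1_{34}\\T^2_{12}&T^2_{13}&T^2_{14}&0&T^2_{24}&T^2_{34}\\1&T^3_{13}&T^3_{14}&0&T^3_{24}&T^3_{34}\\0&0&T^2_{12}+T^3_{13}&1&T^4_{24}&T^4_{34}\end{pmatrix}\begin{pmatrix}\Omega^1\wedge\Omega^2\\\Omega^1\wedge\Omega^3\\\Omega^1\wedge\Omega^4\\\Omega^2\wedge\Omega^3\\\Omega^2\wedge\Omega^4\\\Omega^3\wedge\Omega^4\end{pmatrix}.$$ 4. If $Q$ is connected, then the symmetry group has dimension at most $4$: the symmetries act freely on $B_{final}$ (a symmetry $f$ with $f_1(b)=b$ for some $b\in B_{final}$ is the identity), and every Lie group that acts smoothly and effectively on $Q$ by symmetries has dimension at most $4$. -/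

import Mathlib

open Set Bundle Matrix VectorField
open scoped Manifold ContDiff Topology

universe u v w

noncomputable section

/-- The model space of a `4`-manifold. -/
abbrev Model4 : Type := EuclideanSpace ℝ (Fin 4)

/-- The model with corners of a (boundaryless) `4`-manifold. -/
abbrev I4 : ModelWithCorners ℝ Model4 Model4 := 𝓘(ℝ, Model4)

/-- The space `ℝ⁴` of column vectors, in which coframes take their values.
Indices run over `0, 1, 2, 3` instead of `1, 2, 3, 4`. -/
abbrev Col4 : Type := Fin 4 → ℝ

section Forms

variable {M : Type*} [TopologicalSpace M] [ChartedSpace Model4 M]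

/-- The bundle `Hom(TM, ℝ⁴)`. -/
abbrev HomBundle (M : Type*) [TopologicalSpace M] [ChartedSpace Model4 M] (x : M) : Type :=
  TangentSpace I4 x →L[ℝ] Bundle.Trivial M Col4 x

/-- The total space of `Hom(TM, ℝ⁴)`. The coframe bundle `F*(M)` is its open subset of all
`b` for which `b.2` is bijective. -/
abbrev HomTotal (M : Type*) [TopologicalSpace M] [ChartedSpace Model4 M] : Type _ :=
  TotalSpace (Model4 →L[ℝ] Col4) (HomBundle M)

/-- An `ℝ⁴`-valued one-form is smooth on a set. -/
def SmoothFormOn [IsManifold I4 ∞ M] (θ : ∀ x : M, HomBundle M x) (U : Set M) : Prop :=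
  ContMDiffOn I4 (I4.prod 𝓘(ℝ, Model4 →L[ℝ] Col4)) ∞ (fun x => (⟨x, θ x⟩ : HomTotal M)) U

/-- A vector field is smooth on a set. -/
def SmoothFieldOn [IsManifold I4 ∞ M] (X : ∀ x : M, TangentSpace I4 x) (U : Set M) : Prop :=
  ContMDiffOn I4 I4.tangent ∞ (fun x => (⟨x, X x⟩ : TangentBundle I4 M)) U

/-- The pull-back of an `ℝ⁴`-valued one-form to the model space by the inverse of the chart
at `x`. -/
def formInChart (θ : ∀ x : M, HomBundle M x) (x : M) (y : Model4) : Model4 →L[ℝ] Col4 :=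
  ContinuousLinearMap.comp (θ ((extChartAt I4 x).symm y))
    (mfderiv 𝓘(ℝ, Model4) I4 (extChartAt I4 x).symm y)

/-- The exterior derivative of an `ℝ⁴`-valued one-form on a manifold: pull the form back to the
model space by the inverse of the chart at `x`, take the exterior derivative there, and pull the
result back to `M` by the chart. -/
def formDeriv (θ : ∀ x : M, HomBundle M x) (x : M) (v w : TangentSpace I4 x) : Col4 :=
  extDeriv
    (fun y => ContinuousAlternatingMap.ofSubsingleton ℝ Model4 Col4 (0 : Fin 1)
      (formInChart θ x y))
    (extChartAt I4 x x)
    ![mfderiv I4 𝓘(ℝ, Model4) (extChartAt I4 x) x v,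
      mfderiv I4 𝓘(ℝ, Model4) (extChartAt I4 x) x w]

/-- `(θⁱ ∧ θʲ)(v, w)` for the components of an `ℝ⁴`-valued covector. -/
def wedge {x : M} (α : HomBundle M x) (i j : Fin 4) (v w : TangentSpace I4 x) : ℝ :=
  (α v : Col4) i * (α w : Col4) j - (α w : Col4) i * (α v : Col4) j

/-- `T k i j`, for `i < j`, are the coefficients of `dθᵏ = ∑_{i<j} Tᵏ_{ij} θⁱ ∧ θʲ` on `U`. -/
def IsTorsionOn (θ : ∀ x : M, HomBundle M x) (U : Set M)
    (T : Fin 4 → Fin 4 → Fin 4 → M → ℝ) : Prop :=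
  ∀ x ∈ U, ∀ (v w : TangentSpace I4 x) (k : Fin 4),
    formDeriv θ x v w k = ∑ i, ∑ j ∈ Finset.Ioi i, T k i j x * wedge (θ x) i j v w

/-- The left multiplication of a coframe by a matrix. -/
def matMul (g : Matrix (Fin 4) (Fin 4) ℝ) {x : M} (b : HomBundle M x) : HomBundle M x :=
  (LinearMap.toContinuousLinearMap g.mulVecLin : Col4 →L[ℝ] Col4).comp b

/-- `B` is a `G`-structure on `M`: a set of coframes whose fibres are orbits of `G` and which has
smooth local sections through every point of `M`. -/
structure IsGStructure [IsManifold I4 ∞ M] (G : Subgroup (GL (Fin 4) ℝ)) (B : Set (HomTotal M)) :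
    Prop where
  isCoframe : ∀ b ∈ B, Function.Bijective b.2
  mul_mem : ∀ (x : M) (b : HomBundle M x) (g : GL (Fin 4) ℝ), g ∈ G →
    (⟨x, b⟩ : HomTotal M) ∈ B → (⟨x, matMul g.1 b⟩ : HomTotal M) ∈ B
  transitive : ∀ (x : M) (b b' : HomBundle M x), (⟨x, b⟩ : HomTotal M) ∈ B →
    (⟨x, b'⟩ : HomTotal M) ∈ B → ∃ g ∈ G, b' = matMul g.1 b
  exists_section : ∀ x : M, ∃ U : Set M, IsOpen U ∧ x ∈ U ∧ ∃ η : ∀ y : M, HomBundle M y,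
    SmoothFormOn η U ∧ ∀ y ∈ U, (⟨y, η y⟩ : HomTotal M) ∈ B

/-- The map `b ↦ b ∘ (df)⁻¹` on coframes induced by a diffeomorphism `f`. -/
def pushCoframe {N : Type*} [TopologicalSpace N] [ChartedSpace Model4 N] (f : M → N)
    (b : HomTotal M) : HomTotal N :=
  ⟨f b.1, ContinuousLinearMap.comp b.2 (mfderiv I4 I4 f b.1).inverse⟩

variable [IsManifold I4 ∞ M]

/-- The projection `B → M` of a set of coframes. -/
def projOn (B : Set (HomTotal M)) (b : B) : M := b.1.1

/-- The tautological one-form `Ω_b(v) = b(dπ v)` on a set `B` of coframes that is given the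
structure of a manifold. -/
def tautological (B : Set (HomTotal M)) [ChartedSpace Model4 B] (b : B) : HomBundle B b :=
  ContinuousLinearMap.comp b.1.2 (mfderiv I4 I4 (projOn B) b)

end Forms

/-- The matrices that preserve the nonholonomic geometry of an Engel distribution. -/
def G0 : Set (Matrix (Fin 4) (Fin 4) ℝ) :=
  {g | ∃ A ∈ Matrix.orthogonalGroup (Fin 2) ℝ, ∃ B₁ B₂ a₃₃ a₃₄ a₄₄ : ℝ, a₃₃ * a₄₄ ≠ 0 ∧
    g = !![A 0 0, A 0 1, 0,   B₁;
           A 1 0, A 1 1, 0,   B₂;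
           0,     0,     a₃₃, a₃₄;
           0,     0,     0,   a₄₄]}

/-- The diagonal matrix `diag(ε₁ε₂, ε₂, ε₁, ε₁ε₂)`. -/
def signMatrix (ε₁ ε₂ : ℤˣ) : Matrix (Fin 4) (Fin 4) ℝ :=
  Matrix.diagonal fun i => (((![ε₁ * ε₂, ε₂, ε₁, ε₁ * ε₂] i : ℤˣ) : ℤ) : ℝ)

theorem signMatrix_mul (ε₁ ε₂ δ₁ δ₂ : ℤˣ) :
    signMatrix ε₁ ε₂ * signMatrix δ₁ δ₂ = signMatrix (ε₁ * δ₁) (ε₂ * δ₂) := by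
  unfold signMatrix
  rw [Matrix.diagonal_mul_diagonal]
  congr 1
  funext i
  fin_cases i <;> simp <;> ring

theorem signMatrix_one : signMatrix 1 1 = 1 := by
  unfold signMatrix
  rw [← Matrix.diagonal_one]
  congr 1
  funext i
  fin_cases i <;> simp

/-- The group of all matrices `diag(ε₁ε₂, ε₂, ε₁, ε₁ε₂)` with `ε₁, ε₂ ∈ {1, -1}`. -/
def Gfinal : Subgroup (GL (Fin 4) ℝ) where
  carrier := {g | ∃ ε₁ ε₂ : ℤˣ, g.1 = signMatrix ε₁ ε₂}
  mul_mem' := by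
    rintro a b ⟨ε₁, ε₂, h⟩ ⟨δ₁, δ₂, h'⟩
    exact ⟨ε₁ * δ₁, ε₂ * δ₂, by rw [Units.val_mul, h, h', signMatrix_mul]⟩
  one_mem' := ⟨1, 1, by rw [signMatrix_one]; rfl⟩
  inv_mem' := by
    rintro a ⟨ε₁, ε₂, h⟩
    have : a * a = 1 := by
      apply Units.ext
      rw [Units.val_mul, h, signMatrix_mul, Int.units_mul_self, Int.units_mul_self,
        signMatrix_one]
      rfl
    rw [inv_eq_of_mul_eq_one_right this]
    exact ⟨ε₁, ε₂, h⟩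

/-- The vector fields `X` and `Y` form a smooth frame of the distribution `H` on `U`. -/
structure IsFrameOn {Q : Type*} [TopologicalSpace Q] [ChartedSpace Model4 Q] [IsManifold I4 ∞ Q]
    (H : ∀ x : Q, Submodule ℝ (TangentSpace I4 x)) (U : Set Q)
    (X Y : ∀ x : Q, TangentSpace I4 x) : Prop where
  smooth_left : SmoothFieldOn X U
  smooth_right : SmoothFieldOn Y U
  linearIndependent : ∀ x ∈ U, LinearIndependent ℝ ![X x, Y x]
  span_eq : ∀ x ∈ U, Submodule.span ℝ {X x, Y x} = H x

/-- A nonholonomic Engel structure on a `4`-manifold: a smooth Riemannian metric and a smooth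
rank two distribution `H` such that for all fields `X`, `Y` locally spanning `H` there are functions
`a`, `b` for which `X`, `Y`, `Z = [X, Y]`, `a [X, Z] + b [Y, Z]` is a frame. -/
structure EngelStructure (Q : Type*) [TopologicalSpace Q] [ChartedSpace Model4 Q]
    [IsManifold I4 ∞ Q] where
  metric : ContMDiffRiemannianMetric I4 ∞ Model4 (fun x : Q => TangentSpace I4 x)
  H : ∀ x : Q, Submodule ℝ (TangentSpace I4 x)
  exists_frame : ∀ x : Q, ∃ U : Set Q, IsOpen U ∧ x ∈ U ∧ ∃ X Y, IsFrameOn H U X Y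
  engel : ∀ U : Set Q, IsOpen U → ∀ X Y, IsFrameOn H U X Y → ∃ a b : Q → ℝ, ∀ x ∈ U,
    LinearIndependent ℝ ![X x, Y x, mlieBracket I4 X Y x,
      a x • mlieBracket I4 X (mlieBracket I4 X Y) x +
        b x • mlieBracket I4 Y (mlieBracket I4 X Y) x]

namespace EngelStructure

variable {Q : Type*} [TopologicalSpace Q] [ChartedSpace Model4 Q] [IsManifold I4 ∞ Q]

/-- The distribution `H¹ = H + [H, H]`. Its annihilator is the first derived ideal. -/
def H1 (S : EngelStructure Q) (x : Q) : Submodule ℝ (TangentSpace I4 x) :=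
  S.H x ⊔ Submodule.span ℝ {w | ∃ U : Set Q, IsOpen U ∧ x ∈ U ∧
    ∃ X Y : ∀ y : Q, TangentSpace I4 y, SmoothFieldOn X U ∧ SmoothFieldOn Y U ∧
      (∀ y ∈ U, X y ∈ S.H y ∧ Y y ∈ S.H y) ∧ w = mlieBracket I4 X Y x}

/-- `η` is a coframe at `x`, orthonormal for the metric, such that `η³` and `η⁴` annihilate `H` and
`η⁴` annihilates `H¹`. -/
structure IsOrthonormalAdapted (S : EngelStructure Q) (x : Q) (η : HomBundle Q x) : Prop where
  orthonormal : ∀ v w : TangentSpace I4 x,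
    S.metric.inner x v w = ∑ i, (η v : Col4) i * (η w : Col4) i
  annihilates_H : ∀ v ∈ S.H x, (η v : Col4) 2 = 0 ∧ (η v : Col4) 3 = 0
  annihilates_H1 : ∀ v ∈ S.H1 x, (η v : Col4) 3 = 0

/-- The initial `G₀`-structure `B₀`: all coframes `g η` with `g ∈ G₀` and `η` orthonormal and
adapted to `H` and `H¹`. -/
def B0 (S : EngelStructure Q) : Set (HomTotal Q) :=
  {b | ∃ g ∈ G0, ∃ η : HomBundle Q b.1, S.IsOrthonormalAdapted b.1 η ∧ b.2 = matMul g η}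

/-- The final reduction `B_final` of `B₀`: the coframes through which there is a smooth local
section `η` of `B₀` whose torsion `dηᵏ = ∑_{i<j} Tᵏ_{ij} ηⁱ ∧ ηʲ` is normalized by
`T³₁₂ = 1`, `(T⁴₁₃, T⁴₂₃) = (0, 1)` and `T¹₂₃ = T²₂₃ = T³₂₃ = 0`. -/
def Bfinal (S : EngelStructure Q) : Set (HomTotal Q) :=
  {b | ∃ U : Set Q, IsOpen U ∧ b.1 ∈ U ∧ ∃ η : ∀ y : Q, HomBundle Q y,
    SmoothFormOn η U ∧ (∀ y ∈ U, (⟨y, η y⟩ : HomTotal Q) ∈ S.B0) ∧ b.2 = η b.1 ∧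
    ∃ T : Fin 4 → Fin 4 → Fin 4 → Q → ℝ, IsTorsionOn η U T ∧ ∀ y ∈ U,
      T 2 0 1 y = 1 ∧ T 3 0 2 y = 0 ∧ T 3 1 2 y = 1 ∧
      T 0 1 2 y = 0 ∧ T 1 1 2 y = 0 ∧ T 2 1 2 y = 0}

/-- The diffeomorphism `f` is an isometry and carries the one distribution to the other. -/
def IsIsomorphism {Q' : Type*} [TopologicalSpace Q'] [ChartedSpace Model4 Q'] [IsManifold I4 ∞ Q']
    (S : EngelStructure Q) (S' : EngelStructure Q') (f : Q ≃ₘ^∞⟮I4, I4⟯ Q') : Prop :=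
  ∀ x : Q,
    (∀ v w : TangentSpace I4 x,
      S'.metric.inner (f x) (mfderiv I4 I4 f x v) (mfderiv I4 I4 f x w) = S.metric.inner x v w) ∧
    (S.H x).map (mfderiv I4 I4 f x).toLinearMap = S'.H (f x)

/-- The diffeomorphism `f` of `Q` is a symmetry of the nonholonomic geometry: the induced map of
coframes preserves the `G₀`-structure `B₀`. -/
def IsSymmetry (S : EngelStructure Q) (f : Q → Q) : Prop :=
  pushCoframe f '' S.B0 = S.B0

end EngelStructure

end

/-! Indices run from 0 to 3, and `e₀, …, e₃` is the frame dual to a coframe `η`. Since every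
`ηᵏ(eᵢ)` is constant, Cartan's formula gives `Tᵏᵢⱼ = -ηᵏ([eᵢ, eⱼ])`, so the normalizations are
conditions on brackets. They say that `[e₀, e₁]` has `e₂`-component `-1`, that `[e₁, e₂] = -e₃`, and
that `[e₀, e₂]` has no `e₃`-component, i.e. that `e₀` spans the Cauchy characteristic direction of
`H¹`.

These conditions determine the frame up to two signs. The Engel condition makes `dη³` nonzero on the
three-dimensional `H¹`, with a kernel that is a line inside `H`. Then `e₀` is a unit vector on this
line, `e₁` a unit vector of `H` orthogonal to it, `e₂` minus the component of `[e₀, e₁]` orthogonal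
to `H`, and `e₃ = -[e₁, e₂]`. Read as a construction, this is `exists_isNormalized`. The bridge to
the metric is `mem_B0_iff`: an adapted coframe lies in `B₀` exactly when its first two components
compute the inner products of `H` with `H¹`.

For uniqueness (`IsNormalized.exists_eventually_eq`) the `G₀`-valued transition matrix of two
normalized sections is fed into the transformation law of the torsion. The law is used only for
pairs of matrix entries that are already known to be locally constant, so no derivative of the
transition matrix occurs. The outcome is a locally constant sign matrix. Conversely `diag(s)`
multiplies `Tᵏᵢⱼ` by `sₖsᵢsⱼ`, and the two torsion coefficients normalized to 1 leave exactly the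
group `Gfinal`. Two coefficients are consequences: `T³₀₁ = 0` because `[H, H]` lies in `H¹`, and
`T³₀₃ = T¹₀₁ + T²₀₂` by the Jacobi identity for `e₀, e₁, e₂`.

Canonicity is naturality of `d`: a diffeomorphism that respects `B₀` pulls normalized sections back
to normalized sections, and `B₀` is recovered as `G₀ · B_final`. Since sections differ by locally
constant signs, the image of a normalized section is open in `B_final`. Hence the projection to `Q`
is a local homeomorphism, along which the charts of `Q` are lifted, and locally the tautological
form is the pull-back of a normalized section.

A symmetry that fixes a coframe in `B_final` preserves a normalized section near its base point.
Such a map is the identity nearby by a Grönwall estimate, and everywhere by connectedness. Hence an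
element of a Lie group of symmetries that stabilizes a point acts on the fibre by signs, its square
acts trivially, and effectiveness makes it an involution. A one-parameter family of involutions
through 1 has zero velocity, so orbit maps are immersions into a 4-manifold, which bounds the
dimension. -/

noncomputable section

/-! ### One-forms and their exterior derivative in charts. -/

section Calculus

variable {M : Type*} [TopologicalSpace M] [ChartedSpace Model4 M]

/-- An `ℝ⁴`-valued one-form is smooth at a point. -/
def SmoothFormAt [IsManifold I4 ∞ M] (θ : ∀ x : M, HomBundle M x) (x : M) : Prop :=
  ContMDiffAt I4 (I4.prod 𝓘(ℝ, Model4 →L[ℝ] Col4)) ∞ (fun y => (⟨y, θ y⟩ : HomTotal M)) x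

/-- A vector field is smooth at a point. -/
def SmoothFieldAt [IsManifold I4 ∞ M] (X : ∀ x : M, TangentSpace I4 x) (x : M) : Prop :=
  ContMDiffAt I4 I4.tangent ∞ (fun y => (⟨y, X y⟩ : TangentBundle I4 M)) x

theorem contMDiffAt_iff_chart {E : Type*} [NormedAddCommGroup E] [NormedSpace ℝ E]
    [IsManifold I4 ∞ M] {g : M → E} {x : M} :
    ContMDiffAt I4 𝓘(ℝ, E) ∞ g x ↔
      ContDiffAt ℝ ∞ (g ∘ (extChartAt I4 x).symm) (extChartAt I4 x x) := by
  rw [contMDiffAt_iff]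
  simp only [mfld_simps, contDiffWithinAt_univ]
  constructor
  · rintro ⟨-, h⟩; exact h
  · intro h
    refine ⟨?_, h⟩
    have h1 := h.continuousAt
    have h2 : ContinuousAt (extChartAt I4 x) x := continuousAt_extChartAt x
    have h3 := ContinuousAt.comp (f := extChartAt I4 x) (x := x) (by simpa [mfld_simps] using h1) h2
    refine h3.congr ?_
    filter_upwards [extChartAt_source_mem_nhds (I := I4) x] with y hy
    simpa using congrArg g ((extChartAt I4 x).left_inv hy)

variable [IsManifold I4 ∞ M]

/-- `∞ + 1` unfolds to `∞`; the lemma on smoothness of Lie brackets asks for this form of the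
instance. -/
theorem isManifold_top_add_one : IsManifold I4 (((⊤ : ℕ∞) : WithTop ℕ∞) + 1) M :=
  ‹IsManifold I4 ∞ M›

/-- The trivialization of the tangent bundle at `x` is the derivative of the chart at `x`, and the
target bundle is trivial. This links smoothness of sections of the hom bundle to the concrete
representative `formInChart`. -/
theorem inCoordinates_form (θ : ∀ x : M, HomBundle M x) {x y : M}
    (hy : y ∈ (extChartAt I4 x).source) :
    ContinuousLinearMap.inCoordinates Model4 (TangentSpace I4 : M → Type _) Col4
      (Bundle.Trivial M Col4) x y x y (θ y) = formInChart θ x (extChartAt I4 x y) := by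
  have hy' : y ∈ (chartAt Model4 x).source := by simpa using hy
  have h1 : (trivializationAt Model4 (TangentSpace I4) x).symmL ℝ y =
      mfderiv 𝓘(ℝ, Model4) I4 (extChartAt I4 x).symm (extChartAt I4 x y) := by
    rw [TangentBundle.symmL_trivializationAt hy']
    simp only [modelWithCornersSelf_coe, range_id, mfderivWithin_univ]
    rfl
  ext1 v
  have h2 : (trivializationAt Model4 (TangentSpace I4) x).symmL ℝ y v =
      mfderiv 𝓘(ℝ, Model4) I4 (extChartAt I4 x).symm (extChartAt I4 x y) v :=
    congrArg (fun L : Model4 →L[ℝ] Model4 => L v) h1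
  have h3 := congrArg (fun L : Col4 →L[ℝ] Col4 => L (θ y
      ((trivializationAt Model4 (TangentSpace I4) x).symmL ℝ y v)))
    (Bundle.Trivial.continuousLinearMapAt_trivialization ℝ M Col4 y)
  refine h3.trans ?_
  change θ y ((trivializationAt Model4 (TangentSpace I4) x).symmL ℝ y v) =
    (θ : M → Model4 →L[ℝ] Col4) ((extChartAt I4 x).symm (extChartAt I4 x y))
      (mfderiv 𝓘(ℝ, Model4) I4 (extChartAt I4 x).symm (extChartAt I4 x y) v)
  rw [(extChartAt I4 x).left_inv hy, h2]
  rfl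

theorem smoothFormAt_iff {θ : ∀ x : M, HomBundle M x} {x : M} :
    SmoothFormAt θ x ↔ ContDiffAt ℝ ∞ (formInChart θ x) (extChartAt I4 x x) := by
  unfold SmoothFormAt
  rw [contMDiffAt_hom_bundle]
  have hid : ContMDiffAt I4 I4 ∞ (fun y : M => y) x := contMDiffAt_id
  simp only [hid, true_and]
  rw [contMDiffAt_iff_chart]
  suffices h : (fun y : M => ContinuousLinearMap.inCoordinates Model4 (TangentSpace I4 : M → Type _)
      Col4 (Bundle.Trivial M Col4) x y x y (θ y)) ∘ (extChartAt I4 x).symm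
      =ᶠ[𝓝 (extChartAt I4 x x)] formInChart θ x from
    ⟨fun H => H.congr_of_eventuallyEq h.symm, fun H => H.congr_of_eventuallyEq h⟩
  filter_upwards [extChartAt_target_mem_nhds (I := I4) x] with u hu
  simp only [Function.comp]
  rw [inCoordinates_form θ ((extChartAt I4 x).map_target hu), (extChartAt I4 x).right_inv hu]

theorem extDeriv_ofSubsingleton {E F : Type*} [NormedAddCommGroup E] [NormedSpace ℝ E]
    [NormedAddCommGroup F] [NormedSpace ℝ F] {A : E → E →L[ℝ] F} {u : E}
    (hA : DifferentiableAt ℝ A u) (v w : E) :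
    extDeriv (fun y => ContinuousAlternatingMap.ofSubsingleton ℝ E F (0 : Fin 1) (A y)) u ![v, w] =
      fderiv ℝ A u v w - fderiv ℝ A u w v := by
  have h1 : DifferentiableAt ℝ
      (fun y => ContinuousAlternatingMap.ofSubsingleton ℝ E F (0 : Fin 1) (A y)) u :=
    ((ContinuousAlternatingMap.ofSubsingletonLIE (𝕜 := ℝ) (ι := Fin 1) (E := E) (F := F)
      (i := 0)).toContinuousLinearEquiv.differentiableAt (x := A u)).comp u hA
  have h2 : ∀ z, fderiv ℝ (fun y => A y z) u = (fderiv ℝ A u).flip z := fun z => by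
    rw [fderiv_clm_apply hA (differentiableAt_const z)]
    simp
  rw [extDeriv_apply h1, Fin.sum_univ_two]
  simp [Fin.removeNth, h2, sub_eq_add_neg]

omit [IsManifold I4 ∞ M] in
theorem formDeriv_eq {θ : ∀ x : M, HomBundle M x} {x : M}
    (hθ : DifferentiableAt ℝ (formInChart θ x) (extChartAt I4 x x)) (v w : TangentSpace I4 x) :
    formDeriv θ x v w =
      fderiv ℝ (formInChart θ x) (extChartAt I4 x x)
          (mfderiv I4 𝓘(ℝ, Model4) (extChartAt I4 x) x v)
          (mfderiv I4 𝓘(ℝ, Model4) (extChartAt I4 x) x w) -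
        fderiv ℝ (formInChart θ x) (extChartAt I4 x x)
          (mfderiv I4 𝓘(ℝ, Model4) (extChartAt I4 x) x w)
          (mfderiv I4 𝓘(ℝ, Model4) (extChartAt I4 x) x v) := by
  exact extDeriv_ofSubsingleton hθ _ _

/-! ### Naturality of the exterior derivative. -/

section Pullback

variable {N : Type*} [TopologicalSpace N] [ChartedSpace Model4 N] [IsManifold I4 ∞ N]

/-- The pull-back of an `ℝ⁴`-valued one-form. -/
def pullForm (f : M → N) (θ : ∀ y : N, HomBundle N y) (x : M) : HomBundle M x :=
  ContinuousLinearMap.comp (θ (f x)) (mfderiv I4 I4 f x)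

/-- A map between `4`-manifolds in the charts at `x` and `f x`. -/
def chartRep (f : M → N) (x : M) (u : Model4) : Model4 :=
  extChartAt I4 (f x) (f ((extChartAt I4 x).symm u))

omit [IsManifold I4 ∞ M] [IsManifold I4 ∞ N] in
theorem contDiffAt_chartRep {f : M → N} {x : M} (hf : ContMDiffAt I4 I4 ∞ f x) :
    ContDiffAt ℝ ∞ (chartRep f x) (extChartAt I4 x x) := by
  have h := (contMDiffAt_iff.1 hf).2
  rw [modelWithCornersSelf_coe, range_id, contDiffWithinAt_univ] at h
  exact h

theorem mdifferentiableAt_extChartAt_symm_of_mem {x : M} {u : Model4}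
    (hu : u ∈ (extChartAt I4 x).target) :
    MDifferentiableAt 𝓘(ℝ, Model4) I4 (extChartAt I4 x).symm u := by
  have h := mdifferentiableWithinAt_extChartAt_symm (I := I4) hu
  rwa [modelWithCornersSelf_coe, range_id, mdifferentiableWithinAt_univ] at h

/-- The chain rule for the two factorizations `f ∘ φ⁻¹ = ψ⁻¹ ∘ chartRep f x`, where `φ` and `ψ` are
the charts. It is needed on a neighbourhood, since the pulled-back form is differentiated
afterwards. -/
theorem eventually_mfderiv_chartRep {f : M → N} {x : M} (hf : ContMDiffAt I4 I4 ∞ f x) :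
    ∀ᶠ u in 𝓝 (extChartAt I4 x x), ∀ v : Model4,
      (mfderiv I4 I4 f ((extChartAt I4 x).symm u)
          (mfderiv 𝓘(ℝ, Model4) I4 (extChartAt I4 x).symm u v) : Model4) =
        mfderiv 𝓘(ℝ, Model4) I4 (extChartAt I4 (f x)).symm (chartRep f x u)
          (fderiv ℝ (chartRep f x) u v) := by
  have hcont : ContinuousAt (extChartAt I4 x).symm (extChartAt I4 x x) :=
    continuousAt_extChartAt_symm x
  have hx : (extChartAt I4 x).symm (extChartAt I4 x x) = x := extChartAt_to_inv x
  have h1 : ∀ᶠ y in 𝓝 x, MDifferentiableAt I4 I4 f y := by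
    have : ContMDiffAt I4 I4 1 f x := hf.of_le (by norm_cast)
    filter_upwards [(contMDiffAt_iff_contMDiffAt_nhds (by simp)).1 this] with y hy using hy.mdifferentiableAt one_ne_zero
  have h2 : ∀ᶠ y in 𝓝 x, f y ∈ (extChartAt I4 (f x)).source :=
    hf.continuousAt.eventually (extChartAt_source_mem_nhds (I := I4) (f x))
  rw [ContinuousAt, hx] at hcont
  have h1' := hcont.eventually h1
  have h2' := hcont.eventually h2
  have h3 := extChartAt_target_mem_nhds (I := I4) x
  have h4 : ∀ᶠ u in 𝓝 (extChartAt I4 x x), DifferentiableAt ℝ (chartRep f x) u := by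
    have : ContDiffAt ℝ 1 (chartRep f x) (extChartAt I4 x x) :=
      (contDiffAt_chartRep hf).of_le (by norm_cast)
    filter_upwards [this.eventually (by simp)] with u hu using hu.differentiableAt one_ne_zero
  filter_upwards [h1', h2'.eventually_nhds, h3, h4] with u hu1 hu2 hu3 hu4 v
  have hF : chartRep f x u ∈ (extChartAt I4 (f x)).target :=
    (extChartAt I4 (f x)).map_source hu2.self_of_nhds
  have e1 := mfderiv_comp (I := 𝓘(ℝ, Model4)) (I' := I4) (I'' := I4) u hu1
    (mdifferentiableAt_extChartAt_symm_of_mem hu3)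
  have e2 := mfderiv_comp (I := 𝓘(ℝ, Model4)) (I' := 𝓘(ℝ, Model4)) (I'' := I4) u
    (mdifferentiableAt_extChartAt_symm_of_mem hF) hu4.mdifferentiableAt
  have e3 : (f ∘ (extChartAt I4 x).symm) =ᶠ[𝓝 u] ((extChartAt I4 (f x)).symm ∘ chartRep f x) := by
    filter_upwards [hu2] with z hz
    exact ((extChartAt I4 (f x)).left_inv hz).symm
  have e4 : (mfderiv 𝓘(ℝ, Model4) I4 (f ∘ (extChartAt I4 x).symm) u : Model4 →L[ℝ] Model4) =
    mfderiv 𝓘(ℝ, Model4) I4 ((extChartAt I4 (f x)).symm ∘ chartRep f x) u := e3.mfderiv_eq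
  have e5 := congrArg (fun L : Model4 →L[ℝ] Model4 => L v) (e1.symm.trans (e4.trans e2))
  simp only [mfderiv_eq_fderiv] at e5
  exact e5

theorem formInChart_pullForm {f : M → N} {x : M} (hf : ContMDiffAt I4 I4 ∞ f x)
    (θ : ∀ y : N, HomBundle N y) :
    formInChart (pullForm f θ) x =ᶠ[𝓝 (extChartAt I4 x x)]
      fun u => (formInChart θ (f x) (chartRep f x u)).comp (fderiv ℝ (chartRep f x) u) := by
  have hcont : ContinuousAt (extChartAt I4 x).symm (extChartAt I4 x x) :=
    continuousAt_extChartAt_symm x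
  have hx : (extChartAt I4 x).symm (extChartAt I4 x x) = x := extChartAt_to_inv x
  have h2 : ∀ᶠ y in 𝓝 x, f y ∈ (extChartAt I4 (f x)).source :=
    hf.continuousAt.eventually (extChartAt_source_mem_nhds (I := I4) (f x))
  rw [ContinuousAt, hx] at hcont
  have h2' := hcont.eventually h2
  filter_upwards [eventually_mfderiv_chartRep hf, h2'] with u hu hu2
  ext1 v
  change (θ : N → Model4 →L[ℝ] Col4) (f ((extChartAt I4 x).symm u))
      (mfderiv I4 I4 f ((extChartAt I4 x).symm u)
          (mfderiv 𝓘(ℝ, Model4) I4 (extChartAt I4 x).symm u v)) =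
    (θ : N → Model4 →L[ℝ] Col4) ((extChartAt I4 (f x)).symm (chartRep f x u))
      (mfderiv 𝓘(ℝ, Model4) I4 (extChartAt I4 (f x)).symm (chartRep f x u)
          (fderiv ℝ (chartRep f x) u v))
  have e : (extChartAt I4 (f x)).symm (chartRep f x u) = f ((extChartAt I4 x).symm u) :=
    (extChartAt I4 (f x)).left_inv hu2
  have hu' := congrArg (fun z => (θ : N → Model4 →L[ℝ] Col4) (f ((extChartAt I4 x).symm u)) z) (hu v)
  refine hu'.trans ?_
  rw [e]

omit [IsManifold I4 ∞ M] [IsManifold I4 ∞ N] in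
theorem chartRep_self (f : M → N) (x : M) :
    chartRep f x (extChartAt I4 x x) = extChartAt I4 (f x) (f x) := by
  unfold chartRep
  rw [extChartAt_to_inv]

theorem SmoothFormAt.pullForm {f : M → N} {x : M} (hf : ContMDiffAt I4 I4 ∞ f x)
    {θ : ∀ y : N, HomBundle N y} (hθ : SmoothFormAt θ (f x)) : SmoothFormAt (pullForm f θ) x := by
  rw [smoothFormAt_iff] at hθ ⊢
  refine ContDiffAt.congr_of_eventuallyEq ?_ (formInChart_pullForm hf θ)
  have h := contDiffAt_chartRep hf
  rw [← chartRep_self] at hθ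
  exact (hθ.comp _ h).clm_comp (h.fderiv_right (m := ∞) (by rfl))

theorem mfderiv_extChartAt_comp {f : M → N} {x : M} (hf : ContMDiffAt I4 I4 ∞ f x)
    (v : TangentSpace I4 x) :
    fderiv ℝ (chartRep f x) (extChartAt I4 x x) (mfderiv I4 𝓘(ℝ, Model4) (extChartAt I4 x) x v) =
      mfderiv I4 𝓘(ℝ, Model4) (extChartAt I4 (f x)) (f x) (mfderiv I4 I4 f x v) := by
  have hd : MDifferentiableAt I4 I4 f x := hf.mdifferentiableAt (by simp)
  have h4 : DifferentiableAt ℝ (chartRep f x) (extChartAt I4 x x) :=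
    (contDiffAt_chartRep hf).differentiableAt (by simp)
  have e1 := mfderiv_comp (I := I4) (I' := I4) (I'' := 𝓘(ℝ, Model4)) x
    (mdifferentiableAt_extChartAt (I := I4) (mem_chart_source Model4 (f x))) hd
  have e2 := mfderiv_comp (I := I4) (I' := 𝓘(ℝ, Model4)) (I'' := 𝓘(ℝ, Model4)) x
    h4.mdifferentiableAt (mdifferentiableAt_extChartAt (I := I4) (mem_chart_source Model4 x))
  have e3 : (extChartAt I4 (f x)) ∘ f =ᶠ[𝓝 x] chartRep f x ∘ extChartAt I4 x := by
    filter_upwards [extChartAt_source_mem_nhds (I := I4) x] with y hy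
    simp only [Function.comp, chartRep, (extChartAt I4 x).left_inv hy]
  have e4 : (mfderiv I4 𝓘(ℝ, Model4) ((extChartAt I4 (f x)) ∘ f) x : Model4 →L[ℝ] Model4) =
    mfderiv I4 𝓘(ℝ, Model4) (chartRep f x ∘ extChartAt I4 x) x := e3.mfderiv_eq
  have e5 := congrArg (fun L : Model4 →L[ℝ] Model4 => L v) (e1.symm.trans (e4.trans e2))
  simp only [mfderiv_eq_fderiv] at e5
  exact e5.symm

/-- The product rule produces one extra term with the second derivative of `g`; it is symmetric and
cancels in the difference. This is `d(g*A) = g*(dA)` in a vector space. -/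
theorem fderiv_comp_fderiv_sub {E F : Type*} [NormedAddCommGroup E] [NormedSpace ℝ E]
    [NormedAddCommGroup F] [NormedSpace ℝ F] {A : E → E →L[ℝ] F} {g : E → E} {u : E}
    (hg : ContDiffAt ℝ ∞ g u) (hA : DifferentiableAt ℝ A (g u)) (v w : E) :
    fderiv ℝ (fun u => (A (g u)).comp (fderiv ℝ g u)) u v w -
        fderiv ℝ (fun u => (A (g u)).comp (fderiv ℝ g u)) u w v =
      fderiv ℝ A (g u) (fderiv ℝ g u v) (fderiv ℝ g u w) -
        fderiv ℝ A (g u) (fderiv ℝ g u w) (fderiv ℝ g u v) := by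
  have h2 : DifferentiableAt ℝ g u := hg.differentiableAt (by simp)
  have h3 : DifferentiableAt ℝ (fderiv ℝ g) u :=
    (hg.fderiv_right (m := ∞) (by rfl)).differentiableAt (by simp)
  have h4 := (hA.hasFDerivAt.comp _ h2.hasFDerivAt).clm_comp h3.hasFDerivAt
  have h5 : fderiv ℝ (fun u => (A (g u)).comp (fderiv ℝ g u)) u = _ := h4.fderiv
  have hs : IsSymmSndFDerivAt ℝ g u := hg.isSymmSndFDerivAt (by simp; norm_cast)
  rw [h5]
  simp [hs.eq v w]

theorem formDeriv_pullForm {f : M → N} {x : M} (hf : ContMDiffAt I4 I4 ∞ f x)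
    {θ : ∀ y : N, HomBundle N y} (hθ : SmoothFormAt θ (f x)) (v w : TangentSpace I4 x) :
    formDeriv (pullForm f θ) x v w =
      formDeriv θ (f x) (mfderiv I4 I4 f x v) (mfderiv I4 I4 f x w) := by
  have hθ' := smoothFormAt_iff.1 hθ
  have hF := contDiffAt_chartRep hf
  have hp := smoothFormAt_iff.1 (hθ.pullForm hf)
  rw [formDeriv_eq (hθ'.differentiableAt (by simp)), formDeriv_eq (hp.differentiableAt (by simp)),
    (formInChart_pullForm hf θ).fderiv_eq]
  have hd := hθ'.differentiableAt (by simp)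
  rw [← chartRep_self] at hd
  refine (fderiv_comp_fderiv_sub hF hd (mfderiv I4 𝓘(ℝ, Model4) (extChartAt I4 x) x v)
    (mfderiv I4 𝓘(ℝ, Model4) (extChartAt I4 x) x w)).trans ?_
  rw [mfderiv_extChartAt_comp hf, mfderiv_extChartAt_comp hf, chartRep_self]

end Pullback

/-! ### Cartan's formula. -/

section LieBracket

theorem mfderiv_extChartAt_symm_isInvertible {x : M} {u : Model4}
    (hu : u ∈ (extChartAt I4 x).target) :
    (mfderiv 𝓘(ℝ, Model4) I4 (extChartAt I4 x).symm u).IsInvertible := by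
  have h := isInvertible_mfderivWithin_extChartAt_symm (I := I4) hu
  rwa [modelWithCornersSelf_coe, range_id, mfderivWithin_univ] at h

/-- A vector field in the chart at `x`. -/
def fieldInChart (V : ∀ x : M, TangentSpace I4 x) (x : M) (u : Model4) : Model4 :=
  mpullbackWithin 𝓘(ℝ, Model4) I4 (extChartAt I4 x).symm V (range I4) u

theorem formInChart_fieldInChart (θ : ∀ x : M, HomBundle M x) (V : ∀ x : M, TangentSpace I4 x)
    {x : M} {u : Model4} (hu : u ∈ (extChartAt I4 x).target) :
    formInChart θ x u (fieldInChart V x u) =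
      θ ((extChartAt I4 x).symm u) (V ((extChartAt I4 x).symm u)) := by
  unfold formInChart fieldInChart
  rw [mpullbackWithin_apply, modelWithCornersSelf_coe, range_id, mfderivWithin_univ]
  change θ ((extChartAt I4 x).symm u) (mfderiv 𝓘(ℝ, Model4) I4 (extChartAt I4 x).symm u
    ((mfderiv 𝓘(ℝ, Model4) I4 (extChartAt I4 x).symm u).inverse _)) = _
  rw [(mfderiv_extChartAt_symm_isInvertible hu).self_apply_inverse]

theorem differentiableAt_fieldInChart {V : ∀ x : M, TangentSpace I4 x} {x : M}
    (hV : SmoothFieldAt V x) : DifferentiableAt ℝ (fieldInChart V x) (extChartAt I4 x x) := by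
  have h : MDifferentiableAt I4 I4.tangent (fun y => (⟨y, V y⟩ : TangentBundle I4 M)) x :=
    hV.mdifferentiableAt (by simp)
  have h2 := (mdifferentiableWithinAt_univ.2 h).differentiableWithinAt_mpullbackWithin_vectorField
  rw [preimage_univ, univ_inter] at h2
  have h3 : DifferentiableWithinAt ℝ (fieldInChart V x) (range I4) (extChartAt I4 x x) := h2
  rwa [modelWithCornersSelf_coe, range_id, differentiableWithinAt_univ] at h3

omit [IsManifold I4 ∞ M] in
theorem mfderiv_extChartAt_symm_apply [IsManifold I4 1 M] {x y : M}
    (hy : y ∈ (extChartAt I4 x).source) (v : TangentSpace I4 y) :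
    (mfderiv 𝓘(ℝ, Model4) I4 (extChartAt I4 x).symm (extChartAt I4 x y)
      (mfderiv I4 𝓘(ℝ, Model4) (extChartAt I4 x) y v) : Model4) = v := by
  have h := mfderivWithin_extChartAt_symm_comp_mfderiv_extChartAt' (I := I4) hy
  rw [modelWithCornersSelf_coe, range_id, mfderivWithin_univ] at h
  exact congrArg (fun L : Model4 →L[ℝ] Model4 => L v) h

theorem mfderiv_extChartAt_field (V : ∀ x : M, TangentSpace I4 x) (x : M) :
    mfderiv I4 𝓘(ℝ, Model4) (extChartAt I4 x) x (V x) =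
      fieldInChart V x (extChartAt I4 x x) := by
  unfold fieldInChart
  rw [mpullbackWithin_apply, modelWithCornersSelf_coe, range_id, mfderivWithin_univ]
  refine ((mfderiv_extChartAt_symm_isInvertible (mem_extChartAt_target x)).inverse_apply_eq.2 ?_).symm
  have h := mfderiv_extChartAt_symm_apply (mem_extChartAt_source (I := I4) x) (V x)
  refine Eq.trans ?_ h.symm
  exact congrArg (V : M → Model4) (extChartAt_to_inv x)

theorem mfderiv_extChartAt_mlieBracket (V W : ∀ x : M, TangentSpace I4 x) (x : M) :
    mfderiv I4 𝓘(ℝ, Model4) (extChartAt I4 x) x (mlieBracket I4 V W x) =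
      lieBracket ℝ (fieldInChart V x) (fieldInChart W x) (extChartAt I4 x x) := by
  rw [← mlieBracketWithin_univ, mlieBracketWithin_apply]
  refine ((isInvertible_mfderiv_extChartAt
    (mem_extChartAt_source (I := I4) x)).self_apply_inverse _).trans ?_
  have e : range I4 = univ := by rw [modelWithCornersSelf_coe, range_id]
  rw [preimage_univ, univ_inter]
  change lieBracketWithin ℝ (fieldInChart V x) (fieldInChart W x) (range I4) _ = _
  rw [e, lieBracketWithin_univ]

omit [IsManifold I4 ∞ M] in
theorem formInChart_mfderiv_extChartAt [IsManifold I4 1 M] (θ : ∀ x : M, HomBundle M x) (x : M)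
    (v : TangentSpace I4 x) :
    formInChart θ x (extChartAt I4 x x) (mfderiv I4 𝓘(ℝ, Model4) (extChartAt I4 x) x v) =
      θ x v := by
  change (θ : M → Model4 →L[ℝ] Col4) ((extChartAt I4 x).symm (extChartAt I4 x x))
    (mfderiv 𝓘(ℝ, Model4) I4 (extChartAt I4 x).symm (extChartAt I4 x x)
      (mfderiv I4 𝓘(ℝ, Model4) (extChartAt I4 x) x v)) = _
  rw [mfderiv_extChartAt_symm_apply (mem_extChartAt_source (I := I4) x), extChartAt_to_inv]

/-- In `dθ(V, W) = V(θ W) - W(θ V) - θ([V, W])` the first two terms vanish for a component that is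
locally constant on both fields. Constancy is required only of the component `k` in question. -/
theorem formDeriv_field {θ : ∀ x : M, HomBundle M x} {x : M} (hθ : SmoothFormAt θ x)
    {V W : ∀ x : M, TangentSpace I4 x} (hV : SmoothFieldAt V x) (hW : SmoothFieldAt W x)
    {k : Fin 4} {c c' : ℝ} (hc : ∀ᶠ y in 𝓝 x, (θ y (V y) : Col4) k = c)
    (hc' : ∀ᶠ y in 𝓝 x, (θ y (W y) : Col4) k = c') :
    formDeriv θ x (V x) (W x) k = - (θ x (mlieBracket I4 V W x) : Col4) k := by
  have hA := (smoothFormAt_iff.1 hθ).differentiableAt (by simp)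
  -- Differentiating the locally constant function `θᵏ(V)` in the chart trades a derivative of the
  -- form for a derivative of the field.
  have key : ∀ {V : ∀ x : M, TangentSpace I4 x} {c : ℝ}, SmoothFieldAt V x →
      (∀ᶠ y in 𝓝 x, (θ y (V y) : Col4) k = c) → ∀ w : Model4,
      (fderiv ℝ (formInChart θ x) (extChartAt I4 x x) w (fieldInChart V x (extChartAt I4 x x))) k
        = - (formInChart θ x (extChartAt I4 x x)
          (fderiv ℝ (fieldInChart V x) (extChartAt I4 x x) w)) k := by
    intro V c hV hc w
    have hd := differentiableAt_fieldInChart hV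
    have h1 := hA.hasFDerivAt.clm_apply hd.hasFDerivAt
    have hp : HasFDerivAt (fun z : Col4 => z k)
      (ContinuousLinearMap.proj (R := ℝ) (φ := fun _ : Fin 4 => ℝ) k)
      (formInChart θ x (extChartAt I4 x x) (fieldInChart V x (extChartAt I4 x x))) :=
      (ContinuousLinearMap.proj (R := ℝ) (φ := fun _ : Fin 4 => ℝ) k).hasFDerivAt
    have h2 := HasFDerivAt.comp (f := fun u => formInChart θ x u (fieldInChart V x u))
      (extChartAt I4 x x) hp h1
    have h3 : ∀ᶠ u in 𝓝 (extChartAt I4 x x),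
        formInChart θ x u (fieldInChart V x u) k = c := by
      have hcont : ContinuousAt (extChartAt I4 x).symm (extChartAt I4 x x) :=
        continuousAt_extChartAt_symm x
      rw [ContinuousAt, extChartAt_to_inv] at hcont
      filter_upwards [hcont.eventually hc, extChartAt_target_mem_nhds (I := I4) x] with u hu hu'
      rw [← hu]
      exact congrFun (formInChart_fieldInChart θ V hu') k
    have h4 := (hasFDerivAt_const (𝕜 := ℝ) c (extChartAt I4 x x)).congr_of_eventuallyEq h3
    have h5 := congrArg (fun L : Model4 →L[ℝ] ℝ => L w) (h2.unique h4)
    simp at h5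
    simp
    linarith
  rw [formDeriv_eq hA, mfderiv_extChartAt_field, mfderiv_extChartAt_field,
    ← formInChart_mfderiv_extChartAt θ x, mfderiv_extChartAt_mlieBracket]
  have h1 := key hV hc (fieldInChart W x (extChartAt I4 x x))
  have h2 := key hW hc' (fieldInChart V x (extChartAt I4 x x))
  have h3 : (formInChart θ x (extChartAt I4 x x)
      (lieBracket ℝ (fieldInChart V x) (fieldInChart W x) (extChartAt I4 x x))) k =
      formInChart θ x (extChartAt I4 x x) (fderiv ℝ (fieldInChart W x) (extChartAt I4 x x)
        (fieldInChart V x (extChartAt I4 x x))) k -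
      formInChart θ x (extChartAt I4 x x) (fderiv ℝ (fieldInChart V x) (extChartAt I4 x x)
        (fieldInChart W x (extChartAt I4 x x))) k := by
    rw [lieBracket_eq]
    exact congrFun (map_sub (formInChart θ x (extChartAt I4 x x)) _ _) k
  refine (congrArg₂ (· - ·) h2 h1).trans ?_
  rw [h3]
  ring

end LieBracket

end Calculus

/-! ### Smooth frames and their dual coframes. -/

section Frames

variable {M : Type*} [TopologicalSpace M] [ChartedSpace Model4 M] [IsManifold I4 ∞ M]

theorem mfderiv_extChartAt_field_of_mem (V : ∀ x : M, TangentSpace I4 x) {x y : M}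
    (hy : y ∈ (extChartAt I4 x).source) :
    mfderiv I4 𝓘(ℝ, Model4) (extChartAt I4 x) y (V y) =
      fieldInChart V x (extChartAt I4 x y) := by
  unfold fieldInChart
  rw [mpullbackWithin_apply, modelWithCornersSelf_coe, range_id, mfderivWithin_univ]
  refine ((mfderiv_extChartAt_symm_isInvertible
    ((extChartAt I4 x).map_source hy)).inverse_apply_eq.2 ?_).symm
  have h := mfderiv_extChartAt_symm_apply hy (V y)
  refine Eq.trans ?_ h.symm
  exact congrArg (V : M → Model4) ((extChartAt I4 x).left_inv hy)

/-- In the trivialization at `x` a vector field is its image under the derivative of the chart,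
which is the chart representative `fieldInChart`. -/
theorem smoothFieldAt_iff {V : ∀ x : M, TangentSpace I4 x} {x : M} :
    SmoothFieldAt V x ↔ ContDiffAt ℝ ∞ (fieldInChart V x) (extChartAt I4 x x) := by
  have h0 : SmoothFieldAt V x ↔ ContMDiffAt I4 𝓘(ℝ, Model4) ∞ (fun y =>
    (trivializationAt Model4 (TangentSpace I4) x (⟨y, V y⟩ : TangentBundle I4 M)).2) x :=
    contMDiffAt_section x
  rw [h0, contMDiffAt_iff_chart]
  suffices h : (fun y : M => (trivializationAt Model4 (TangentSpace I4) x
      (⟨y, V y⟩ : TangentBundle I4 M)).2) ∘ (extChartAt I4 x).symm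
      =ᶠ[𝓝 (extChartAt I4 x x)] fieldInChart V x from
    ⟨fun H => H.congr_of_eventuallyEq h.symm, fun H => H.congr_of_eventuallyEq h⟩
  filter_upwards [extChartAt_target_mem_nhds (I := I4) x] with u hu
  have hs := (extChartAt I4 x).map_target hu
  have h1 := mfderiv_extChartAt_field_of_mem V hs
  rw [(extChartAt I4 x).right_inv hu] at h1
  refine Eq.trans ?_ h1
  have hy : (extChartAt I4 x).symm u ∈ (chartAt Model4 x).source := by simpa using hs
  have h2 := congrArg (fun L : Model4 →L[ℝ] Model4 => L (V ((extChartAt I4 x).symm u)))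
    (TangentBundle.continuousLinearMapAt_trivializationAt (I := I4) hy)
  refine Eq.trans ?_ h2
  have hb : (extChartAt I4 x).symm u ∈
    (trivializationAt Model4 (TangentSpace I4 : M → Type _) x).baseSet := by simpa using hy
  exact (congrFun (Trivialization.coe_linearMapAt_of_mem (R := ℝ) _ hb) _).symm

theorem SmoothFormAt.apply {θ : ∀ x : M, HomBundle M x} {V : ∀ x : M, TangentSpace I4 x} {x : M}
    (hθ : SmoothFormAt θ x) (hV : SmoothFieldAt V x) (k : Fin 4) :
    ContMDiffAt I4 𝓘(ℝ, ℝ) ∞ (fun y => (θ y (V y) : Col4) k) x := by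
  rw [contMDiffAt_iff_chart]
  have h1 := (smoothFormAt_iff.1 hθ).clm_apply (smoothFieldAt_iff.1 hV)
  have h2 : ContDiffAt ℝ ∞ (fun u => formInChart θ x u (fieldInChart V x u) k)
    (extChartAt I4 x x) := contDiffAt_pi.1 h1 k
  refine h2.congr_of_eventuallyEq ?_
  filter_upwards [extChartAt_target_mem_nhds (I := I4) x] with u hu
  exact (congrFun (formInChart_fieldInChart θ V hu) k).symm

/-- The basis of a tangent space dual to a coframe at a point. -/
def dualVec {x : M} (b : HomBundle M x) (i : Fin 4) : TangentSpace I4 x :=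
  b.inverse (Pi.single i 1 : Col4)

/-- The frame dual to a coframe. -/
def dualFrame (θ : ∀ x : M, HomBundle M x) (i : Fin 4) (x : M) : TangentSpace I4 x :=
  dualVec (θ x) i

theorem isInvertible_of_bijective {A : Model4 →L[ℝ] Col4} (hA : Function.Bijective A) :
    A.IsInvertible :=
  ⟨(LinearEquiv.ofBijective A.toLinearMap hA).toContinuousLinearEquiv, by ext; rfl⟩

omit [IsManifold I4 ∞ M] in
theorem isInvertible_form {x : M} {b : HomBundle M x} (hb : Function.Bijective b) :
    b.IsInvertible := isInvertible_of_bijective hb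

omit [IsManifold I4 ∞ M] in
theorem apply_dualVec {x : M} {b : HomBundle M x} (hb : Function.Bijective b) (i : Fin 4) :
    b (dualVec b i) = (Pi.single i 1 : Col4) :=
  (isInvertible_form hb).self_apply_inverse _

omit [IsManifold I4 ∞ M] in
theorem apply_dualFrame {θ : ∀ x : M, HomBundle M x} {x : M} (hb : Function.Bijective (θ x))
    (i : Fin 4) : θ x (dualFrame θ i x) = (Pi.single i 1 : Col4) :=
  apply_dualVec hb i

theorem isInvertible_formInChart {θ : ∀ x : M, HomBundle M x} {x y : M}
    (hy : y ∈ (extChartAt I4 x).source) (hb : Function.Bijective (θ y)) :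
    (formInChart θ x (extChartAt I4 x y)).IsInvertible := by
  have h1 := mfderiv_extChartAt_symm_isInvertible ((extChartAt I4 x).map_source hy)
  have h2 : ((θ : M → Model4 →L[ℝ] Col4) y).IsInvertible := isInvertible_form hb
  rw [← (extChartAt I4 x).left_inv hy] at h2
  exact h2.comp h1

/-- Inversion of continuous linear maps is smooth at invertible ones, and in the chart the dual
frame is the inverse of the form applied to constant vectors. -/
theorem smoothFieldAt_dualFrame {θ : ∀ x : M, HomBundle M x} {x : M} (hθ : SmoothFormAt θ x)
    (hb : ∀ᶠ y in 𝓝 x, Function.Bijective (θ y)) (i : Fin 4) :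
    SmoothFieldAt (dualFrame θ i) x := by
  rw [smoothFieldAt_iff]
  have hx := isInvertible_formInChart (mem_extChartAt_source (I := I4) x) hb.self_of_nhds
  have h1 : ContDiffAt ℝ ∞ (fun u => (formInChart θ x u).inverse (Pi.single i 1 : Col4))
      (extChartAt I4 x x) :=
    (hx.contDiffAt_map_inverse.comp _ (smoothFormAt_iff.1 hθ)).clm_apply contDiffAt_const
  refine h1.congr_of_eventuallyEq ?_
  have hcont : ContinuousAt (extChartAt I4 x).symm (extChartAt I4 x x) :=
    continuousAt_extChartAt_symm x
  rw [ContinuousAt, extChartAt_to_inv] at hcont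
  filter_upwards [extChartAt_target_mem_nhds (I := I4) x, hcont.eventually hb] with u hu hu'
  have h2 := isInvertible_formInChart ((extChartAt I4 x).map_target hu) hu'
  rw [(extChartAt I4 x).right_inv hu] at h2
  rw [eq_comm, h2.inverse_apply_eq, formInChart_fieldInChart θ _ hu]
  exact (apply_dualFrame hu' i).symm

/-- The linear map `ℝ⁴ → T_x M` given by a frame. -/
def frameMap (e : Fin 4 → ∀ x : M, TangentSpace I4 x) (x : M) : Col4 →L[ℝ] TangentSpace I4 x :=
  ∑ i, (ContinuousLinearMap.proj (R := ℝ) (φ := fun _ : Fin 4 => ℝ) i).smulRight (e i x)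

/-- The coframe dual to a frame. -/
def dualCoframe (e : Fin 4 → ∀ x : M, TangentSpace I4 x) (x : M) : HomBundle M x :=
  (frameMap e x).inverse

omit [IsManifold I4 ∞ M] in
theorem frameMap_apply (e : Fin 4 → ∀ x : M, TangentSpace I4 x) (x : M) (c : Col4) :
    frameMap e x c = ∑ i, c i • e i x := by
  simp [frameMap]

/-- The map `frameMap` in the chart at `x`. -/
def frameMapInChart (e : Fin 4 → ∀ x : M, TangentSpace I4 x) (x : M) (u : Model4) :
    Col4 →L[ℝ] Model4 :=
  ∑ i, (ContinuousLinearMap.proj (R := ℝ) (φ := fun _ : Fin 4 => ℝ) i).smulRight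
    (fieldInChart (e i) x u)

theorem contDiffAt_frameMapInChart {e : Fin 4 → ∀ x : M, TangentSpace I4 x} {x : M}
    (he : ∀ i, SmoothFieldAt (e i) x) :
    ContDiffAt ℝ ∞ (frameMapInChart e x) (extChartAt I4 x x) := by
  unfold frameMapInChart
  refine ContDiffAt.sum fun i _ => ?_
  exact contDiffAt_const.smulRight (smoothFieldAt_iff.1 (he i))

theorem frameMapInChart_eq (e : Fin 4 → ∀ x : M, TangentSpace I4 x) {x y : M}
    (hy : y ∈ (extChartAt I4 x).source) :
    frameMapInChart e x (extChartAt I4 x y) =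
      (mfderiv I4 𝓘(ℝ, Model4) (extChartAt I4 x) y : Model4 →L[ℝ] Model4).comp
        (frameMap e y : Col4 →L[ℝ] Model4) := by
  ext1 c
  have h1 : frameMapInChart e x (extChartAt I4 x y) c =
      ∑ i, c i • fieldInChart (e i) x (extChartAt I4 x y) := by
    simp [frameMapInChart]
  have h2 : (mfderiv I4 𝓘(ℝ, Model4) (extChartAt I4 x) y) (frameMap e y c) =
      ∑ i, c i • (mfderiv I4 𝓘(ℝ, Model4) (extChartAt I4 x) y) (e i y) := by
    rw [frameMap_apply, map_sum]
    exact Finset.sum_congr rfl fun i _ => map_smul _ _ _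
  rw [h1]
  refine Eq.trans ?_ h2.symm
  exact Finset.sum_congr rfl fun i _ => by
    rw [mfderiv_extChartAt_field_of_mem (e i) hy]; rfl

theorem isInvertible_frameMapInChart_iff (e : Fin 4 → ∀ x : M, TangentSpace I4 x) {x y : M}
    (hy : y ∈ (extChartAt I4 x).source) :
    (frameMapInChart e x (extChartAt I4 x y)).IsInvertible ↔ (frameMap e y).IsInvertible := by
  rw [frameMapInChart_eq e hy]
  obtain ⟨L, hL⟩ : (mfderiv I4 𝓘(ℝ, Model4) (extChartAt I4 x) y :
      Model4 →L[ℝ] Model4).IsInvertible := isInvertible_mfderiv_extChartAt hy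
  rw [← hL]
  exact ContinuousLinearMap.isInvertible_equiv_comp

theorem smoothFormAt_dualCoframe {e : Fin 4 → ∀ x : M, TangentSpace I4 x} {x : M}
    (he : ∀ i, SmoothFieldAt (e i) x) (hx : (frameMap e x).IsInvertible) :
    SmoothFormAt (dualCoframe e) x := by
  rw [smoothFormAt_iff]
  rw [← isInvertible_frameMapInChart_iff e (mem_extChartAt_source (I := I4) x)] at hx
  refine (hx.contDiffAt_map_inverse.comp _ (contDiffAt_frameMapInChart he)).congr_of_eventuallyEq ?_
  filter_upwards [extChartAt_target_mem_nhds (I := I4) x] with u hu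
  have hs := (extChartAt I4 x).map_target hu
  have h1 := frameMapInChart_eq e hs
  rw [(extChartAt I4 x).right_inv hu] at h1
  have h2 : (mfderiv I4 𝓘(ℝ, Model4) (extChartAt I4 x) ((extChartAt I4 x).symm u) :
      Model4 →L[ℝ] Model4).IsInvertible := isInvertible_mfderiv_extChartAt hs
  have h4 := h2.inverse_comp_of_left (f := (frameMap e ((extChartAt I4 x).symm u) :
    Col4 →L[ℝ] Model4))
  refine Eq.trans ?_ ((congrArg ContinuousLinearMap.inverse h1).trans h4).symm
  ext1 v
  change _ = (frameMap e _).inverse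
    ((mfderiv I4 𝓘(ℝ, Model4) (extChartAt I4 x) ((extChartAt I4 x).symm u) :
      Model4 →L[ℝ] Model4).inverse v)
  refine congrArg (dualCoframe e ((extChartAt I4 x).symm u) : Model4 → Col4) ?_
  refine (h2.inverse_apply_eq.2 ?_).symm
  have h3 := mfderiv_extChartAt_comp_mfderivWithin_extChartAt_symm (I := I4) hu
  rw [modelWithCornersSelf_coe, range_id, mfderivWithin_univ] at h3
  exact (congrArg (fun L : Model4 →L[ℝ] Model4 => L v) h3).symm

theorem eventually_isInvertible_frameMap {e : Fin 4 → ∀ x : M, TangentSpace I4 x} {x : M}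
    (he : ∀ i, SmoothFieldAt (e i) x) (hx : (frameMap e x).IsInvertible) :
    ∀ᶠ y in 𝓝 x, (frameMap e y).IsInvertible := by
  have hx' := hx
  rw [← isInvertible_frameMapInChart_iff e (mem_extChartAt_source (I := I4) x)] at hx'
  have h1 : IsOpen {A : Col4 →L[ℝ] Model4 | A.IsInvertible} := ContinuousLinearEquiv.isOpen
  have h2 := (contDiffAt_frameMapInChart he).continuousAt.comp
    (f := extChartAt I4 x) (continuousAt_extChartAt x)
  filter_upwards [h2.preimage_mem_nhds (h1.mem_nhds hx'), extChartAt_source_mem_nhds (I := I4) x]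
    with y hy hy'
  exact (isInvertible_frameMapInChart_iff e hy').1 hy

omit [IsManifold I4 ∞ M] in
theorem isInvertible_frameMap {e : Fin 4 → ∀ x : M, TangentSpace I4 x} {x : M}
    (he : LinearIndependent ℝ fun i => e i x) : (frameMap e x).IsInvertible := by
  have h1 : Function.Injective (frameMap e x) := by
    rw [injective_iff_map_eq_zero]
    intro c hc
    rw [frameMap_apply] at hc
    exact funext (Fintype.linearIndependent_iff.1 he c hc)
  let A : Col4 →L[ℝ] Model4 := frameMap e x
  have h2 : Function.Bijective A := by
    refine ⟨h1, ?_⟩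
    exact (LinearMap.injective_iff_surjective_of_finrank_eq_finrank
      (f := A.toLinearMap) (by simp)).1 h1
  exact ⟨(LinearEquiv.ofBijective A.toLinearMap h2).toContinuousLinearEquiv, by ext; rfl⟩

omit [IsManifold I4 ∞ M] in
theorem dualCoframe_bijective {e : Fin 4 → ∀ x : M, TangentSpace I4 x} {x : M}
    (hx : (frameMap e x).IsInvertible) : Function.Bijective (dualCoframe e x) :=
  hx.inverse.bijective

omit [IsManifold I4 ∞ M] in
theorem dualCoframe_apply {e : Fin 4 → ∀ x : M, TangentSpace I4 x} {x : M}
    (hx : (frameMap e x).IsInvertible) (i : Fin 4) :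
    dualCoframe e x (e i x) = (Pi.single i 1 : Col4) := by
  unfold dualCoframe
  rw [hx.inverse_apply_eq, frameMap_apply]
  simp [Pi.single_apply, Finset.sum_ite_eq']

omit [IsManifold I4 ∞ M] in
theorem dualFrame_eq {θ : ∀ x : M, HomBundle M x} {x : M} (hb : Function.Bijective (θ x))
    {i : Fin 4} {v : TangentSpace I4 x} (h : θ x v = (Pi.single i 1 : Col4)) :
    dualFrame θ i x = v :=
  hb.1 ((apply_dualFrame hb i).trans h.symm)

omit [IsManifold I4 ∞ M] in
theorem sum_smul_dualVec {x : M} {b : HomBundle M x} (hb : Function.Bijective b)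
    (v : TangentSpace I4 x) : v = ∑ i, (b v : Col4) i • dualVec b i := by
  apply hb.1
  rw [map_sum]
  simp only [map_smul]
  ext k
  have : ∀ i, (b (dualVec b i) : Col4) = Pi.single i 1 := fun i => apply_dualVec hb i
  change (b v : Col4) k = (∑ i, (b v : Col4) i • (b (dualVec b i) : Col4)) k
  simp [this, Pi.single_apply]

omit [IsManifold I4 ∞ M] in
theorem sum_smul_dualFrame {θ : ∀ x : M, HomBundle M x} {x : M} (hb : Function.Bijective (θ x))
    (v : TangentSpace I4 x) : v = ∑ i, (θ x v : Col4) i • dualFrame θ i x :=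
  sum_smul_dualVec hb v

theorem SmoothFieldAt.add {V W : ∀ x : M, TangentSpace I4 x} {x : M} (hV : SmoothFieldAt V x)
    (hW : SmoothFieldAt W x) : SmoothFieldAt (fun y => V y + W y) x :=
  ContMDiffAt.add_section hV hW

theorem SmoothFieldAt.sub {V W : ∀ x : M, TangentSpace I4 x} {x : M} (hV : SmoothFieldAt V x)
    (hW : SmoothFieldAt W x) : SmoothFieldAt (fun y => V y - W y) x :=
  ContMDiffAt.sub_section hV hW

theorem SmoothFieldAt.neg {V : ∀ x : M, TangentSpace I4 x} {x : M} (hV : SmoothFieldAt V x) :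
    SmoothFieldAt (fun y => - V y) x :=
  ContMDiffAt.neg_section hV

theorem SmoothFieldAt.smul {V : ∀ x : M, TangentSpace I4 x} {x : M} {f : M → ℝ}
    (hf : ContMDiffAt I4 𝓘(ℝ, ℝ) ∞ f x) (hV : SmoothFieldAt V x) :
    SmoothFieldAt (fun y => f y • V y) x :=
  ContMDiffAt.smul_section hf hV

theorem SmoothFieldAt.mlieBracket {V W : ∀ x : M, TangentSpace I4 x} {x : M}
    (hV : SmoothFieldAt V x) (hW : SmoothFieldAt W x) :
    SmoothFieldAt (mlieBracket I4 V W) x := by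
  have := isManifold_top_add_one (M := M)
  have : IsManifold I4 (minSmoothness ℝ 2) M := by
    rw [minSmoothness_of_isRCLikeNormedField]; infer_instance
  exact ContMDiffAt.mlieBracket_vectorField (m := ⊤) (n := ⊤) hV hW (by simp)

end Frames

/-! ### Torsion coefficients of a coframe. -/

section Torsion

variable {M : Type*} [TopologicalSpace M] [ChartedSpace Model4 M] [IsManifold I4 ∞ M]

/-- The exterior derivative at a point as a bilinear map. -/
def formDerivBilin (θ : ∀ x : M, HomBundle M x) (x : M) :
    TangentSpace I4 x →ₗ[ℝ] TangentSpace I4 x →ₗ[ℝ] Col4 :=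
  let D := fderiv ℝ (formInChart θ x) (extChartAt I4 x x)
  let B : Model4 →ₗ[ℝ] Model4 →ₗ[ℝ] Col4 :=
    LinearMap.mk₂ ℝ (fun v w => D v w - D w v)
      (by intros; simp; abel) (by intros; simp [smul_sub]) (by intros; simp; abel)
      (by intros; simp [smul_sub])
  B.compl₁₂ (mfderiv I4 𝓘(ℝ, Model4) (extChartAt I4 x) x).toLinearMap
    (mfderiv I4 𝓘(ℝ, Model4) (extChartAt I4 x) x).toLinearMap

theorem formDeriv_eq_formDerivBilin {θ : ∀ x : M, HomBundle M x} {x : M}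
    (hθ : SmoothFormAt θ x) (v w : TangentSpace I4 x) :
    formDeriv θ x v w = formDerivBilin θ x v w :=
  formDeriv_eq ((smoothFormAt_iff.1 hθ).differentiableAt (by simp)) v w

omit [IsManifold I4 ∞ M] in
theorem formDerivBilin_swap (θ : ∀ x : M, HomBundle M x) (x : M) (v w : TangentSpace I4 x) :
    formDerivBilin θ x v w = - formDerivBilin θ x w v :=
  (neg_sub _ _).symm

omit [IsManifold I4 ∞ M] in
theorem formDerivBilin_self (θ : ∀ x : M, HomBundle M x) (x : M) (v : TangentSpace I4 x) :
    formDerivBilin θ x v v = 0 :=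
  sub_self _

theorem formDerivBilin_field {θ : ∀ x : M, HomBundle M x} {x : M} (hθ : SmoothFormAt θ x)
    {V W : ∀ x : M, TangentSpace I4 x} (hV : SmoothFieldAt V x) (hW : SmoothFieldAt W x)
    {k : Fin 4} {c c' : ℝ} (hc : ∀ᶠ y in 𝓝 x, (θ y (V y) : Col4) k = c)
    (hc' : ∀ᶠ y in 𝓝 x, (θ y (W y) : Col4) k = c') :
    formDerivBilin θ x (V x) (W x) k = - (θ x (mlieBracket I4 V W x) : Col4) k := by
  rw [← formDeriv_eq_formDerivBilin hθ, formDeriv_field hθ hV hW hc hc']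

/-- The coefficients `Tᵏ_{ij}` of the exterior derivative of a coframe in terms of the coframe. -/
def torsion (θ : ∀ x : M, HomBundle M x) (k i j : Fin 4) (x : M) : ℝ :=
  formDeriv θ x (dualFrame θ i x) (dualFrame θ j x) k

omit [IsManifold I4 ∞ M] in
theorem wedge_dualFrame {θ : ∀ x : M, HomBundle M x} {x : M} (hb : Function.Bijective (θ x))
    (i j k l : Fin 4) : wedge (θ x) i j (dualFrame θ k x) (dualFrame θ l x) =
      (if i = k then 1 else 0) * (if j = l then 1 else 0) -
        (if i = l then 1 else 0) * (if j = k then 1 else 0) := by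
  unfold wedge
  rw [apply_dualFrame hb, apply_dualFrame hb]
  simp [Pi.single_apply]

omit [IsManifold I4 ∞ M] in
theorem formDerivBilin_eq_sum {θ : ∀ x : M, HomBundle M x} {x : M}
    (hb : Function.Bijective (θ x)) (v w : TangentSpace I4 x) (k : Fin 4) :
    formDerivBilin θ x v w k = ∑ i, ∑ j ∈ Finset.Ioi i,
      formDerivBilin θ x (dualFrame θ i x) (dualFrame θ j x) k * wedge (θ x) i j v w := by
  have hv := sum_smul_dualFrame hb v
  have hw := sum_smul_dualFrame hb w
  have key : formDerivBilin θ x v w = ∑ i, ∑ j, ((θ x v : Col4) i * (θ x w : Col4) j) •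
      formDerivBilin θ x (dualFrame θ i x) (dualFrame θ j x) := by
    conv_lhs => rw [hv, hw]
    simp only [map_sum, map_smul, LinearMap.sum_apply, LinearMap.smul_apply, Finset.smul_sum,
      smul_smul]
    rw [Finset.sum_comm]
    refine Finset.sum_congr rfl fun i _ => Finset.sum_congr rfl fun j _ => ?_
    rw [mul_comm]
  rw [key]
  have h10 := formDerivBilin_swap θ x (dualFrame θ 1 x) (dualFrame θ 0 x)
  have h20 := formDerivBilin_swap θ x (dualFrame θ 2 x) (dualFrame θ 0 x)
  have h30 := formDerivBilin_swap θ x (dualFrame θ 3 x) (dualFrame θ 0 x)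
  have h21 := formDerivBilin_swap θ x (dualFrame θ 2 x) (dualFrame θ 1 x)
  have h31 := formDerivBilin_swap θ x (dualFrame θ 3 x) (dualFrame θ 1 x)
  have h32 := formDerivBilin_swap θ x (dualFrame θ 3 x) (dualFrame θ 2 x)
  have i0 : (Finset.Ioi (0 : Fin 4)) = {1, 2, 3} := by decide
  have i1 : (Finset.Ioi (1 : Fin 4)) = {2, 3} := by decide
  have i2 : (Finset.Ioi (2 : Fin 4)) = {3} := by decide
  have i3 : (Finset.Ioi (3 : Fin 4)) = ∅ := by decide
  simp only [Fin.sum_univ_four, i0, i1, i2, i3, h10, h20, h30, h21, h31, h32,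
    formDerivBilin_self, wedge]
  simp [Finset.sum_insert]
  ring

/-- The two-forms `θⁱ ∧ θʲ` with `i < j` are a basis, and evaluation on the dual frame reads off the
coefficients. Thus the existentially quantified `T` in the definition of `B_final` can be replaced
by the function `torsion`. -/
theorem isTorsionOn_iff {θ : ∀ x : M, HomBundle M x} {U : Set M} (hU : IsOpen U)
    (hθ : SmoothFormOn θ U) (hb : ∀ x ∈ U, Function.Bijective (θ x))
    (T : Fin 4 → Fin 4 → Fin 4 → M → ℝ) :
    IsTorsionOn θ U T ↔ ∀ x ∈ U, ∀ k i j, i < j → T k i j x = torsion θ k i j x := by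
  have hs : ∀ x ∈ U, SmoothFormAt θ x := fun x hx => (hθ x hx).contMDiffAt (hU.mem_nhds hx)
  refine forall₂_congr fun x hx => ?_
  constructor
  · intro h k i j hij
    have h1 := h (dualFrame θ i x) (dualFrame θ j x) k
    unfold torsion
    rw [h1]
    simp only [wedge_dualFrame (hb x hx)]
    fin_cases i <;> fin_cases j <;> first | (exact absurd hij (by decide)) | skip
    all_goals
      have i0 : (Finset.Ioi (0 : Fin 4)) = {1, 2, 3} := by decide
      have i1 : (Finset.Ioi (1 : Fin 4)) = {2, 3} := by decide
      have i2 : (Finset.Ioi (2 : Fin 4)) = {3} := by decide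
      have i3 : (Finset.Ioi (3 : Fin 4)) = ∅ := by decide
      simp [Fin.sum_univ_four, i0, i1, i2, i3]
  · intro h v w k
    rw [formDeriv_eq_formDerivBilin (hs x hx), formDerivBilin_eq_sum (hb x hx)]
    refine Finset.sum_congr rfl fun i _ => Finset.sum_congr rfl fun j hj => ?_
    rw [h k i j (Finset.mem_Ioi.1 hj), torsion, formDeriv_eq_formDerivBilin (hs x hx)]

omit [IsManifold I4 ∞ M] in
theorem eventually_apply_dualFrame {θ : ∀ x : M, HomBundle M x} {x : M}
    (hb : ∀ᶠ y in 𝓝 x, Function.Bijective (θ y)) (i k : Fin 4) :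
    ∀ᶠ y in 𝓝 x, (θ y (dualFrame θ i y) : Col4) k = (Pi.single i 1 : Col4) k := by
  filter_upwards [hb] with y hy
  exact congrFun (apply_dualFrame hy i) k

theorem torsion_eq {θ : ∀ x : M, HomBundle M x} {x : M} (hθ : SmoothFormAt θ x)
    (hb : ∀ᶠ y in 𝓝 x, Function.Bijective (θ y)) (k i j : Fin 4) :
    torsion θ k i j x =
      - (θ x (mlieBracket I4 (dualFrame θ i) (dualFrame θ j) x) : Col4) k :=
  formDeriv_field hθ (smoothFieldAt_dualFrame hθ hb i) (smoothFieldAt_dualFrame hθ hb j)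
    (eventually_apply_dualFrame hb i k) (eventually_apply_dualFrame hb j k)

/-- As components of brackets of the dual frame the coefficients are smooth. The definition through
`formDeriv` uses a different chart at every point and does not show this. -/
theorem contMDiffAt_torsion {θ : ∀ x : M, HomBundle M x} {x : M}
    (hθ : ∀ᶠ y in 𝓝 x, SmoothFormAt θ y)
    (hb : ∀ᶠ y in 𝓝 x, Function.Bijective (θ y)) (k i j : Fin 4) :
    ContMDiffAt I4 𝓘(ℝ, ℝ) ∞ (torsion θ k i j) x := by
  have hx := hθ.self_of_nhds
  have h1 := hx.apply ((smoothFieldAt_dualFrame hx hb i).mlieBracket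
    (smoothFieldAt_dualFrame hx hb j)) k
  refine h1.neg.congr_of_eventuallyEq ?_
  filter_upwards [hθ, hb.eventually_nhds] with y hy hy'
  exact torsion_eq hy hy' k i j

end Torsion

/-! ### Matrices acting on coframes at a point. -/

section MatMul

variable {M : Type*} [TopologicalSpace M] [ChartedSpace Model4 M] {x : M}

theorem matMul_apply (g : Matrix (Fin 4) (Fin 4) ℝ) (b : HomBundle M x) (v : TangentSpace I4 x) :
    (matMul g b v : Col4) = g *ᵥ (b v : Col4) := rfl

theorem matMul_matMul (g h : Matrix (Fin 4) (Fin 4) ℝ) (b : HomBundle M x) :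
    matMul g (matMul h b) = matMul (g * h) b := by
  ext1 v
  exact Matrix.mulVec_mulVec (b v : Col4) g h

theorem matMul_one (b : HomBundle M x) : matMul 1 b = b := by
  ext1 v
  exact Matrix.one_mulVec (b v : Col4)

theorem eq_matMul_of_bijective {b : HomBundle M x} (hb : Function.Bijective b)
    (b' : HomBundle M x) : b' = matMul (Matrix.of fun k j => (b' (dualVec b j) : Col4) k) b := by
  ext1 v
  funext k
  have h := congrArg (fun v => (b' v : Col4) k) (sum_smul_dualVec hb v)
  refine h.trans ?_
  rw [matMul_apply, map_sum]
  simp only [map_smul]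
  change (∑ i, (b v : Col4) i • (b' (dualVec b i) : Col4)) k = _
  simp [Matrix.mulVec, dotProduct, mul_comm]

theorem matMul_injective {b : HomBundle M x} (hb : Function.Bijective b)
    {g h : Matrix (Fin 4) (Fin 4) ℝ} (hgh : matMul g b = matMul h b) : g = h := by
  ext k j
  have h1 := congrArg (fun c : HomBundle M x => (c (dualVec b j) : Col4) k) hgh
  simp only [matMul_apply] at h1
  rw [apply_dualVec hb] at h1
  simpa using h1

theorem bijective_of_injective {b : HomBundle M x} (hb : Function.Injective b) :
    Function.Bijective b := by
  let A : Model4 →L[ℝ] Col4 := b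
  exact ⟨hb, (LinearMap.injective_iff_surjective_of_finrank_eq_finrank
    (f := A.toLinearMap) (by simp)).1 hb⟩

theorem matMul_bijective {b : HomBundle M x} (hb : Function.Bijective b)
    {g : Matrix (Fin 4) (Fin 4) ℝ} (hg : ∀ c : Col4, g *ᵥ c = 0 → c = 0) :
    Function.Bijective (matMul g b) := by
  apply bijective_of_injective
  rw [injective_iff_map_eq_zero]
  intro v hv
  exact (injective_iff_map_eq_zero _).1 hb.1 v (hg _ hv)

end MatMul

/-! ### The intrinsic description of `B₀`. -/

namespace EngelStructure

variable {Q : Type*} [TopologicalSpace Q] [ChartedSpace Model4 Q] [IsManifold I4 ∞ Q]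

/-- The intrinsic description of the coframes in `B₀`. -/
structure IsAdapted (S : EngelStructure Q) (x : Q) (b : HomBundle Q x) : Prop where
  bijective : Function.Bijective b
  annihilates_H : ∀ v ∈ S.H x, (b v : Col4) 2 = 0 ∧ (b v : Col4) 3 = 0
  annihilates_H1 : ∀ v ∈ S.H1 x, (b v : Col4) 3 = 0
  inner_eq : ∀ v ∈ S.H x, ∀ w ∈ S.H1 x,
    S.metric.inner x v w = (b v : Col4) 0 * (b w : Col4) 0 + (b v : Col4) 1 * (b w : Col4) 1

variable {S : EngelStructure Q} {x : Q}

theorem finrank_H (S : EngelStructure Q) (x : Q) : Module.finrank ℝ (S.H x) = 2 := by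
  obtain ⟨U, -, hx, X, Y, h⟩ := S.exists_frame x
  rw [← h.span_eq x hx]
  have h1 := finrank_span_eq_card (h.linearIndependent x hx)
  have e : Set.range ![X x, Y x] = {X x, Y x} := by
    rw [Matrix.range_cons, Matrix.range_cons, Matrix.range_empty, Set.union_empty]
    rfl
  rw [e] at h1
  exact h1

theorem H_le_H1 (S : EngelStructure Q) (x : Q) : S.H x ≤ S.H1 x := le_sup_left

theorem mlieBracket_mem_H1 (S : EngelStructure Q) {U : Set Q} (hU : IsOpen U) (hx : x ∈ U)
    {X Y : ∀ y : Q, TangentSpace I4 y} (hX : SmoothFieldOn X U) (hY : SmoothFieldOn Y U)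
    (h : ∀ y ∈ U, X y ∈ S.H y ∧ Y y ∈ S.H y) : mlieBracket I4 X Y x ∈ S.H1 x :=
  Submodule.mem_sup_right (Submodule.subset_span ⟨U, hU, hx, X, Y, hX, hY, h, rfl⟩)

theorem _root_.IsFrameOn.mem {H : ∀ x : Q, Submodule ℝ (TangentSpace I4 x)} {U : Set Q}
    {X Y : ∀ x : Q, TangentSpace I4 x} (h : IsFrameOn H U X Y) (hx : x ∈ U) :
    X x ∈ H x ∧ Y x ∈ H x := by
  rw [← h.span_eq x hx]
  exact ⟨Submodule.subset_span (by simp), Submodule.subset_span (by simp)⟩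

instance : FiniteDimensional ℝ (TangentSpace I4 x) :=
  inferInstanceAs (FiniteDimensional ℝ Model4)

/-- The lower bound suffices: an adapted coframe puts `H¹` into the kernel of a nonzero functional,
which gives the upper bound 3. -/
theorem three_le_finrank_H1 (S : EngelStructure Q) (x : Q) :
    3 ≤ Module.finrank ℝ (S.H1 x) := by
  obtain ⟨U, hU, hx, X, Y, h⟩ := S.exists_frame x
  obtain ⟨a, b, hab⟩ := S.engel U hU X Y h
  have hZ := S.mlieBracket_mem_H1 hU hx h.smooth_left h.smooth_right fun y hy => h.mem hy
  have h1 : LinearIndependent ℝ ![X x, Y x, mlieBracket I4 X Y x] := by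
    have := (hab x hx).comp (Fin.castSucc : Fin 3 → Fin 4) (Fin.castSucc_injective 3)
    convert this using 1
    ext i
    fin_cases i <;> rfl
  have h2 : Submodule.span ℝ (Set.range ![X x, Y x, mlieBracket I4 X Y x]) ≤ S.H1 x := by
    rw [Submodule.span_le]
    rintro _ ⟨i, rfl⟩
    fin_cases i
    · exact S.H_le_H1 x (h.mem hx).1
    · exact S.H_le_H1 x (h.mem hx).2
    · exact hZ
  have h3 := finrank_span_eq_card h1
  have h4 := Submodule.finrank_mono h2
  simpa [h3] using h4

theorem IsAdapted.mem_H {b : HomBundle Q x} (hb : S.IsAdapted x b) {v : TangentSpace I4 x}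
    (h2 : (b v : Col4) 2 = 0) (h3 : (b v : Col4) 3 = 0) : v ∈ S.H x := by
  let A : TangentSpace I4 x →ₗ[ℝ] ℝ × ℝ :=
    { toFun := fun v => ((b v : Col4) 2, (b v : Col4) 3)
      map_add' := fun v w => by rw [map_add]; rfl
      map_smul' := fun c v => by rw [map_smul]; rfl }
  have hA : Function.Surjective A := by
    intro p
    obtain ⟨v, hv⟩ := hb.bijective.2 (![0, 0, p.1, p.2] : Col4)
    refine ⟨v, ?_⟩
    change ((b v : Col4) 2, (b v : Col4) 3) = p
    rw [hv]; rfl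
  have h4 := A.finrank_range_add_finrank_ker
  rw [LinearMap.range_eq_top.2 hA, finrank_top] at h4
  have h5 : Module.finrank ℝ (TangentSpace I4 x) = 4 := by
    change Module.finrank ℝ Model4 = 4
    simp
  simp [h5] at h4
  have hle : S.H x ≤ LinearMap.ker A := fun w hw =>
    Prod.ext (hb.annihilates_H w hw).1 (hb.annihilates_H w hw).2
  have heq := Submodule.eq_of_le_of_finrank_eq hle (by rw [finrank_H]; omega)
  rw [heq]
  exact Prod.ext h2 h3

theorem IsAdapted.mem_H1 {b : HomBundle Q x} (hb : S.IsAdapted x b) {v : TangentSpace I4 x}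
    (h3 : (b v : Col4) 3 = 0) : v ∈ S.H1 x := by
  let A : TangentSpace I4 x →ₗ[ℝ] ℝ :=
    { toFun := fun v => (b v : Col4) 3
      map_add' := fun v w => by rw [map_add]; rfl
      map_smul' := fun c v => by rw [map_smul]; rfl }
  have hA : Function.Surjective A := by
    intro p
    obtain ⟨v, hv⟩ := hb.bijective.2 (![0, 0, 0, p] : Col4)
    refine ⟨v, ?_⟩
    change (b v : Col4) 3 = p
    rw [hv]; rfl
  have h4 := A.finrank_range_add_finrank_ker
  rw [LinearMap.range_eq_top.2 hA, finrank_top] at h4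
  have h5 : Module.finrank ℝ (TangentSpace I4 x) = 4 := by
    change Module.finrank ℝ Model4 = 4
    simp
  simp [h5] at h4
  have hle : S.H1 x ≤ LinearMap.ker A := fun w hw => hb.annihilates_H1 w hw
  have h6 := Submodule.finrank_mono hle
  have h7 := S.three_le_finrank_H1 x
  have heq := Submodule.eq_of_le_of_finrank_eq hle (by omega)
  rw [heq]
  exact h3

theorem IsAdapted.dualVec_mem {b : HomBundle Q x} (hb : S.IsAdapted x b) :
    dualVec b 0 ∈ S.H x ∧ dualVec b 1 ∈ S.H x ∧ dualVec b 2 ∈ S.H1 x := by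
  refine ⟨hb.mem_H ?_ ?_, hb.mem_H ?_ ?_, hb.mem_H1 ?_⟩ <;>
    · rw [apply_dualVec hb.bijective]; simp

theorem mem_G0_iff (g : Matrix (Fin 4) (Fin 4) ℝ) :
    g ∈ G0 ↔ g 0 0 ^ 2 + g 1 0 ^ 2 = 1 ∧ g 0 1 ^ 2 + g 1 1 ^ 2 = 1 ∧
      g 0 0 * g 0 1 + g 1 0 * g 1 1 = 0 ∧ g 0 2 = 0 ∧ g 1 2 = 0 ∧ g 2 0 = 0 ∧ g 2 1 = 0 ∧
      g 3 0 = 0 ∧ g 3 1 = 0 ∧ g 3 2 = 0 ∧ g 2 2 * g 3 3 ≠ 0 := by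
  constructor
  · rintro ⟨A, hA, B₁, B₂, a₃₃, a₃₄, a₄₄, h, rfl⟩
    rw [Matrix.mem_orthogonalGroup_iff'] at hA
    have h00 := congrFun (congrFun hA 0) 0
    have h11 := congrFun (congrFun hA 1) 1
    have h01 := congrFun (congrFun hA 0) 1
    simp [Matrix.mul_apply, Fin.sum_univ_two] at h00 h11 h01
    refine ⟨by simp; linarith, by simp; linarith, by simp; linarith, by simp, by simp, by simp,
      by simp, by simp, by simp, by simp, by simpa using h⟩
  · rintro ⟨h00, h11, h01, h02, h12, h20, h21, h30, h31, h32, h⟩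
    refine ⟨!![g 0 0, g 0 1; g 1 0, g 1 1], ?_, g 0 3, g 1 3, g 2 2, g 2 3, g 3 3, h, ?_⟩
    · rw [Matrix.mem_orthogonalGroup_iff']
      ext i j
      fin_cases i <;> fin_cases j <;> simp [Matrix.mul_apply, Fin.sum_univ_two] <;> linarith
    · ext i j
      fin_cases i <;> fin_cases j <;> simp [*]

/-- The entries `B₁`, `B₂` of a matrix in `G₀` multiply the last component, which vanishes on `H¹`.
So the first two components are only rotated or reflected there, and their pairing of `H` with `H¹`
is unchanged. -/
theorem IsAdapted.matMul {b : HomBundle Q x} (hb : S.IsAdapted x b)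
    {g : Matrix (Fin 4) (Fin 4) ℝ} (hg : g ∈ G0) : S.IsAdapted x (matMul g b) := by
  obtain ⟨h00, h11, h01, h02, h12, h20, h21, h30, h31, h32, h⟩ := (mem_G0_iff g).1 hg
  have key : ∀ (c : Col4) (i : Fin 4), (g *ᵥ c) i =
      g i 0 * c 0 + g i 1 * c 1 + g i 2 * c 2 + g i 3 * c 3 := fun c i => by
    simp [Matrix.mulVec, dotProduct, Fin.sum_univ_four]
  refine ⟨matMul_bijective hb.bijective fun c hc => ?_, fun v hv => ?_, fun v hv => ?_,
    fun v hv w hw => ?_⟩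
  · have e0 := (key c 0).symm.trans (congrFun hc 0)
    have e1 := (key c 1).symm.trans (congrFun hc 1)
    have e2 := (key c 2).symm.trans (congrFun hc 2)
    have e3 := (key c 3).symm.trans (congrFun hc 3)
    simp only [Pi.zero_apply, h02, h12, h20, h21, h30, h31, h32, zero_mul, zero_add, add_zero]
      at e0 e1 e2 e3
    have c3 : c 3 = 0 := (mul_eq_zero.1 e3).resolve_left (right_ne_zero_of_mul h)
    have c2 : c 2 = 0 := by
      rw [c3, mul_zero, add_zero] at e2
      exact (mul_eq_zero.1 e2).resolve_left (left_ne_zero_of_mul h)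
    rw [c3, mul_zero, add_zero] at e0 e1
    -- The orthogonal block is inverted by its transpose.
    have c0 : c 0 = 0 := by
      linear_combination g 0 0 * e0 + g 1 0 * e1 - c 0 * h00 - c 1 * h01
    have c1 : c 1 = 0 := by
      linear_combination g 0 1 * e0 + g 1 1 * e1 - c 1 * h11 - c 0 * h01
    funext i
    fin_cases i <;> assumption
  · obtain ⟨h2, h3⟩ := hb.annihilates_H v hv
    rw [matMul_apply, key, key, h2, h3, h20, h21, h30, h31]
    simp
  · have h3 := hb.annihilates_H1 v hv
    rw [matMul_apply, key, h3, h30, h31, h32]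
    simp
  · obtain ⟨h2, h3⟩ := hb.annihilates_H v hv
    have h3' := hb.annihilates_H1 w hw
    rw [hb.inner_eq v hv w hw, matMul_apply, matMul_apply, key, key, key, key, h2, h3, h3', h02,
      h12]
    linear_combination -(b v : Col4) 0 * (b w : Col4) 0 * h00 -
      (b v : Col4) 1 * (b w : Col4) 1 * h11 -
      ((b v : Col4) 0 * (b w : Col4) 1 + (b v : Col4) 1 * (b w : Col4) 0) * h01

/-- The entries of the matrix are the values of `b'` on the basis dual to `b`. Annihilation of `H`
and `H¹` gives the zeros in the last two rows; computing inner products with `b` and with `b'` gives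
orthogonality and the two zeros in column 2. -/
theorem IsAdapted.exists_mem_G0 {b b' : HomBundle Q x} (hb : S.IsAdapted x b)
    (hb' : S.IsAdapted x b') : ∃ g ∈ G0, b' = _root_.matMul g b := by
  refine ⟨_, (mem_G0_iff _).2 ?_, eq_matMul_of_bijective hb.bijective b'⟩
  obtain ⟨m0, m1, m2⟩ := hb.dualVec_mem
  obtain ⟨n0, n1, -⟩ := hb'.dualVec_mem
  have a0 := hb'.annihilates_H _ m0
  have a1 := hb'.annihilates_H _ m1
  have a2 := hb'.annihilates_H1 _ m2
  have i00 := (hb.inner_eq _ m0 _ (S.H_le_H1 x m0)).symm.trans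
    (hb'.inner_eq _ m0 _ (S.H_le_H1 x m0))
  have i01 := (hb.inner_eq _ m0 _ (S.H_le_H1 x m1)).symm.trans
    (hb'.inner_eq _ m0 _ (S.H_le_H1 x m1))
  have i11 := (hb.inner_eq _ m1 _ (S.H_le_H1 x m1)).symm.trans
    (hb'.inner_eq _ m1 _ (S.H_le_H1 x m1))
  -- The vector of `H¹` dual to component 2 of `b` is orthogonal to `H`, hence its first two
  -- components under `b'` vanish as well.
  have j0 := (hb.inner_eq _ n0 _ m2).symm.trans (hb'.inner_eq _ n0 _ m2)
  have j1 := (hb.inner_eq _ n1 _ m2).symm.trans (hb'.inner_eq _ n1 _ m2)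
  rw [apply_dualVec hb'.bijective, apply_dualVec hb.bijective] at j0 j1
  rw [apply_dualVec hb.bijective] at i00 i01 i11
  rw [apply_dualVec hb.bijective] at i01
  simp at i00 i01 i11 j0 j1
  simp only [Matrix.of_apply]
  refine ⟨by linarith, by linarith, by linarith, j0.symm, j1.symm, a0.1, a1.1, a0.2, a1.2, a2, ?_⟩
  -- If the entry (2, 2) vanished, `b'` would kill a dual basis vector of `b`; if the entry (3, 3)
  -- did, the last component of `b'` would vanish identically.
  intro h0
  rcases mul_eq_zero.1 h0 with h0 | h0
  · have h2 : b' (dualVec b 2) = (0 : Col4) := by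
      funext i
      fin_cases i
      · exact j0.symm
      · exact j1.symm
      · exact h0
      · exact a2
    have h3 := hb'.bijective.1 (h2.trans (map_zero b').symm)
    have h4 := apply_dualVec hb.bijective 2
    rw [h3, map_zero] at h4
    simpa using congrFun h4 2
  · obtain ⟨v, hv⟩ := hb'.bijective.2 (Pi.single 3 1 : Col4)
    have h1 := congrArg (fun v => (b' v : Col4) 3) (sum_smul_dualVec hb.bijective v)
    have h2 : (b' (∑ i, (b v : Col4) i • dualVec b i) : Col4) 3 =
        ∑ i, (b v : Col4) i * (b' (dualVec b i) : Col4) 3 := by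
      rw [map_sum]
      simp only [map_smul]
      change (∑ i, (b v : Col4) i • (b' (dualVec b i) : Col4)) 3 = _
      simp
    have h3 := h1.trans h2
    rw [Fin.sum_univ_four, hv, a0.2, a1.2, a2, h0] at h3
    simp at h3

theorem inner_dualVec_expand (S : EngelStructure Q) {b : HomBundle Q x}
    (hb : Function.Bijective b) (v w : TangentSpace I4 x) :
    S.metric.inner x v w = ∑ i, ∑ j, (b v : Col4) i * (b w : Col4) j *
      S.metric.inner x (dualVec b i) (dualVec b j) := by
  conv_lhs => rw [sum_smul_dualVec hb v, sum_smul_dualVec hb w]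
  simp only [map_sum, map_smul, _root_.sum_apply, _root_.smul_apply,
    smul_eq_mul, Finset.mul_sum]
  rw [Finset.sum_comm]
  exact Finset.sum_congr rfl fun i _ => Finset.sum_congr rfl fun j _ => by ring

theorem IsOrthonormalAdapted.isAdapted {η : HomBundle Q x} (h : S.IsOrthonormalAdapted x η) :
    S.IsAdapted x η where
  bijective := by
    apply bijective_of_injective
    rw [injective_iff_map_eq_zero]
    intro v hv
    by_contra hne
    have h1 := S.metric.pos x v hne
    rw [h.orthonormal, hv] at h1
    simp at h1
  annihilates_H := h.annihilates_H
  annihilates_H1 := h.annihilates_H1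
  inner_eq v hv w hw := by
    rw [h.orthonormal, Fin.sum_univ_four, (h.annihilates_H v hv).1, (h.annihilates_H v hv).2]
    ring

/-- Gram-Schmidt in the basis dual to `b`. Adaptedness already makes its first two vectors
orthonormal and orthogonal to the third, so only the third and fourth have to be corrected. -/
theorem IsAdapted.exists_orthonormal {b : HomBundle Q x} (hb : S.IsAdapted x b) :
    ∃ η : HomBundle Q x, S.IsOrthonormalAdapted x η := by
  obtain ⟨m0, m1, m2⟩ := hb.dualVec_mem
  set G : Fin 4 → Fin 4 → ℝ := fun i j => S.metric.inner x (dualVec b i) (dualVec b j) with hG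
  have hsymm : ∀ i j, G i j = G j i := fun i j => S.metric.symm x _ _
  have h00 := hb.inner_eq _ m0 _ (S.H_le_H1 x m0)
  have h01 := hb.inner_eq _ m0 _ (S.H_le_H1 x m1)
  have h11 := hb.inner_eq _ m1 _ (S.H_le_H1 x m1)
  have h02 := hb.inner_eq _ m0 _ m2
  have h12 := hb.inner_eq _ m1 _ m2
  rw [apply_dualVec hb.bijective] at h00 h01 h11 h02 h12
  rw [apply_dualVec hb.bijective] at h01 h02 h12
  simp at h00 h01 h11 h02 h12
  change G 0 0 = 1 at h00
  change G 0 1 = 0 at h01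
  change G 1 1 = 1 at h11
  change G 0 2 = 0 at h02
  change G 1 2 = 0 at h12
  have expand : ∀ v w : TangentSpace I4 x, S.metric.inner x v w =
      ∑ i, ∑ j, (b v : Col4) i * (b w : Col4) j * G i j :=
    inner_dualVec_expand S hb.bijective
  have h22 : 0 < G 2 2 := by
    apply S.metric.pos
    intro h0
    have h4 := apply_dualVec hb.bijective 2
    rw [h0, map_zero] at h4
    simpa using congrFun h4 2
  set s := G 2 2
  set t := G 3 3 - G 0 3 ^ 2 - G 1 3 ^ 2 - G 2 3 ^ 2 / s with ht
  have ht0 : 0 < t := by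
    -- `n` is the part of the fourth basis vector orthogonal to the other three, and `t` is its
    -- squared length.
    obtain ⟨n, hn⟩ := hb.bijective.2 (![-G 0 3, -G 1 3, -G 2 3 / s, 1] : Col4)
    have hn0 : n ≠ 0 := by
      rintro rfl
      rw [map_zero] at hn
      simpa using congrFun hn 3
    have h1 := S.metric.pos x n hn0
    rw [expand, hn] at h1
    simp only [Fin.sum_univ_four] at h1
    rw [hsymm 1 0, hsymm 2 0, hsymm 2 1, hsymm 3 0, hsymm 3 1, hsymm 3 2, h00, h01, h11, h02,
      h12] at h1
    simp at h1
    convert h1 using 1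
    have hs : s ≠ 0 := h22.ne'
    rw [ht]
    field_simp
    ring
  -- The matrix is the upper triangular Cholesky factor `R` of the Gram matrix, `Rᵀ R = G`; its
  -- shape keeps the annihilation conditions.
  refine ⟨_root_.matMul !![1, 0, 0, G 0 3; 0, 1, 0, G 1 3; 0, 0, √s, G 2 3 / √s; 0, 0, 0, √t] b,
    ?_, ?_, ?_⟩
  · intro v w
    rw [expand]
    simp only [matMul_apply, Fin.sum_univ_four]
    rw [hsymm 1 0, hsymm 2 0, hsymm 2 1, hsymm 3 0, hsymm 3 1, hsymm 3 2, h00, h01, h11, h02,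
      h12]
    simp [Matrix.mulVec, dotProduct, Fin.sum_univ_four]
    have hs : √s ≠ 0 := (Real.sqrt_pos.2 h22).ne'
    have hp : √s * √s = s := Real.mul_self_sqrt h22.le
    have hq : √t * √t = t := Real.mul_self_sqrt ht0.le
    have hr : G 2 3 / √s * √s = G 2 3 := div_mul_cancel₀ _ hs
    have hr2 : G 2 3 / √s * (G 2 3 / √s) = G 2 3 ^ 2 / s := by
      rw [div_mul_div_comm, hp, sq]
    linear_combination -(b v : Col4) 2 * (b w : Col4) 2 * hp -
      ((b v : Col4) 2 * (b w : Col4) 3 + (b v : Col4) 3 * (b w : Col4) 2) * hr -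
      (b v : Col4) 3 * (b w : Col4) 3 * hr2 - (b v : Col4) 3 * (b w : Col4) 3 * (hq.trans ht)
  · intro v hv
    obtain ⟨h2, h3⟩ := hb.annihilates_H v hv
    simp [matMul_apply, Matrix.mulVec, dotProduct, Fin.sum_univ_four, h2, h3]
  · intro v hv
    have h3 := hb.annihilates_H1 v hv
    simp [matMul_apply, Matrix.mulVec, dotProduct, Fin.sum_univ_four, h3]

theorem mem_B0_iff {b : HomTotal Q} : b ∈ S.B0 ↔ S.IsAdapted b.1 b.2 := by
  constructor
  · rintro ⟨g, hg, η, hη, h⟩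
    rw [h]
    exact hη.isAdapted.matMul hg
  · intro h
    obtain ⟨η, hη⟩ := h.exists_orthonormal
    obtain ⟨g, hg, h'⟩ := hη.isAdapted.exists_mem_G0 h
    exact ⟨g, hg, η, hη, h'⟩

end EngelStructure

/-! ### Normalized sections: uniqueness up to signs, and the Jacobi identity. -/

namespace EngelStructure

variable {Q : Type*} [TopologicalSpace Q] [ChartedSpace Model4 Q] [IsManifold I4 ∞ Q]

/-- `η` is a smooth section of `B₀` on the open set `U` with normalized torsion. -/
structure IsNormalized (S : EngelStructure Q) (η : ∀ y : Q, HomBundle Q y) (U : Set Q) : Prop where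
  isOpen : IsOpen U
  smooth : ∀ y ∈ U, SmoothFormAt η y
  adapted : ∀ y ∈ U, S.IsAdapted y (η y)
  torsion_eq : ∀ y ∈ U, torsion η 2 0 1 y = 1 ∧ torsion η 3 0 2 y = 0 ∧ torsion η 3 1 2 y = 1 ∧
    torsion η 0 1 2 y = 0 ∧ torsion η 1 1 2 y = 0 ∧ torsion η 2 1 2 y = 0

variable {S : EngelStructure Q}

theorem mem_Bfinal_iff {b : HomTotal Q} :
    b ∈ S.Bfinal ↔ ∃ U : Set Q, b.1 ∈ U ∧ ∃ η, S.IsNormalized η U ∧ b.2 = η b.1 := by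
  constructor
  · rintro ⟨U, hU, hb, η, hη, h0, he, T, hT, h⟩
    have ha : ∀ y ∈ U, S.IsAdapted y (η y) := fun y hy => mem_B0_iff.1 (h0 y hy)
    rw [isTorsionOn_iff hU hη fun y hy => (ha y hy).bijective] at hT
    refine ⟨U, hb, η, ⟨hU, fun y hy => (hη y hy).contMDiffAt (hU.mem_nhds hy), ha,
      fun y hy => ?_⟩, he⟩
    have h1 := h y hy
    have h2 := hT y hy
    rwa [h2 2 0 1 (by decide), h2 3 0 2 (by decide), h2 3 1 2 (by decide), h2 0 1 2 (by decide),
      h2 1 1 2 (by decide), h2 2 1 2 (by decide)] at h1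
  · rintro ⟨U, hb, η, h, he⟩
    have hη : SmoothFormOn η U := fun y hy => (h.smooth y hy).contMDiffWithinAt
    refine ⟨U, h.isOpen, hb, η, hη, fun y hy => mem_B0_iff.2 (h.adapted y hy), he, torsion η, ?_,
      h.torsion_eq⟩
    exact (isTorsionOn_iff h.isOpen hη (fun y hy => (h.adapted y hy).bijective) _).2
      fun _ _ _ _ _ _ => rfl

section Transition

variable {η η' : ∀ y : Q, HomBundle Q y} {U U' : Set Q} {y : Q}

theorem IsNormalized.eventually_bijective (h : S.IsNormalized η U) (hy : y ∈ U) :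
    ∀ᶠ z in 𝓝 y, Function.Bijective (η z) := by
  filter_upwards [h.isOpen.mem_nhds hy] with z hz using (h.adapted z hz).bijective

theorem IsNormalized.smooth_dualFrame (h : S.IsNormalized η U) (hy : y ∈ U) (i : Fin 4) :
    SmoothFieldAt (dualFrame η i) y :=
  smoothFieldAt_dualFrame (h.smooth y hy) (h.eventually_bijective hy) i

/-- `e₀` and `e₁` are sections of `H`, so their bracket lies in `H¹`. This coefficient needs no
normalization. -/
theorem IsNormalized.torsion_three_zero_one (h : S.IsNormalized η U) (hy : y ∈ U) :
    torsion η 3 0 1 y = 0 := by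
  have h1 : mlieBracket I4 (dualFrame η 0) (dualFrame η 1) y ∈ S.H1 y :=
    S.mlieBracket_mem_H1 h.isOpen hy
      (fun z hz => (h.smooth_dualFrame hz 0).contMDiffWithinAt)
      (fun z hz => (h.smooth_dualFrame hz 1).contMDiffWithinAt)
      fun z hz => ⟨(h.adapted z hz).dualVec_mem.1, (h.adapted z hz).dualVec_mem.2.1⟩
  rw [_root_.torsion_eq (h.smooth y hy) (h.eventually_bijective hy),
    (h.adapted y hy).annihilates_H1 _ h1, neg_zero]

/-- The matrix that relates two coframes. -/
def transition (η η' : ∀ y : Q, HomBundle Q y) (z : Q) : Matrix (Fin 4) (Fin 4) ℝ :=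
  Matrix.of fun k j => (η z (dualFrame η' j z) : Col4) k

omit [IsManifold I4 ∞ Q] in
theorem eq_matMul_transition (hb : Function.Bijective (η' y)) :
    η y = matMul (transition η η' y) (η' y) :=
  eq_matMul_of_bijective hb (η y)

theorem transition_mem_G0 (h : S.IsAdapted y (η y)) (h' : S.IsAdapted y (η' y)) :
    transition η η' y ∈ G0 := by
  obtain ⟨g, hg, hgb⟩ := h'.exists_mem_G0 h
  have := matMul_injective h'.bijective ((eq_matMul_transition h'.bijective).symm.trans hgb)
  rwa [this]

theorem IsNormalized.continuousAt_transition (h : S.IsNormalized η U) (h' : S.IsNormalized η' U')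
    (hy : y ∈ U) (hy' : y ∈ U') (k j : Fin 4) :
    ContinuousAt (fun z => transition η η' z k j) y :=
  ((h.smooth y hy).apply (h'.smooth_dualFrame hy' j) k).continuousAt

/-- The transformation law of the torsion. -/
theorem IsNormalized.transition_torsion (h : S.IsNormalized η U) (h' : S.IsNormalized η' U')
    (hy : y ∈ U) (hy' : y ∈ U') {k a b : Fin 4} {c c' : ℝ}
    (hc : ∀ᶠ z in 𝓝 y, transition η η' z k a = c)
    (hc' : ∀ᶠ z in 𝓝 y, transition η η' z k b = c') :
    ∑ l, transition η η' y k l * torsion η' l a b y =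
      ∑ i, ∑ j ∈ Finset.Ioi i, torsion η k i j y *
        (transition η η' y i a * transition η η' y j b -
          transition η η' y i b * transition η η' y j a) := by
  have hs := h.smooth y hy
  -- `dηᵏ(e'ₐ, e'_b)` is computed twice. The hypotheses on two entries of the transition matrix say
  -- that `ηᵏ` is locally constant on both fields, which removes the derivative terms.
  have h1 := formDerivBilin_field hs (h'.smooth_dualFrame hy' a) (h'.smooth_dualFrame hy' b) hc hc'
  rw [formDerivBilin_eq_sum (h.adapted y hy).bijective] at h1
  simp only [torsion, formDeriv_eq_formDerivBilin hs]
  refine Eq.trans ?_ h1.symm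
  have h2 := eq_matMul_transition (η := η) (h'.adapted y hy').bijective
  have h3 := congrArg (fun β : HomBundle Q y =>
    (β (mlieBracket I4 (dualFrame η' a) (dualFrame η' b) y) : Col4) k) h2
  refine Eq.trans ?_ (congrArg Neg.neg h3).symm
  have hb' := h'.eventually_bijective hy'
  have h4 := fun l => _root_.torsion_eq (h'.smooth y hy') hb' l a b
  simp only [torsion, formDeriv_eq_formDerivBilin (h'.smooth y hy')] at h4 ⊢
  simp only [h4, matMul_apply, Matrix.mulVec, dotProduct, mul_neg, Finset.sum_neg_distrib]

/-- The possible values 1 and -1 are at distance 2, so a variation below 1 is no variation. -/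
theorem eventually_eq_of_sq_eq_one {X : Type*} [TopologicalSpace X] {f : X → ℝ} {x : X}
    (hf : ContinuousAt f x) (h : ∀ᶠ y in 𝓝 x, f y ^ 2 = 1) : ∀ᶠ y in 𝓝 x, f y = f x := by
  have hx := h.self_of_nhds
  have h1 : ∀ᶠ y in 𝓝 x, |f y - f x| < 1 := by
    have := Metric.continuousAt_iff'.1 hf 1 one_pos
    simpa [Real.dist_eq] using this
  filter_upwards [h, h1] with y hy hy1
  rw [abs_lt] at hy1
  rcases sq_eq_one_iff.1 hx with h2 | h2 <;> rcases sq_eq_one_iff.1 hy with h3 | h3 <;>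
    linarith

/-- Both frames start with the characteristic direction, so the orthogonal block is triangular and
hence diagonal with entries ±1; `T²₀₁ = 1` then fixes the entry (2, 2) as the determinant of the
block. -/
theorem IsNormalized.transition_orthogonal (h : S.IsNormalized η U) (h' : S.IsNormalized η' U')
    (hy : y ∈ U) (hy' : y ∈ U') :
    transition η η' y 0 0 ^ 2 = 1 ∧ transition η η' y 1 1 ^ 2 = 1 ∧ transition η η' y 1 0 = 0 ∧
      transition η η' y 0 1 = 0 ∧
      transition η η' y 2 2 = transition η η' y 0 0 * transition η η' y 1 1 := by
  have hG : ∀ᶠ z in 𝓝 y, transition η η' z ∈ G0 := by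
    filter_upwards [h.isOpen.mem_nhds hy, h'.isOpen.mem_nhds hy'] with z hz hz'
    exact transition_mem_G0 (h.adapted z hz) (h'.adapted z hz')
  simp only [mem_G0_iff] at hG
  obtain ⟨h00, h11, h01, h02, h12, h20, h21, h30, h31, h32, hne⟩ := hG.self_of_nhds
  obtain ⟨t1, t2, t3, -, -, t6⟩ := h.torsion_eq y hy
  obtain ⟨t1', t2', -⟩ := h'.torsion_eq y hy'
  have t0 := h.torsion_three_zero_one hy
  have t0' := h'.torsion_three_zero_one hy'
  have i0 : (Finset.Ioi (0 : Fin 4)) = {1, 2, 3} := by decide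
  have i1 : (Finset.Ioi (1 : Fin 4)) = {2, 3} := by decide
  have i2 : (Finset.Ioi (2 : Fin 4)) = {3} := by decide
  have i3 : (Finset.Ioi (3 : Fin 4)) = ∅ := by decide
  -- With `T³₀₂ = 0` and `T³₁₂ = 1` the law reduces to the vanishing of the product of the entries
  -- (1, 0) and (2, 2).
  have e1 := h.transition_torsion h' hy hy' (k := 3) (a := 0) (b := 2) (c := 0) (c' := 0)
    (hG.mono fun z hz => hz.2.2.2.2.2.2.2.1) (hG.mono fun z hz => hz.2.2.2.2.2.2.2.2.2.1)
  have e2 := h.transition_torsion h' hy hy' (k := 2) (a := 0) (b := 1) (c := 0) (c' := 0)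
    (hG.mono fun z hz => hz.2.2.2.2.2.1) (hG.mono fun z hz => hz.2.2.2.2.2.2.1)
  simp [Fin.sum_univ_four, i0, i1, i2, i3, h02, h12, h20, h21, h30, h31, h32, t0, t1, t2, t3,
    t6, t0', t1', t2'] at e1 e2
  have g22 := left_ne_zero_of_mul hne
  have g10 : transition η η' y 1 0 = 0 := by tauto
  rw [g10] at h00 h01 e2
  have g00 : transition η η' y 0 0 ^ 2 = 1 := by simpa using h00
  have g01 : transition η η' y 0 1 = 0 := by
    have : transition η η' y 0 0 ≠ 0 := by
      intro h0; rw [h0] at g00; norm_num at g00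
    rw [zero_mul, add_zero] at h01
    exact (mul_eq_zero.1 h01).resolve_left this
  rw [g01] at h11
  exact ⟨g00, by simpa using h11, g10, g01, by linarith⟩

/-- `T'ˡ₁₂` is 1 for `l = 3` and 0 otherwise, so the law for the pair (1, 2) isolates the last
column of the transition matrix, one row at a time. -/
theorem IsNormalized.transition_eq_diagonal (h : S.IsNormalized η U) (h' : S.IsNormalized η' U')
    (hy : y ∈ U) (hy' : y ∈ U') :
    transition η η' y = Matrix.diagonal ![transition η η' y 0 0, transition η η' y 1 1,
      transition η η' y 0 0 * transition η η' y 1 1, transition η η' y 0 0] := by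
  have hV : ∀ᶠ z in 𝓝 y, z ∈ U ∧ z ∈ U' :=
    (h.isOpen.eventually_mem hy).and (h'.isOpen.eventually_mem hy')
  have hG : ∀ᶠ z in 𝓝 y, transition η η' z ∈ G0 := by
    filter_upwards [hV] with z hz
    exact transition_mem_G0 (h.adapted z hz.1) (h'.adapted z hz.2)
  simp only [mem_G0_iff] at hG
  obtain ⟨h00, h11, h01, h02, h12, h20, h21, h30, h31, h32, hne⟩ := hG.self_of_nhds
  have hO := hV.mono fun z hz => h.transition_orthogonal h' hz.1 hz.2
  obtain ⟨g00, g11, g10, g01, g22⟩ := hO.self_of_nhds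
  obtain ⟨-, -, t3, t4, t5, t6⟩ := h.torsion_eq y hy
  obtain ⟨-, -, t3', t4', t5', t6'⟩ := h'.torsion_eq y hy'
  have i0 : (Finset.Ioi (0 : Fin 4)) = {1, 2, 3} := by decide
  have i1 : (Finset.Ioi (1 : Fin 4)) = {2, 3} := by decide
  have i2 : (Finset.Ioi (2 : Fin 4)) = {3} := by decide
  have i3 : (Finset.Ioi (3 : Fin 4)) = ∅ := by decide
  -- Rows 1 and 2 of the law involve these diagonal entries, which therefore have to be locally
  -- constant and not only ±1 at `y`.
  have c11 := eventually_eq_of_sq_eq_one (h.continuousAt_transition h' hy hy' 1 1)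
    (hO.mono fun z hz => hz.2.1)
  have c22 := eventually_eq_of_sq_eq_one (h.continuousAt_transition h' hy hy' 2 2)
    (hO.mono fun z hz => by
      rw [hz.2.2.2.2, mul_pow, hz.1, hz.2.1, one_mul])
  have e0 := h.transition_torsion h' hy hy' (k := 0) (a := 1) (b := 2) (c := 0) (c' := 0)
    (hO.mono fun z hz => hz.2.2.2.1) (hG.mono fun z hz => hz.2.2.2.1)
  have e1 := h.transition_torsion h' hy hy' (k := 1) (a := 1) (b := 2) (c' := 0)
    c11 (hG.mono fun z hz => hz.2.2.2.2.1)
  have e2 := h.transition_torsion h' hy hy' (k := 2) (a := 1) (b := 2) (c := 0)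
    (hG.mono fun z hz => hz.2.2.2.2.2.2.1) c22
  have e3 := h.transition_torsion h' hy hy' (k := 3) (a := 1) (b := 2) (c := 0) (c' := 0)
    (hG.mono fun z hz => hz.2.2.2.2.2.2.2.2.1) (hG.mono fun z hz => hz.2.2.2.2.2.2.2.2.2.1)
  simp [Fin.sum_univ_four, i0, i1, i2, i3, h02, h12, h20, h21, h30, h31, h32, g01, t3, t4,
    t5, t6, t3', t4', t5', t6'] at e0 e1 e2 e3
  have e4 : transition η η' y 3 3 = transition η η' y 0 0 := by
    rw [e3, g22]
    linear_combination transition η η' y 0 0 * g11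
  ext i j
  fin_cases i <;> fin_cases j <;> simp [h02, h12, h20, h21, h30, h31, h32, g01, g10, e0, e1, e2,
    e4, g22]

theorem exists_units_eq {s : ℝ} (hs : s ^ 2 = 1) : ∃ ε : ℤˣ, ((ε : ℤ) : ℝ) = s := by
  rcases sq_eq_one_iff.1 hs with rfl | rfl
  · exact ⟨1, by simp⟩
  · exact ⟨-1, by simp⟩

/-- Two normalized sections differ locally by a constant element of the final group. -/
theorem IsNormalized.exists_eventually_eq (h : S.IsNormalized η U) (h' : S.IsNormalized η' U')
    (hy : y ∈ U) (hy' : y ∈ U') :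
    ∃ ε₁ ε₂ : ℤˣ, ∀ᶠ z in 𝓝 y, η z = matMul (signMatrix ε₁ ε₂) (η' z) := by
  have hV : ∀ᶠ z in 𝓝 y, z ∈ U ∧ z ∈ U' :=
    (h.isOpen.eventually_mem hy).and (h'.isOpen.eventually_mem hy')
  have hO := hV.mono fun z hz => h.transition_orthogonal h' hz.1 hz.2
  have c00 := eventually_eq_of_sq_eq_one (h.continuousAt_transition h' hy hy' 0 0)
    (hO.mono fun z hz => hz.1)
  have c11 := eventually_eq_of_sq_eq_one (h.continuousAt_transition h' hy hy' 1 1)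
    (hO.mono fun z hz => hz.2.1)
  obtain ⟨ε, hε⟩ := exists_units_eq hO.self_of_nhds.1
  obtain ⟨δ, hδ⟩ := exists_units_eq hO.self_of_nhds.2.1
  -- The diagonal is `(ε, δ, εδ, ε)`; the parametrization of the group has `ε₂` in place 1 and `ε₁`
  -- in place 2.
  refine ⟨ε * δ, δ, ?_⟩
  filter_upwards [hV, c00, c11] with z hz h0 h1
  rw [eq_matMul_transition (η := η) (h'.adapted z hz.2).bijective]
  congr 1
  rw [h.transition_eq_diagonal h' hz.1 hz.2, h0, h1, ← hε, ← hδ]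
  unfold signMatrix
  congr 1
  funext i
  fin_cases i <;> simp [mul_assoc]

theorem IsNormalized.mlieBracket_eq (h : S.IsNormalized η U) (hy : y ∈ U) (i j : Fin 4) :
    mlieBracket I4 (dualFrame η i) (dualFrame η j) y =
      ∑ k, (-torsion η k i j y) • dualFrame η k y := by
  have h1 := sum_smul_dualFrame (h.adapted y hy).bijective
    (mlieBracket I4 (dualFrame η i) (dualFrame η j) y)
  simp only [_root_.torsion_eq (h.smooth y hy) (h.eventually_bijective hy), neg_neg]
  exact h1

theorem apply_sum_smul {E ι : Type*} [Fintype ι] [AddCommGroup E] [Module ℝ E] (L : E →ₗ[ℝ] ℝ)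
    (c : ι → ℝ) (e : ι → E) : L (∑ k, c k • e k) = ∑ k, c k * L (e k) := by
  simp [map_sum]

/-- The consequence of the Jacobi identity for a normalized section. -/
theorem IsNormalized.torsion_three_zero_three (h : S.IsNormalized η U) (hy : y ∈ U) :
    torsion η 3 0 3 y = torsion η 1 0 1 y + torsion η 2 0 2 y := by
  have hs := h.smooth y hy
  have hd := h.smooth_dualFrame hy
  have hV := h.isOpen.eventually_mem hy
  have hb := h.eventually_bijective hy
  have hT : ∀ k i j, ∀ᶠ z in 𝓝 y,
      (η z (mlieBracket I4 (dualFrame η i) (dualFrame η j) z) : Col4) k = -torsion η k i j z :=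
    fun k i j => hV.mono fun z hz => by
      rw [_root_.torsion_eq (h.smooth z hz) (h.eventually_bijective hz), neg_neg]
  -- The three inner brackets of the Jacobi identity have locally constant `η³`-components `0`, `0`
  -- and `-1`, so each double bracket has `η³`-component `-dη³` of its two arguments.
  have c01 : ∀ᶠ z in 𝓝 y,
      (η z (mlieBracket I4 (dualFrame η 0) (dualFrame η 1) z) : Col4) 3 = 0 := by
    filter_upwards [hT 3 0 1, hV] with z hz hz'
    rw [hz, h.torsion_three_zero_one hz', neg_zero]
  have c02 : ∀ᶠ z in 𝓝 y,
      (η z (mlieBracket I4 (dualFrame η 0) (dualFrame η 2) z) : Col4) 3 = 0 := by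
    filter_upwards [hT 3 0 2, hV] with z hz hz'
    rw [hz, (h.torsion_eq z hz').2.1, neg_zero]
  have c12 : ∀ᶠ z in 𝓝 y,
      (η z (mlieBracket I4 (dualFrame η 1) (dualFrame η 2) z) : Col4) 3 = -1 := by
    filter_upwards [hT 3 1 2, hV] with z hz hz'
    rw [hz, (h.torsion_eq z hz').2.2.1]
  have e1 := formDerivBilin_field hs (hd 0) ((hd 1).mlieBracket (hd 2))
    (eventually_apply_dualFrame hb 0 3) c12
  have e2 := formDerivBilin_field hs ((hd 0).mlieBracket (hd 1)) (hd 2) c01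
    (eventually_apply_dualFrame hb 2 3)
  have e3 := formDerivBilin_field hs (hd 1) ((hd 0).mlieBracket (hd 2))
    (eventually_apply_dualFrame hb 1 3) c02
  have hM : IsManifold I4 (minSmoothness ℝ 3) Q := by
    rw [minSmoothness_of_isRCLikeNormedField]; infer_instance
  have hd2 := fun i => (hd i).of_le (show minSmoothness ℝ 2 ≤ ∞ by
    rw [minSmoothness_of_isRCLikeNormedField]; exact WithTop.coe_le_coe.2 le_top)
  have hJ := leibniz_identity_mlieBracket_apply (I := I4) (hd2 0) (hd2 1) (hd2 2)
  have hJ' := congrArg (fun v => (η y v : Col4) 3) hJ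
  have hJ2 : (η y (mlieBracket I4 (dualFrame η 0) (mlieBracket I4 (dualFrame η 1) (dualFrame η 2)) y)
      : Col4) 3 = (η y (mlieBracket I4 (mlieBracket I4 (dualFrame η 0) (dualFrame η 1))
        (dualFrame η 2) y) : Col4) 3 + (η y (mlieBracket I4 (dualFrame η 1)
          (mlieBracket I4 (dualFrame η 0) (dualFrame η 2)) y) : Col4) 3 := by
    refine hJ'.trans ?_
    exact congrFun (map_add (η y) _ _) 3
  have hB : ∀ k i j, formDerivBilin η y (dualFrame η i y) (dualFrame η j y) k = torsion η k i j y :=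
    fun k i j => by rw [torsion, formDeriv_eq_formDerivBilin hs]
  have hB10 : formDerivBilin η y (dualFrame η 1 y) (dualFrame η 0 y) 3 = 0 := by
    rw [formDerivBilin_swap, Pi.neg_apply, hB, h.torsion_three_zero_one hy, neg_zero]
  obtain ⟨t1, t2, t3, t4, t5, t6⟩ := h.torsion_eq y hy
  -- Expanding the inner bracket in the frame makes `dη³` of it a sum of products of torsion
  -- coefficients. After normalization one term survives in each case: `T³₀₃`, `T¹₀₁` and `T²₀₂`.
  have hr : ∀ (v : TangentSpace I4 y) (i j : Fin 4),
      formDerivBilin η y v (mlieBracket I4 (dualFrame η i) (dualFrame η j) y) 3 =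
        ∑ k, -torsion η k i j y * formDerivBilin η y v (dualFrame η k y) 3 := fun v i j => by
    rw [h.mlieBracket_eq hy]
    exact apply_sum_smul (LinearMap.proj (R := ℝ) (φ := fun _ : Fin 4 => ℝ) 3 ∘ₗ formDerivBilin η y v) _ _
  have hl : ∀ (v : TangentSpace I4 y) (i j : Fin 4),
      formDerivBilin η y (mlieBracket I4 (dualFrame η i) (dualFrame η j) y) v 3 =
        ∑ k, -torsion η k i j y * formDerivBilin η y (dualFrame η k y) v 3 := fun v i j => by
    rw [h.mlieBracket_eq hy]
    exact apply_sum_smul (LinearMap.proj (R := ℝ) (φ := fun _ : Fin 4 => ℝ) 3 ∘ₗ (formDerivBilin η y).flip v) _ _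
  rw [hr] at e1 e3
  rw [hl] at e2
  have t0 := h.torsion_three_zero_one hy
  have hB11 : formDerivBilin η y (dualFrame η 1 y) (dualFrame η 1 y) 3 = 0 := by
    rw [formDerivBilin_self, Pi.zero_apply]
  have hB22 : formDerivBilin η y (dualFrame η 2 y) (dualFrame η 2 y) 3 = 0 := by
    rw [formDerivBilin_self, Pi.zero_apply]
  rw [Fin.sum_univ_four] at e1 e2 e3
  simp only [t1, t2, t3, t4, t5, t6, t0, hB11, hB22, hB10, hB, neg_zero, zero_mul,
    mul_zero, zero_add, add_zero, mul_one, neg_mul, one_mul, neg_inj] at e1 e2 e3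
  exact e1.trans (hJ2.trans (congrArg₂ (· + ·) e2.symm e3.symm))

end Transition

end EngelStructure

/-! ### Scalar components of forms. -/

section Components

variable {M : Type*} [TopologicalSpace M] [ChartedSpace Model4 M]

/-- The components of a covector with values in `ℝ⁴`. -/
def formComp {x : M} (b : HomBundle M x) (k : Fin 4) : TangentSpace I4 x →ₗ[ℝ] ℝ :=
  LinearMap.proj (R := ℝ) (φ := fun _ : Fin 4 => ℝ) k ∘ₗ b.toLinearMap

/-- The components of the exterior derivative of an `ℝ⁴`-valued form. -/
def formDerivComp (θ : ∀ x : M, HomBundle M x) (k : Fin 4) (x : M) :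
    TangentSpace I4 x →ₗ[ℝ] TangentSpace I4 x →ₗ[ℝ] ℝ :=
  (formDerivBilin θ x).compr₂ (LinearMap.proj (R := ℝ) (φ := fun _ : Fin 4 => ℝ) k)

theorem formDerivComp_swap (θ : ∀ x : M, HomBundle M x) (k : Fin 4) (x : M)
    (v w : TangentSpace I4 x) : formDerivComp θ k x v w = - formDerivComp θ k x w v :=
  congrFun (formDerivBilin_swap θ x v w) k

theorem formDerivComp_self (θ : ∀ x : M, HomBundle M x) (k : Fin 4) (x : M)
    (v : TangentSpace I4 x) : formDerivComp θ k x v v = 0 :=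
  congrFun (formDerivBilin_self θ x v) k

variable [IsManifold I4 ∞ M]

theorem formDerivComp_field {θ : ∀ x : M, HomBundle M x} {x : M} (hθ : SmoothFormAt θ x)
    {V W : ∀ x : M, TangentSpace I4 x} (hV : SmoothFieldAt V x) (hW : SmoothFieldAt W x)
    {k : Fin 4} {c c' : ℝ} (hc : ∀ᶠ y in 𝓝 x, formComp (θ y) k (V y) = c)
    (hc' : ∀ᶠ y in 𝓝 x, formComp (θ y) k (W y) = c') :
    formDerivComp θ k x (V x) (W x) = - formComp (θ x) k (mlieBracket I4 V W x) :=
  formDerivBilin_field hθ hV hW hc hc'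

omit [IsManifold I4 ∞ M] in
theorem sum_formComp_smul_dualFrame {θ : ∀ x : M, HomBundle M x} {x : M}
    (hb : Function.Bijective (θ x)) (v : TangentSpace I4 x) :
    v = ∑ i, formComp (θ x) i v • dualFrame θ i x :=
  sum_smul_dualFrame hb v

end Components

/-! ### The characteristic direction of an Engel distribution. -/

namespace EngelStructure

variable {Q : Type*} [TopologicalSpace Q] [ChartedSpace Model4 Q] [IsManifold I4 ∞ Q]
variable {S : EngelStructure Q}

theorem contMDiffAt_inner (S : EngelStructure Q) {V W : ∀ x : Q, TangentSpace I4 x} {x : Q}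
    (hV : SmoothFieldAt V x) (hW : SmoothFieldAt W x) :
    ContMDiffAt I4 𝓘(ℝ, ℝ) ∞ (fun y => S.metric.inner y (V y) (W y)) x := by
  have h := ContMDiffAt.clm_bundle_apply₂ (F₁ := Model4) (F₂ := Model4) (F₃ := ℝ)
    (E₃ := Bundle.Trivial Q ℝ) (S.metric.contMDiff x) hV hW
  exact (Bundle.contMDiffAt_totalSpace.1 h).2

/-- Smooth Gram-Schmidt orthonormalization of two vector fields. -/
theorem exists_orthonormal_fields (S : EngelStructure Q) {C D : ∀ x : Q, TangentSpace I4 x}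
    {U : Set Q} (hC : ∀ y ∈ U, SmoothFieldAt C y) (hD : ∀ y ∈ U, SmoothFieldAt D y)
    (hC0 : ∀ y ∈ U, C y ≠ 0) (hD0 : ∀ y ∈ U, ∀ c : ℝ, D y + c • C y ≠ 0) :
    ∃ f g h : Q → ℝ, ∃ C' D' : ∀ x : Q, TangentSpace I4 x,
      (∀ y ∈ U, SmoothFieldAt C' y) ∧ (∀ y ∈ U, SmoothFieldAt D' y) ∧
      (∀ y, C' y = f y • C y) ∧ (∀ y, D' y = g y • D y + h y • C y) ∧ ∀ y ∈ U,
        f y ≠ 0 ∧ g y ≠ 0 ∧ S.metric.inner y (C' y) (C' y) = 1 ∧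
        S.metric.inner y (D' y) (D' y) = 1 ∧ S.metric.inner y (C' y) (D' y) = 0 := by
  have norm : ∀ V : ∀ x : Q, TangentSpace I4 x, (∀ y ∈ U, SmoothFieldAt V y) →
      (∀ y ∈ U, V y ≠ 0) → ∃ f : Q → ℝ, (∀ y ∈ U, ContMDiffAt I4 𝓘(ℝ, ℝ) ∞ f y) ∧
        ∀ y ∈ U, f y ≠ 0 ∧ f y * f y * S.metric.inner y (V y) (V y) = 1 := by
    intro V hV hV0
    refine ⟨fun y => (√(S.metric.inner y (V y) (V y)))⁻¹, fun y hy => ?_, fun y hy => ?_⟩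
    · have hp := S.metric.pos y (V y) (hV0 y hy)
      have h1 : ContDiffAt ℝ ∞ (fun t : ℝ => (√t)⁻¹) (S.metric.inner y (V y) (V y)) :=
        (Real.contDiffAt_sqrt hp.ne').inv (Real.sqrt_pos.2 hp).ne'
      exact ContMDiffAt.comp (g := fun t : ℝ => (√t)⁻¹)
        (f := fun y => S.metric.inner y (V y) (V y)) y h1.contMDiffAt
        (S.contMDiffAt_inner (hV y hy) (hV y hy))
    · have hp := S.metric.pos y (V y) (hV0 y hy)
      refine ⟨inv_ne_zero (Real.sqrt_pos.2 hp).ne', ?_⟩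
      rw [← mul_inv, Real.mul_self_sqrt hp.le, inv_mul_cancel₀ hp.ne']
  obtain ⟨f, hf, hf1⟩ := norm C hC hC0
  let C' : ∀ x : Q, TangentSpace I4 x := fun y => f y • C y
  have hC' : ∀ y ∈ U, SmoothFieldAt C' y := fun y hy => (hC y hy).smul (hf y hy)
  let m : Q → ℝ := fun y => - S.metric.inner y (D y) (C' y)
  have hm : ∀ y ∈ U, ContMDiffAt I4 𝓘(ℝ, ℝ) ∞ m y := fun y hy =>
    (S.contMDiffAt_inner (hD y hy) (hC' y hy)).neg
  let E : ∀ x : Q, TangentSpace I4 x := fun y => D y + m y • C' y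
  have hE : ∀ y ∈ U, SmoothFieldAt E y := fun y hy => (hD y hy).add ((hC' y hy).smul (hm y hy))
  have hE0 : ∀ y ∈ U, E y ≠ 0 := fun y hy => by
    have := hD0 y hy (m y * f y)
    rwa [mul_smul] at this
  obtain ⟨g, hg, hg1⟩ := norm E hE hE0
  refine ⟨f, g, fun y => g y * m y * f y, C', fun y => g y • E y, hC',
    fun y hy => (hE y hy).smul (hg y hy), fun y => rfl, fun y => ?_, fun y hy => ?_⟩
  · change g y • (D y + m y • f y • C y) = _
    rw [smul_add, smul_smul, smul_smul]
  · have e1 : S.metric.inner y (C' y) (C' y) = 1 := by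
      have := (hf1 y hy).2
      change S.metric.inner y (f y • C y) (f y • C y) = 1
      rw [map_smul, ContinuousLinearMap.map_smul, _root_.smul_apply, smul_eq_mul, smul_eq_mul,
        ← mul_assoc, this]
    refine ⟨(hf1 y hy).1, (hg1 y hy).1, e1, ?_, ?_⟩
    · have := (hg1 y hy).2
      rw [map_smul, ContinuousLinearMap.map_smul, _root_.smul_apply, smul_eq_mul, smul_eq_mul,
        ← mul_assoc, this]
    · have e2 : S.metric.inner y (C' y) (E y) = 0 := by
        change S.metric.inner y (C' y) (D y + m y • C' y) = 0
        have e3 := map_add (S.metric.inner y (C' y)) (D y) (m y • C' y)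
        have e4 := map_smul (S.metric.inner y (C' y)) (m y) (C' y)
        rw [e1, smul_eq_mul, mul_one] at e4
        rw [e3, e4, S.metric.symm]
        exact add_neg_cancel _
      rw [ContinuousLinearMap.map_smul, e2, smul_zero]

/-- A coframe `θ` and a frame `C`, `D` of `H` that are adapted to the characteristic direction of
an Engel distribution. -/
structure IsCharacteristic (S : EngelStructure Q) (θ : ∀ y : Q, HomBundle Q y)
    (C D : ∀ y : Q, TangentSpace I4 y) (U : Set Q) : Prop where
  isOpen : IsOpen U
  smooth : ∀ y ∈ U, SmoothFormAt θ y
  bijective : ∀ y ∈ U, Function.Bijective (θ y)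
  smooth_left : ∀ y ∈ U, SmoothFieldAt C y
  smooth_right : ∀ y ∈ U, SmoothFieldAt D y
  mem_H_iff : ∀ y ∈ U, ∀ v, v ∈ S.H y ↔ formComp (θ y) 2 v = 0 ∧ formComp (θ y) 3 v = 0
  annihilates_H1 : ∀ y ∈ U, ∀ v ∈ S.H1 y, formComp (θ y) 3 v = 0
  left_mem : ∀ y ∈ U, C y ∈ S.H y
  right_mem : ∀ y ∈ U, D y ∈ S.H y
  deriv_ne : ∀ y ∈ U, formDerivComp θ 2 y (C y) (D y) ≠ 0
  -- On `ker θ³`, `C` lies in the kernel of `dθ³`, whereas `D` pairs to zero only with vectors of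
  -- `H`.
  deriv_left : ∀ y ∈ U, ∀ v, formComp (θ y) 3 v = 0 → formDerivComp θ 3 y (C y) v = 0
  deriv_right : ∀ y ∈ U, ∀ v, formComp (θ y) 3 v = 0 → formDerivComp θ 3 y (D y) v = 0 →
    formComp (θ y) 2 v = 0

/-- `θᵏ([X, Y]) = -dθᵏ(X, Y)` for sections `X`, `Y` of `H`. This is how forms are shown to kill
`H¹`, also after pull-back. -/
theorem annihilates_H1_of_deriv {θ : ∀ y : Q, HomBundle Q y} {y : Q} {k : Fin 4}
    (hθ : SmoothFormAt θ y) (hH : ∀ᶠ z in 𝓝 y, ∀ v ∈ S.H z, formComp (θ z) k v = 0)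
    (hd : ∀ v ∈ S.H y, ∀ w ∈ S.H y, formDerivComp θ k y v w = 0) :
    ∀ v ∈ S.H1 y, formComp (θ y) k v = 0 := by
  have h : S.H1 y ≤ LinearMap.ker (formComp (θ y) k) := by
    refine sup_le (fun v hv => hH.self_of_nhds v hv) (Submodule.span_le.2 ?_)
    rintro _ ⟨U, hU, hy, X, Y, hX, hY, hXY, rfl⟩
    have hm := hU.eventually_mem hy
    have h1 := formDerivComp_field hθ ((hX y hy).contMDiffAt (hU.mem_nhds hy))
      ((hY y hy).contMDiffAt (hU.mem_nhds hy)) (k := k) (c := 0) (c' := 0)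
      ((hm.and hH).mono fun z hz => hz.2 _ (hXY z hz.1).1)
      ((hm.and hH).mono fun z hz => hz.2 _ (hXY z hz.1).2)
    rw [hd _ (hXY y hy).1 _ (hXY y hy).2] at h1
    exact neg_eq_zero.1 h1.symm
  exact h

/-- With `Z = [X, Y]`, `p = θ³([X, Z])` and `q = θ³([Y, Z])`, the form `dθ³` on `ker θ³` pairs `sX +
tY` with `Z` to `-(sp + tq)` and vanishes on `H`. So `qX - pY` is characteristic, and the Engel
condition says that `(p, q)` does not vanish. -/
theorem exists_isCharacteristic (S : EngelStructure Q) (x : Q) :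
    ∃ U θ C D, x ∈ U ∧ S.IsCharacteristic θ C D U := by
  obtain ⟨U, hU, hx, X, Y, h⟩ := S.exists_frame x
  obtain ⟨a, b, hab⟩ := S.engel U hU X Y h
  have sX : ∀ y ∈ U, SmoothFieldAt X y := fun y hy =>
    (h.smooth_left y hy).contMDiffAt (hU.mem_nhds hy)
  have sY : ∀ y ∈ U, SmoothFieldAt Y y := fun y hy =>
    (h.smooth_right y hy).contMDiffAt (hU.mem_nhds hy)
  set Z := mlieBracket I4 X Y with hZ
  have sZ : ∀ y ∈ U, SmoothFieldAt Z y := fun y hy => (sX y hy).mlieBracket (sY y hy)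
  -- The functions `a`, `b` need not be continuous. They are frozen at `x`; independence at `x` then
  -- persists nearby because the resulting frame is smooth.
  let a₀ := a x
  let b₀ := b x
  let W : ∀ y : Q, TangentSpace I4 y := fun y =>
    a₀ • mlieBracket I4 X Z y + b₀ • mlieBracket I4 Y Z y
  have sW : ∀ y ∈ U, SmoothFieldAt W y := fun y hy =>
    (((sX y hy).mlieBracket (sZ y hy)).smul contMDiffAt_const).add
      (((sY y hy).mlieBracket (sZ y hy)).smul contMDiffAt_const)
  let e : Fin 4 → ∀ y : Q, TangentSpace I4 y := ![X, Y, Z, W]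
  have se : ∀ y ∈ U, ∀ i, SmoothFieldAt (e i) y := by
    intro y hy i
    fin_cases i
    exacts [sX y hy, sY y hy, sZ y hy, sW y hy]
  have hex : (frameMap e x).IsInvertible := by
    apply isInvertible_frameMap
    convert hab x hx using 1
    funext i
    fin_cases i <;> rfl
  obtain ⟨U', hU'1, hU', hxU'⟩ := mem_nhds_iff.1
    ((hU.eventually_mem hx).and (eventually_isInvertible_frameMap (se x hx) hex))
  let θ := dualCoframe e
  have sθ : ∀ y ∈ U', SmoothFormAt θ y := fun y hy =>
    smoothFormAt_dualCoframe (se y (hU'1 hy).1) (hU'1 hy).2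
  have hθe : ∀ y ∈ U', ∀ k i, formComp (θ y) k (e i y) = (Pi.single i 1 : Col4) k :=
    fun y hy k i => congrFun (dualCoframe_apply (hU'1 hy).2 i) k
  have hθb : ∀ y ∈ U', Function.Bijective (θ y) := fun y hy => dualCoframe_bijective (hU'1 hy).2
  have hsum : ∀ y ∈ U', ∀ v : TangentSpace I4 y, v = formComp (θ y) 0 v • X y +
      formComp (θ y) 1 v • Y y + formComp (θ y) 2 v • Z y + formComp (θ y) 3 v • W y := by
    intro y hy v
    have h1 := sum_formComp_smul_dualFrame (hθb y hy) v
    have h2 : ∀ i, dualFrame θ i y = e i y := fun i =>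
      dualFrame_eq (hθb y hy) (dualCoframe_apply (hU'1 hy).2 i)
    rw [Fin.sum_univ_four, h2, h2, h2, h2] at h1
    exact h1
  have hd : ∀ y ∈ U', ∀ k i j, formDerivComp θ k y (e i y) (e j y) =
      - formComp (θ y) k (mlieBracket I4 (e i) (e j) y) := by
    intro y hy k i j
    have hm := hU'.eventually_mem hy
    exact formDerivComp_field (sθ y hy) (se y (hU'1 hy).1 i) (se y (hU'1 hy).1 j)
      (hm.mono fun z hz => hθe z hz k i) (hm.mono fun z hz => hθe z hz k j)
  have memH : ∀ y ∈ U', ∀ v, v ∈ S.H y ↔ formComp (θ y) 2 v = 0 ∧ formComp (θ y) 3 v = 0 := by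
    intro y hy v
    have eX2 := hθe y hy 2 0
    have eX3 := hθe y hy 3 0
    have eY2 := hθe y hy 2 1
    have eY3 := hθe y hy 3 1
    constructor
    · intro hv
      rw [← h.span_eq y (hU'1 hy).1, Submodule.mem_span_pair] at hv
      obtain ⟨c, c', rfl⟩ := hv
      have e2 : formComp (θ y) 2 (X y) = 0 := eX2.trans (by simp)
      have e3 : formComp (θ y) 3 (X y) = 0 := eX3.trans (by simp)
      have e4 : formComp (θ y) 2 (Y y) = 0 := eY2.trans (by simp)
      have e5 : formComp (θ y) 3 (Y y) = 0 := eY3.trans (by simp)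
      rw [map_add, map_add, map_smul, map_smul, map_smul, map_smul, e2, e3, e4, e5]
      simp
    · rintro ⟨h2, h3⟩
      have h1 := hsum y hy v
      rw [h2, h3, zero_smul, zero_smul, add_zero, add_zero] at h1
      rw [h1]
      have := h.mem (hU'1 hy).1
      exact add_mem (Submodule.smul_mem _ _ this.1) (Submodule.smul_mem _ _ this.2)
  have d3 : ∀ y ∈ U', formDerivComp θ 3 y (X y) (Y y) = 0 := fun y hy =>
    (hd y hy 3 0 1).trans (neg_eq_zero.2 ((hθe y hy 3 2).trans (by simp)))
  have d2 : ∀ y ∈ U', formDerivComp θ 2 y (X y) (Y y) = -1 := fun y hy =>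
    (hd y hy 2 0 1).trans (congrArg Neg.neg ((hθe y hy 2 2).trans (by simp)))
  let p : Q → ℝ := fun y => formComp (θ y) 3 (mlieBracket I4 X Z y)
  let q : Q → ℝ := fun y => formComp (θ y) 3 (mlieBracket I4 Y Z y)
  have sp : ∀ y ∈ U', ContMDiffAt I4 𝓘(ℝ, ℝ) ∞ p y := fun y hy =>
    (sθ y hy).apply ((sX y (hU'1 hy).1).mlieBracket (sZ y (hU'1 hy).1)) 3
  have sq : ∀ y ∈ U', ContMDiffAt I4 𝓘(ℝ, ℝ) ∞ q y := fun y hy =>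
    (sθ y hy).apply ((sY y (hU'1 hy).1).mlieBracket (sZ y (hU'1 hy).1)) 3
  have dXZ : ∀ y ∈ U', formDerivComp θ 3 y (X y) (Z y) = -p y := fun y hy => hd y hy 3 0 2
  have dYZ : ∀ y ∈ U', formDerivComp θ 3 y (Y y) (Z y) = -q y := fun y hy => hd y hy 3 1 2
  -- This is `θ³(W) = 1`. It makes `a₀ X + b₀ Y` a complement of the characteristic direction in
  -- `H`.
  have hpq : ∀ y ∈ U', a₀ * p y + b₀ * q y = 1 := by
    intro y hy
    have h1 : formComp (θ y) 3 (W y) = 1 := (hθe y hy 3 3).trans (by simp)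
    change formComp (θ y) 3 (a₀ • mlieBracket I4 X Z y + b₀ • mlieBracket I4 Y Z y) = 1 at h1
    rwa [map_add, map_smul, map_smul] at h1
  have dval : ∀ y ∈ U', ∀ (s t : ℝ) (v : TangentSpace I4 y), formComp (θ y) 3 v = 0 →
      formDerivComp θ 3 y (s • X y + t • Y y) v = - (formComp (θ y) 2 v * (s * p y + t * q y)) := by
    intro y hy s t v hv
    have h1 := hsum y hy v
    rw [hv, zero_smul, add_zero] at h1
    have h2 := formDerivComp_swap θ 3 y (Y y) (X y)
    rw [d3 y hy, neg_zero] at h2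
    conv_lhs => rw [h1]
    simp only [map_add, map_smul, LinearMap.add_apply, LinearMap.smul_apply, d3 y hy, dXZ y hy,
      dYZ y hy, formDerivComp_self, h2, smul_eq_mul]
    ring
  refine ⟨U', θ, fun y => q y • X y + (-p y) • Y y, fun y => a₀ • X y + b₀ • Y y, hxU',
    hU', sθ, hθb, ?_, ?_, memH, ?_, ?_, ?_, ?_, ?_, ?_⟩
  · exact fun y hy => ((sX y (hU'1 hy).1).smul (sq y hy)).add
      ((sY y (hU'1 hy).1).smul (sp y hy).neg)
  · exact fun y hy => ((sX y (hU'1 hy).1).smul contMDiffAt_const).add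
      ((sY y (hU'1 hy).1).smul contMDiffAt_const)
  · intro y hy
    refine annihilates_H1_of_deriv (sθ y hy)
      ((hU'.eventually_mem hy).mono fun z hz v hv => ((memH z hz v).1 hv).2) ?_
    intro v hv w hw
    have h1 := hsum y hy v
    rw [((memH y hy v).1 hv).1, ((memH y hy v).1 hv).2, zero_smul, zero_smul, add_zero,
      add_zero] at h1
    rw [h1, dval y hy _ _ w ((memH y hy w).1 hw).2, ((memH y hy w).1 hw).1, zero_mul, neg_zero]
  · intro y hy
    have := h.mem (hU'1 hy).1
    exact add_mem (Submodule.smul_mem _ _ this.1) (Submodule.smul_mem _ _ this.2)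
  · intro y hy
    have := h.mem (hU'1 hy).1
    exact add_mem (Submodule.smul_mem _ _ this.1) (Submodule.smul_mem _ _ this.2)
  · intro y hy
    have h2 := formDerivComp_swap θ 2 y (Y y) (X y)
    rw [d2 y hy, neg_neg] at h2
    simp only [map_add, map_smul, LinearMap.add_apply, LinearMap.smul_apply, d2 y hy,
      formDerivComp_self, h2, smul_eq_mul]
    have := hpq y hy
    intro h0
    have : (1 : ℝ) = 0 := by linarith
    exact one_ne_zero this
  · intro y hy v hv
    rw [dval y hy _ _ v hv]
    ring
  · intro y hy v hv h0
    rwa [dval y hy _ _ v hv, hpq y hy, mul_one, neg_eq_zero] at h0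

/-- Gram-Schmidt that starts with `C` rescales `C` and changes `D` by a nonzero factor and a
multiple of `C`; all the conditions are stable under this. -/
theorem exists_isCharacteristic_orthonormal (S : EngelStructure Q) (x : Q) :
    ∃ U θ C D, x ∈ U ∧ S.IsCharacteristic θ C D U ∧ ∀ y ∈ U,
      S.metric.inner y (C y) (C y) = 1 ∧ S.metric.inner y (D y) (D y) = 1 ∧
      S.metric.inner y (C y) (D y) = 0 := by
  obtain ⟨U, θ, C, D, hx, h⟩ := S.exists_isCharacteristic x
  obtain ⟨f, g, k, C', D', sC, sD, hC, hD, ho⟩ := S.exists_orthonormal_fields h.smooth_left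
    h.smooth_right
    -- Independence of `C` and `D` is read off from `dθ²(C, D) ≠ 0`.
    (fun y hy h0 => h.deriv_ne y hy (by rw [h0, map_zero, LinearMap.zero_apply]))
    (fun y hy c h0 => h.deriv_ne y hy (by
      have h1 := map_add (formDerivComp θ 2 y (C y)) (D y) (c • C y)
      rw [h0, map_zero, map_smul, formDerivComp_self, smul_zero, add_zero] at h1
      exact h1.symm))
  refine ⟨U, θ, C', D', hx, ⟨h.isOpen, h.smooth, h.bijective, sC, sD, h.mem_H_iff,
    h.annihilates_H1, fun y hy => ?_, fun y hy => ?_, fun y hy => ?_, fun y hy v hv => ?_,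
    fun y hy v hv h0 => ?_⟩, fun y hy => (ho y hy).2.2⟩
  · rw [hC]
    exact Submodule.smul_mem _ _ (h.left_mem y hy)
  · rw [hD]
    exact add_mem (Submodule.smul_mem _ _ (h.right_mem y hy))
      (Submodule.smul_mem _ _ (h.left_mem y hy))
  · rw [hC, hD]
    simp only [map_add, map_smul, LinearMap.smul_apply, formDerivComp_self, smul_eq_mul, mul_zero,
      add_zero]
    exact mul_ne_zero (ho y hy).2.1 (mul_ne_zero (ho y hy).1 (h.deriv_ne y hy))
  · rw [hC, map_smul, LinearMap.smul_apply, h.deriv_left y hy v hv, smul_zero]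
  · rw [hD, map_add, map_smul, map_smul, LinearMap.add_apply, LinearMap.smul_apply,
      LinearMap.smul_apply, h.deriv_left y hy v hv, smul_zero, add_zero] at h0
    exact h.deriv_right y hy v hv ((smul_eq_zero.1 h0).resolve_left (ho y hy).2.1)

end EngelStructure

/-! ### Existence of normalized sections. -/

namespace EngelStructure

variable {Q : Type*} [TopologicalSpace Q] [ChartedSpace Model4 Q] [IsManifold I4 ∞ Q]

/-- The frame is `A`, `B`, `C`, `D`, with `A` unit characteristic and `B` its unit orthogonal
partner in `H`; the normalizations dictate `C` and `D`. The auxiliary coframe `θ` certifies that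
these are independent and respect `H` and `H¹`. -/
theorem exists_isNormalized (S : EngelStructure Q) (x : Q) :
    ∃ U η, x ∈ U ∧ S.IsNormalized η U := by
  obtain ⟨U, θ, A, B, hx, h, ho⟩ := S.exists_isCharacteristic_orthonormal x
  let L := mlieBracket I4 A B
  have sL : ∀ y ∈ U, SmoothFieldAt L y := fun y hy =>
    (h.smooth_left y hy).mlieBracket (h.smooth_right y hy)
  -- Minus the component of `[A, B]` orthogonal to `H`: the sign gives `T²₀₁ = 1`, the orthogonality
  -- gives membership in `B₀`.
  let C : ∀ y : Q, TangentSpace I4 y := fun y =>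
    S.metric.inner y (A y) (L y) • A y + S.metric.inner y (B y) (L y) • B y - L y
  have sC : ∀ y ∈ U, SmoothFieldAt C y := fun y hy =>
    (((h.smooth_left y hy).smul (S.contMDiffAt_inner (h.smooth_left y hy) (sL y hy))).add
      ((h.smooth_right y hy).smul (S.contMDiffAt_inner (h.smooth_right y hy) (sL y hy)))).sub
      (sL y hy)
  -- This choice settles all four coefficients `Tᵏ₁₂` at once.
  let D : ∀ y : Q, TangentSpace I4 y := fun y => - mlieBracket I4 B C y
  have sD : ∀ y ∈ U, SmoothFieldAt D y := fun y hy =>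
    ((h.smooth_right y hy).mlieBracket (sC y hy)).neg
  let e : Fin 4 → ∀ y : Q, TangentSpace I4 y := ![A, B, C, D]
  have se : ∀ y ∈ U, ∀ i, SmoothFieldAt (e i) y := by
    intro y hy i
    fin_cases i
    exacts [h.smooth_left y hy, h.smooth_right y hy, sC y hy, sD y hy]
  have A2 : ∀ y ∈ U, formComp (θ y) 2 (A y) = 0 := fun y hy =>
    ((h.mem_H_iff y hy _).1 (h.left_mem y hy)).1
  have A3 : ∀ y ∈ U, formComp (θ y) 3 (A y) = 0 := fun y hy =>
    ((h.mem_H_iff y hy _).1 (h.left_mem y hy)).2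
  have B2 : ∀ y ∈ U, formComp (θ y) 2 (B y) = 0 := fun y hy =>
    ((h.mem_H_iff y hy _).1 (h.right_mem y hy)).1
  have B3 : ∀ y ∈ U, formComp (θ y) 3 (B y) = 0 := fun y hy =>
    ((h.mem_H_iff y hy _).1 (h.right_mem y hy)).2
  have L2 : ∀ y ∈ U, formComp (θ y) 2 (L y) ≠ 0 := fun y hy h0 => by
    have h1 := formDerivComp_field (h.smooth y hy) (h.smooth_left y hy) (h.smooth_right y hy)
      ((h.isOpen.eventually_mem hy).mono A2) ((h.isOpen.eventually_mem hy).mono B2)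
    exact h.deriv_ne y hy (h1.trans (neg_eq_zero.2 h0))
  have L3 : ∀ y ∈ U, formComp (θ y) 3 (L y) = 0 := fun y hy =>
    h.annihilates_H1 y hy _ (S.mlieBracket_mem_H1 h.isOpen hy
      (fun z hz => (h.smooth_left z hz).contMDiffWithinAt)
      (fun z hz => (h.smooth_right z hz).contMDiffWithinAt)
      fun z hz => ⟨h.left_mem z hz, h.right_mem z hz⟩)
  have C2 : ∀ y ∈ U, formComp (θ y) 2 (C y) ≠ 0 := fun y hy => by
    change formComp (θ y) 2 (S.metric.inner y (A y) (L y) • A y +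
      S.metric.inner y (B y) (L y) • B y - L y) ≠ 0
    rw [map_sub, map_add, map_smul, map_smul, A2 y hy, B2 y hy, smul_zero, smul_zero, add_zero,
      zero_sub]
    exact neg_ne_zero.2 (L2 y hy)
  have C3 : ∀ y ∈ U, formComp (θ y) 3 (C y) = 0 := fun y hy => by
    change formComp (θ y) 3 (S.metric.inner y (A y) (L y) • A y +
      S.metric.inner y (B y) (L y) • B y - L y) = 0
    rw [map_sub, map_add, map_smul, map_smul, A3 y hy, B3 y hy, L3 y hy, smul_zero, smul_zero,
      add_zero, sub_zero]
  have D3 : ∀ y ∈ U, formComp (θ y) 3 (D y) ≠ 0 := fun y hy h0 => by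
    have h1 := formDerivComp_field (h.smooth y hy) (h.smooth_right y hy) (sC y hy)
      ((h.isOpen.eventually_mem hy).mono B3) ((h.isOpen.eventually_mem hy).mono C3)
    rw [← map_neg] at h1
    exact C2 y hy (h.deriv_right y hy _ (C3 y hy) (h1.trans h0))
  -- Here it matters that `A` is characteristic; the result becomes `T³₀₂ = 0`.
  have AC3 : ∀ y ∈ U, formComp (θ y) 3 (mlieBracket I4 A C y) = 0 := fun y hy => by
    have h1 := formDerivComp_field (h.smooth y hy) (h.smooth_left y hy) (sC y hy)
      ((h.isOpen.eventually_mem hy).mono A3) ((h.isOpen.eventually_mem hy).mono C3)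
    rw [h.deriv_left y hy _ (C3 y hy)] at h1
    exact neg_eq_zero.1 h1.symm
  have AC : ∀ y ∈ U, S.metric.inner y (A y) (C y) = 0 := fun y hy => by
    obtain ⟨hA, hB, hAB⟩ := ho y hy
    have e1 := map_sub (S.metric.inner y (A y)) (S.metric.inner y (A y) (L y) • A y +
      S.metric.inner y (B y) (L y) • B y) (L y)
    refine e1.trans ?_
    rw [map_add, map_smul, map_smul, hA, hAB]
    simp
  have BC : ∀ y ∈ U, S.metric.inner y (B y) (C y) = 0 := fun y hy => by
    obtain ⟨hA, hB, hAB⟩ := ho y hy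
    rw [S.metric.symm] at hAB
    have e1 := map_sub (S.metric.inner y (B y)) (S.metric.inner y (A y) (L y) • A y +
      S.metric.inner y (B y) (L y) • B y) (L y)
    refine e1.trans ?_
    rw [map_add, map_smul, map_smul, hB, hAB]
    simp
  have he : ∀ y ∈ U, (frameMap e y).IsInvertible := by
    intro y hy
    obtain ⟨hA, hB, hAB⟩ := ho y hy
    have hBA := hAB
    rw [S.metric.symm] at hBA
    apply isInvertible_frameMap
    rw [Fintype.linearIndependent_iff]
    intro c hc
    rw [Fin.sum_univ_four] at hc
    replace hc : c 0 • A y + c 1 • B y + c 2 • C y + c 3 • D y = 0 := hc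
    -- The frame is triangular with respect to `θ³` and `θ²`; on the remaining two vectors the
    -- metric decides.
    have c3 : c 3 = 0 := by
      have := congrArg (formComp (θ y) 3) hc
      simp only [map_add, map_smul, A3 y hy, B3 y hy, C3 y hy, smul_zero, add_zero, zero_add,
        map_zero] at this
      exact (smul_eq_zero.1 this).resolve_right (D3 y hy)
    have c2 : c 2 = 0 := by
      have := congrArg (formComp (θ y) 2) hc
      simp only [map_add, map_smul, A2 y hy, B2 y hy, c3, smul_zero, add_zero, zero_add, zero_smul,
        map_zero] at this
      exact (smul_eq_zero.1 this).resolve_right (C2 y hy)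
    rw [c3, c2, zero_smul, zero_smul, add_zero, add_zero] at hc
    have c0 : c 0 = 0 := by
      have := congrArg (S.metric.inner y (A y)) hc
      rw [map_add, map_smul, map_smul, hA, hAB, map_zero] at this
      simpa using this
    have c1 : c 1 = 0 := by
      have := congrArg (S.metric.inner y (B y)) hc
      rw [map_add, map_smul, map_smul, hB, hBA, map_zero] at this
      simpa using this
    intro i
    fin_cases i
    exacts [c0, c1, c2, c3]
  let η := dualCoframe e
  have hη : ∀ y ∈ U, Function.Bijective (η y) := fun y hy => dualCoframe_bijective (he y hy)
  have sη : ∀ y ∈ U, SmoothFormAt η y := fun y hy => smoothFormAt_dualCoframe (se y hy) (he y hy)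
  have hηe : ∀ y ∈ U, ∀ k i, formComp (η y) k (e i y) = (Pi.single i 1 : Col4) k :=
    fun y hy k i => congrFun (dualCoframe_apply (he y hy) i) k
  have hd : ∀ y ∈ U, ∀ i, dualFrame η i y = e i y := fun y hy i =>
    dualFrame_eq (hη y hy) (dualCoframe_apply (he y hy) i)
  have hsum : ∀ y ∈ U, ∀ v : TangentSpace I4 y, v = formComp (η y) 0 v • A y +
      formComp (η y) 1 v • B y + formComp (η y) 2 v • C y + formComp (η y) 3 v • D y := by
    intro y hy v
    have h1 := sum_formComp_smul_dualFrame (hη y hy) v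
    rw [Fin.sum_univ_four, hd y hy, hd y hy, hd y hy, hd y hy] at h1
    exact h1
  have η3 : ∀ y ∈ U, ∀ v, formComp (θ y) 3 v = 0 → formComp (η y) 3 v = 0 := by
    intro y hy v hv
    have h1 := congrArg (formComp (θ y) 3) (hsum y hy v)
    simp only [map_add, map_smul, A3 y hy, B3 y hy, C3 y hy, hv, smul_zero, zero_add] at h1
    exact (smul_eq_zero.1 h1.symm).resolve_right (D3 y hy)
  have η2 : ∀ y ∈ U, ∀ v, formComp (θ y) 2 v = 0 → formComp (θ y) 3 v = 0 →
      formComp (η y) 2 v = 0 := by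
    intro y hy v hv hv3
    have h1 := congrArg (formComp (θ y) 2) (hsum y hy v)
    simp only [map_add, map_smul, A2 y hy, B2 y hy, hv, smul_zero, zero_add, η3 y hy v hv3,
      zero_smul, add_zero] at h1
    exact (smul_eq_zero.1 h1.symm).resolve_right (C2 y hy)
  have ht : ∀ y ∈ U, ∀ k i j, torsion η k i j y =
      - formComp (η y) k (mlieBracket I4 (e i) (e j) y) := by
    intro y hy k i j
    have hm := h.isOpen.eventually_mem hy
    rw [torsion, hd y hy, hd y hy, formDeriv_eq_formDerivBilin (sη y hy)]
    exact formDerivComp_field (sη y hy) (se y hy i) (se y hy j)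
      (hm.mono fun z hz => hηe z hz k i) (hm.mono fun z hz => hηe z hz k j)
  have t12 : ∀ y ∈ U, ∀ k, torsion η k 1 2 y = (Pi.single 3 1 : Col4) k := fun y hy k => by
    rw [ht y hy, ← map_neg]
    exact hηe y hy k 3
  refine ⟨U, η, hx, h.isOpen, sη, fun y hy => ⟨hη y hy, ?_, ?_, ?_⟩, fun y hy => ?_⟩
  · intro v hv
    obtain ⟨h2, h3⟩ := (h.mem_H_iff y hy v).1 hv
    exact ⟨η2 y hy v h2 h3, η3 y hy v h3⟩
  · exact fun v hv => η3 y hy v (h.annihilates_H1 y hy v hv)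
  · intro v hv w hw
    obtain ⟨hA, hB, hAB⟩ := ho y hy
    have hBA := hAB
    rw [S.metric.symm] at hBA
    obtain ⟨h2, h3⟩ := (h.mem_H_iff y hy v).1 hv
    have ev := hsum y hy v
    have ew := hsum y hy w
    rw [η2 y hy v h2 h3, η3 y hy v h3, zero_smul, zero_smul, add_zero, add_zero] at ev
    rw [η3 y hy w (h.annihilates_H1 y hy w hw), zero_smul, add_zero] at ew
    have hv : S.metric.inner y v w = formComp (η y) 0 v * S.metric.inner y (A y) w +
        formComp (η y) 1 v * S.metric.inner y (B y) w := by
      conv_lhs => rw [ev, map_add, map_smul, map_smul]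
      rfl
    have hAw : S.metric.inner y (A y) w = formComp (η y) 0 w := by
      conv_lhs => rw [ew, map_add, map_add, map_smul, map_smul, map_smul, hA, hAB, AC y hy]
      simp
    have hBw : S.metric.inner y (B y) w = formComp (η y) 1 w := by
      conv_lhs => rw [ew, map_add, map_add, map_smul, map_smul, map_smul, hBA, hB, BC y hy]
      simp
    rw [hv, hAw, hBw]
    rfl
  · refine ⟨?_, ?_, ?_, ?_, ?_, ?_⟩
    · rw [ht y hy]
      have h1 : L y = S.metric.inner y (A y) (L y) • A y + S.metric.inner y (B y) (L y) • B y
          - C y := (sub_sub_cancel _ _).symm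
      have h2 := congrArg (formComp (η y) 2) h1
      have a2 : formComp (η y) 2 (A y) = 0 := (hηe y hy 2 0).trans (by simp)
      have b2 : formComp (η y) 2 (B y) = 0 := (hηe y hy 2 1).trans (by simp)
      have c2 : formComp (η y) 2 (C y) = 1 := (hηe y hy 2 2).trans (by simp)
      rw [map_sub, map_add, map_smul, map_smul, a2, b2, c2] at h2
      change - formComp (η y) 2 (L y) = 1
      rw [h2]
      simp
    · rw [ht y hy]
      exact neg_eq_zero.2 (η3 y hy _ (AC3 y hy))
    all_goals
      rw [t12 y hy]
      simp

end EngelStructure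

/-! ### Constant matrices and pull-backs acting on torsion. -/

section MatMul

variable {M : Type*} [TopologicalSpace M] [ChartedSpace Model4 M]

theorem formInChart_matMul (g : Matrix (Fin 4) (Fin 4) ℝ) (θ : ∀ x : M, HomBundle M x) (x : M) :
    formInChart (fun y => matMul g (θ y)) x =
      fun u => (LinearMap.toContinuousLinearMap g.mulVecLin : Col4 →L[ℝ] Col4).comp
        (formInChart θ x u) := rfl

variable [IsManifold I4 ∞ M]

theorem SmoothFormAt.matMul {θ : ∀ x : M, HomBundle M x} {x : M} (hθ : SmoothFormAt θ x)
    (g : Matrix (Fin 4) (Fin 4) ℝ) : SmoothFormAt (fun y => matMul g (θ y)) x := by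
  rw [smoothFormAt_iff, formInChart_matMul]
  exact contDiffAt_const.clm_comp (smoothFormAt_iff.1 hθ)

theorem formDeriv_matMul {θ : ∀ x : M, HomBundle M x} {x : M} (hθ : SmoothFormAt θ x)
    (g : Matrix (Fin 4) (Fin 4) ℝ) (v w : TangentSpace I4 x) :
    formDeriv (fun y => matMul g (θ y)) x v w = g *ᵥ formDeriv θ x v w := by
  have h1 := (smoothFormAt_iff.1 hθ).differentiableAt (by simp)
  have h2 := (smoothFormAt_iff.1 (hθ.matMul g)).differentiableAt (by simp)
  rw [formDeriv_eq h1, formDeriv_eq h2, formInChart_matMul, Matrix.mulVec_sub]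
  have h3 := ((hasFDerivAt_const (LinearMap.toContinuousLinearMap g.mulVecLin : Col4 →L[ℝ] Col4)
    (extChartAt I4 x x)).clm_comp h1.hasFDerivAt).fderiv
  have h4 : ∀ a b : Model4, fderiv ℝ (fun u => (LinearMap.toContinuousLinearMap g.mulVecLin :
      Col4 →L[ℝ] Col4).comp (formInChart θ x u)) (extChartAt I4 x x) a b =
      g *ᵥ fderiv ℝ (formInChart θ x) (extChartAt I4 x x) a b := fun a b => by
    rw [h3]
    simp
  exact congrArg₂ (· - ·) (h4 _ _) (h4 _ _)

end MatMul

section Pullback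

variable {M : Type*} [TopologicalSpace M] [ChartedSpace Model4 M]
variable {N : Type*} [TopologicalSpace N] [ChartedSpace Model4 N]

theorem pullForm_bijective {f : M → N} {x : M} (hdf : (mfderiv I4 I4 f x).IsInvertible)
    {θ : ∀ y : N, HomBundle N y} (hb : Function.Bijective (θ (f x))) :
    Function.Bijective (pullForm f θ x) :=
  hb.comp hdf.bijective

theorem dualFrame_pullForm {f : M → N} {x : M} (hdf : (mfderiv I4 I4 f x).IsInvertible)
    {θ : ∀ y : N, HomBundle N y} (hb : Function.Bijective (θ (f x))) (i : Fin 4) :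
    mfderiv I4 I4 f x (dualFrame (pullForm f θ) i x) = dualFrame θ i (f x) :=
  hb.1 ((apply_dualFrame (pullForm_bijective hdf hb) i).trans (apply_dualFrame hb i).symm)

variable [IsManifold I4 ∞ M] [IsManifold I4 ∞ N]

theorem torsion_pullForm {f : M → N} {x : M} (hf : ContMDiffAt I4 I4 ∞ f x)
    (hdf : (mfderiv I4 I4 f x).IsInvertible) {θ : ∀ y : N, HomBundle N y}
    (hθ : SmoothFormAt θ (f x)) (hb : Function.Bijective (θ (f x))) (k i j : Fin 4) :
    torsion (pullForm f θ) k i j x = torsion θ k i j (f x) := by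
  unfold torsion
  rw [formDeriv_pullForm hf hθ, dualFrame_pullForm hdf hb, dualFrame_pullForm hdf hb]

theorem formDerivComp_pullForm {f : M → N} {x : M} (hf : ContMDiffAt I4 I4 ∞ f x)
    {θ : ∀ y : N, HomBundle N y} (hθ : SmoothFormAt θ (f x)) (k : Fin 4)
    (v w : TangentSpace I4 x) : formDerivComp (pullForm f θ) k x v w =
      formDerivComp θ k (f x) (mfderiv I4 I4 f x v) (mfderiv I4 I4 f x w) := by
  have h := congrFun (formDeriv_pullForm hf hθ v w) k
  rw [formDeriv_eq_formDerivBilin hθ, formDeriv_eq_formDerivBilin (hθ.pullForm hf)] at h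
  exact h

end Pullback

/-! ### The final structure group. -/

section Sign

theorem signMatrix_mem_G0 (ε₁ ε₂ : ℤˣ) : signMatrix ε₁ ε₂ ∈ G0 := by
  have h1 : ((ε₁ : ℤ) : ℝ) ^ 2 = 1 := by rcases Int.units_eq_one_or ε₁ with rfl | rfl <;> simp
  have h2 : ((ε₂ : ℤ) : ℝ) ^ 2 = 1 := by rcases Int.units_eq_one_or ε₂ with rfl | rfl <;> simp
  rw [EngelStructure.mem_G0_iff]
  unfold signMatrix
  refine ⟨?_, ?_, ?_, ?_, ?_, ?_, ?_, ?_, ?_, ?_, ?_⟩ <;> simp [mul_pow, h1, h2]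

theorem signMatrix_mul_self (ε₁ ε₂ : ℤˣ) : signMatrix ε₁ ε₂ * signMatrix ε₁ ε₂ = 1 := by
  rw [signMatrix_mul, Int.units_mul_self, Int.units_mul_self, signMatrix_one]

/-- The diagonal sign matrices as elements of the general linear group. -/
def signGL (ε₁ ε₂ : ℤˣ) : GL (Fin 4) ℝ :=
  ⟨signMatrix ε₁ ε₂, signMatrix ε₁ ε₂, signMatrix_mul_self ε₁ ε₂, signMatrix_mul_self ε₁ ε₂⟩

theorem signMatrix_injective {ε₁ ε₂ δ₁ δ₂ : ℤˣ} (h : signMatrix ε₁ ε₂ = signMatrix δ₁ δ₂) :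
    ε₁ = δ₁ ∧ ε₂ = δ₂ := by
  have h1 := congrFun (congrFun h 1) 1
  have h2 := congrFun (congrFun h 2) 2
  simp only [signMatrix, Matrix.diagonal_apply_eq] at h1 h2
  exact ⟨Units.ext (by exact_mod_cast h2), Units.ext (by exact_mod_cast h1)⟩

theorem nonempty_Gfinal_mulEquiv : Nonempty (Gfinal ≃* Multiplicative (ZMod 2 × ZMod 2)) := by
  let F : ℤˣ × ℤˣ →* Gfinal :=
    { toFun := fun p => ⟨signGL p.1 p.2, p.1, p.2, rfl⟩
      map_one' := Subtype.ext (Units.ext signMatrix_one)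
      map_mul' := fun p q => Subtype.ext (Units.ext (signMatrix_mul p.1 p.2 q.1 q.2).symm) }
  have hF : Function.Bijective F := by
    constructor
    · intro p q h
      have h1 := signMatrix_injective (congrArg (fun g : Gfinal => g.1.1) h)
      exact Prod.ext h1.1 h1.2
    · rintro ⟨g, ε₁, ε₂, h⟩
      exact ⟨(ε₁, ε₂), Subtype.ext (Units.ext h.symm)⟩
  have e : ℤˣ ≃* Multiplicative (ZMod 2) :=
    mulEquivOfPrimeCardEq (p := 2) (by simp) (by simp)
  exact ⟨(MulEquiv.ofBijective F hF).symm.trans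
    ((e.prodCongr e).trans (MulEquiv.prodMultiplicative (ZMod 2) (ZMod 2)).symm)⟩

end Sign

/-! ### `B_final` as a reduction of `B₀`. -/

namespace EngelStructure

variable {Q : Type*} [TopologicalSpace Q] [ChartedSpace Model4 Q] [IsManifold I4 ∞ Q]
variable {S : EngelStructure Q} {η : ∀ y : Q, HomBundle Q y} {U : Set Q} {y : Q}

/-- A constant matrix `diag(s)` with signs multiplies `Tᵏᵢⱼ` by `sₖsᵢsⱼ`. Zeros stay zero, and
preserving `T²₀₁ = T³₁₂ = 1` requires `s₀s₁s₂ = s₁s₂s₃ = 1`, which is the shape of the group. -/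
theorem IsNormalized.signMatrix (h : S.IsNormalized η U) (ε₁ ε₂ : ℤˣ) :
    S.IsNormalized (fun y => matMul (signMatrix ε₁ ε₂) (η y)) U := by
  let s : Fin 4 → ℝ := fun i => (((![ε₁ * ε₂, ε₂, ε₁, ε₁ * ε₂] i : ℤˣ) : ℤ) : ℝ)
  have hs : ∀ i, s i * s i = 1 := fun i => by
    change ((((![ε₁ * ε₂, ε₂, ε₁, ε₁ * ε₂] i : ℤˣ) : ℤ) : ℝ)) * _ = 1
    rw [← Int.cast_mul, ← Units.val_mul, Int.units_mul_self]
    simp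
  have hmul : ∀ (c : Col4) (k : Fin 4), (_root_.signMatrix ε₁ ε₂ *ᵥ c) k = s k * c k :=
    fun c k => Matrix.mulVec_diagonal _ _ _
  have ha : ∀ y ∈ U, S.IsAdapted y (matMul (_root_.signMatrix ε₁ ε₂) (η y)) := fun y hy =>
    (h.adapted y hy).matMul (signMatrix_mem_G0 ε₁ ε₂)
  have hd : ∀ y ∈ U, ∀ i, dualFrame (fun y => matMul (_root_.signMatrix ε₁ ε₂) (η y)) i y =
      s i • dualFrame η i y := by
    intro y hy i
    refine dualFrame_eq (θ := fun y => matMul (_root_.signMatrix ε₁ ε₂) (η y)) (ha y hy).bijective ?_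
    funext k
    rw [matMul_apply, hmul, map_smul, apply_dualFrame (h.adapted y hy).bijective]
    simp only [Pi.smul_apply, smul_eq_mul, Pi.single_apply]
    split_ifs with hk
    · rw [hk, mul_one, hs]
    · simp
  have ht : ∀ y ∈ U, ∀ k i j, torsion (fun y => matMul (_root_.signMatrix ε₁ ε₂) (η y)) k i j y =
      s k * s i * s j * torsion η k i j y := by
    intro y hy k i j
    unfold torsion
    rw [formDeriv_matMul (h.smooth y hy), hd y hy, hd y hy, hmul,
      formDeriv_eq_formDerivBilin (h.smooth y hy), map_smul, map_smul, LinearMap.smul_apply,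
      formDeriv_eq_formDerivBilin (h.smooth y hy), Pi.smul_apply, Pi.smul_apply]
    simp only [smul_eq_mul]
    ring
  refine ⟨h.isOpen, fun y hy => (h.smooth y hy).matMul _, ha, fun y hy => ?_⟩
  obtain ⟨t1, t2, t3, t4, t5, t6⟩ := h.torsion_eq y hy
  simp only [ht y hy, t1, t2, t3, t4, t5, t6, mul_zero, mul_one, and_true, true_and]
  have e0 : s 0 = s 2 * s 1 := by simp [s]
  have e3 : s 3 = s 2 * s 1 := by simp [s]
  have h1 := hs 1
  have h2 := hs 2
  rw [e0, e3]
  constructor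
  · linear_combination s 1 * s 1 * h2 + h1
  · linear_combination s 1 * s 1 * h2 + h1

theorem Bfinal_subset_B0 (S : EngelStructure Q) : S.Bfinal ⊆ S.B0 := by
  intro b hb
  obtain ⟨U, hU, η, h, he⟩ := mem_Bfinal_iff.1 hb
  rw [mem_B0_iff, he]
  exact h.adapted _ hU

theorem IsNormalized.mem_Bfinal (h : S.IsNormalized η U) (hy : y ∈ U) :
    (⟨y, η y⟩ : HomTotal Q) ∈ S.Bfinal :=
  mem_Bfinal_iff.2 ⟨U, hy, η, h, rfl⟩

theorem isGStructure_Bfinal (S : EngelStructure Q) : IsGStructure Gfinal S.Bfinal where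
  isCoframe b hb := (mem_B0_iff.1 (S.Bfinal_subset_B0 hb)).bijective
  mul_mem := by
    rintro x b g ⟨ε₁, ε₂, hg⟩ hb
    obtain ⟨U, hU, η, h, hb⟩ := mem_Bfinal_iff.1 hb
    obtain rfl : b = η x := hb
    rw [hg]
    exact (h.signMatrix ε₁ ε₂).mem_Bfinal hU
  transitive := by
    rintro x b b' hb hb'
    obtain ⟨U, hU, η, h, hb⟩ := mem_Bfinal_iff.1 hb
    obtain ⟨U', hU', η', h', hb'⟩ := mem_Bfinal_iff.1 hb'
    obtain rfl : b = η x := hb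
    obtain rfl : b' = η' x := hb'
    obtain ⟨ε₁, ε₂, he⟩ := h'.exists_eventually_eq h hU' hU
    exact ⟨signGL ε₁ ε₂, ⟨ε₁, ε₂, rfl⟩, he.self_of_nhds⟩
  exists_section := by
    intro x
    obtain ⟨U, η, hx, h⟩ := S.exists_isNormalized x
    exact ⟨U, h.isOpen, hx, η, fun y hy => (h.smooth y hy).contMDiffWithinAt,
      fun y hy => h.mem_Bfinal hy⟩

theorem IsNormalized.formDerivComp_three (h : S.IsNormalized η U) (hy : y ∈ U)
    {v w : TangentSpace I4 y} (hv : v ∈ S.H y) (hw : w ∈ S.H y) :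
    formDerivComp η 3 y v w = 0 := by
  have hs := sum_formComp_smul_dualFrame (h.adapted y hy).bijective
  have hsum : ∀ v ∈ S.H y, v = formComp (η y) 0 v • dualFrame η 0 y +
      formComp (η y) 1 v • dualFrame η 1 y := by
    intro v hv
    have h1 := hs v
    have h2 : formComp (η y) 2 v = 0 := ((h.adapted y hy).annihilates_H v hv).1
    have h3 : formComp (η y) 3 v = 0 := ((h.adapted y hy).annihilates_H v hv).2
    rwa [Fin.sum_univ_four, h2, h3, zero_smul, zero_smul, add_zero, add_zero] at h1
  have h01 : formDerivComp η 3 y (dualFrame η 0 y) (dualFrame η 1 y) = 0 := by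
    rw [← h.torsion_three_zero_one hy, torsion, formDeriv_eq_formDerivBilin (h.smooth y hy)]
    rfl
  have h10 : formDerivComp η 3 y (dualFrame η 1 y) (dualFrame η 0 y) = 0 := by
    rw [formDerivComp_swap, h01, neg_zero]
  rw [hsum v hv, hsum w hw]
  simp only [map_add, map_smul, LinearMap.add_apply, LinearMap.smul_apply, h01, h10,
    formDerivComp_self, smul_zero, add_zero]

end EngelStructure

/-! ### The action of maps on coframes. -/

section Push

variable {M : Type*} [TopologicalSpace M] [ChartedSpace Model4 M]
variable {N : Type*} [TopologicalSpace N] [ChartedSpace Model4 N]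

/-- All fibres are definitionally the same space of linear maps, so no transport along the equality
of base points is needed. -/
theorem HomTotal.ext {b b' : HomTotal M} (h1 : b.1 = b'.1)
    (h2 : (b.2 : Model4 →L[ℝ] Col4) = b'.2) : b = b' := by
  obtain ⟨x, b⟩ := b
  obtain ⟨x', b'⟩ := b'
  obtain rfl : x = x' := h1
  obtain rfl : b = b' := h2
  rfl

/-- Replaces the inverse derivative by composition with the derivative, so that statements on
push-forwards become statements on pulled-back forms. -/
theorem pushCoframe_eq_iff {f : M → N} {b : HomTotal M}
    (hdf : (mfderiv I4 I4 f b.1).IsInvertible) (c : HomBundle N (f b.1)) :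
    pushCoframe f b = ⟨f b.1, c⟩ ↔ b.2 = ContinuousLinearMap.comp c (mfderiv I4 I4 f b.1) := by
  obtain ⟨x, b⟩ := b
  obtain ⟨L, hL⟩ := hdf
  simp only [pushCoframe, TotalSpace.mk_inj]
  rw [← hL, ContinuousLinearMap.inverse_equiv]
  constructor
  · rintro rfl
    ext1 v
    exact congrArg (b : Model4 → Col4) (L.symm_apply_apply v).symm
  · intro h
    rw [h]
    ext1 v
    exact congrArg (c : Model4 → Col4) (L.apply_symm_apply v)

theorem pushCoframe_id (b : HomTotal M) : pushCoframe id b = b := by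
  refine HomTotal.ext rfl ?_
  change ContinuousLinearMap.comp b.2 (mfderiv I4 I4 id b.1).inverse = _
  rw [mfderiv_id, ContinuousLinearMap.inverse_id]
  rfl

variable {P : Type*} [TopologicalSpace P] [ChartedSpace Model4 P]

theorem pushCoframe_comp {f : M → N} {g : N → P} {b : HomTotal M}
    (hf : MDifferentiableAt I4 I4 f b.1) (hg : MDifferentiableAt I4 I4 g (f b.1))
    (hdg : (mfderiv I4 I4 g (f b.1)).IsInvertible) :
    pushCoframe (g ∘ f) b = pushCoframe g (pushCoframe f b) := by
  refine HomTotal.ext rfl ?_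
  change ContinuousLinearMap.comp b.2 (mfderiv I4 I4 (g ∘ f) b.1).inverse =
    ContinuousLinearMap.comp (ContinuousLinearMap.comp b.2 (mfderiv I4 I4 f b.1).inverse)
      (mfderiv I4 I4 g (f b.1)).inverse
  rw [mfderiv_comp _ hg hf, hdg.inverse_comp_of_left]
  rfl

end Push

section Diffeo

variable {M : Type*} [TopologicalSpace M] [ChartedSpace Model4 M]
variable {N : Type*} [TopologicalSpace N] [ChartedSpace Model4 N]

theorem Diffeomorph.isInvertible_mfderiv (f : M ≃ₘ^∞⟮I4, I4⟯ N) (x : M) :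
    (mfderiv I4 I4 f x).IsInvertible :=
  ⟨f.mfderivToContinuousLinearEquiv (by simp) x, rfl⟩

theorem pushCoframe_symm_pushCoframe (f : M ≃ₘ^∞⟮I4, I4⟯ N) (b : HomTotal M) :
    pushCoframe f.symm (pushCoframe f b) = b := by
  rw [← pushCoframe_comp (f.contMDiff.mdifferentiableAt (by simp))
    (f.symm.contMDiff.mdifferentiableAt (by simp))
    (f.symm.isInvertible_mfderiv _)]
  have h : f.symm ∘ f = id := funext f.symm_apply_apply
  rw [h, pushCoframe_id]

theorem pushCoframe_pushCoframe_symm (f : M ≃ₘ^∞⟮I4, I4⟯ N) (b : HomTotal N) :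
    pushCoframe f (pushCoframe f.symm b) = b :=
  pushCoframe_symm_pushCoframe f.symm b

/-- An equality of an image of a diffeomorphism with a set is a pair of inclusions. -/
theorem image_pushCoframe_eq_iff (f : M ≃ₘ^∞⟮I4, I4⟯ N) {B : Set (HomTotal M)}
    {B' : Set (HomTotal N)} : pushCoframe f '' B = B' ↔
      B' ⊆ pushCoframe f '' B ∧ B ⊆ pushCoframe f.symm '' B' := by
  constructor
  · rintro rfl
    refine ⟨subset_rfl, fun b hb => ⟨_, mem_image_of_mem _ hb, pushCoframe_symm_pushCoframe f b⟩⟩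
  · rintro ⟨h1, h2⟩
    refine (subset_antisymm h1 ?_).symm
    rintro _ ⟨b, hb, rfl⟩
    obtain ⟨b', hb', rfl⟩ := h2 hb
    rwa [pushCoframe_pushCoframe_symm]

end Diffeo

/-! ### Equivalences of Engel structures. -/

namespace EngelStructure

variable {Q : Type*} [TopologicalSpace Q] [ChartedSpace Model4 Q] [IsManifold I4 ∞ Q]
variable {Q' : Type*} [TopologicalSpace Q'] [ChartedSpace Model4 Q'] [IsManifold I4 ∞ Q']
variable {S : EngelStructure Q} {S' : EngelStructure Q'}

/-- The pull-back of a normalized section is normalized. -/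
theorem IsNormalized.pullForm {f : Q → Q'} (hf : ContMDiff I4 I4 ∞ f)
    (hdf : ∀ x, (mfderiv I4 I4 f x).IsInvertible)
    (hB : ∀ x, ∀ c : HomBundle Q' (f x), S'.IsAdapted (f x) c →
      S.IsAdapted x (ContinuousLinearMap.comp c (mfderiv I4 I4 f x)))
    {η : ∀ y : Q', HomBundle Q' y} {U : Set Q'} (h : S'.IsNormalized η U) :
    S.IsNormalized (pullForm f η) (f ⁻¹' U) where
  isOpen := h.isOpen.preimage hf.continuous
  smooth y hy := (h.smooth _ hy).pullForm (hf y)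
  adapted y hy := hB y _ (h.adapted _ hy)
  torsion_eq y hy := by
    have ht := fun k i j => torsion_pullForm (hf y) (hdf y) (h.smooth _ hy)
      (h.adapted _ hy).bijective k i j
    simp only [ht]
    exact h.torsion_eq _ hy

theorem isAdapted_of_B0_subset (f : Q ≃ₘ^∞⟮I4, I4⟯ Q') (h : S'.B0 ⊆ pushCoframe f '' S.B0) (x : Q)
    (c : HomBundle Q' (f x)) (hc : S'.IsAdapted (f x) c) :
    S.IsAdapted x (ContinuousLinearMap.comp c (mfderiv I4 I4 f x)) := by
  obtain ⟨b, hb, hbc⟩ := h (show (⟨f x, c⟩ : HomTotal Q') ∈ S'.B0 from mem_B0_iff.2 hc)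
  have hx : b.1 = x := f.injective (congrArg TotalSpace.proj hbc)
  obtain ⟨y, b⟩ := b
  obtain rfl : y = x := hx
  have h1 := (pushCoframe_eq_iff (f.isInvertible_mfderiv y) c).1 hbc
  rw [← h1]
  exact mem_B0_iff.1 hb

theorem B0_subset_of_isAdapted (f : Q ≃ₘ^∞⟮I4, I4⟯ Q')
    (h : ∀ x, ∀ c : HomBundle Q' (f x), S'.IsAdapted (f x) c →
      S.IsAdapted x (ContinuousLinearMap.comp c (mfderiv I4 I4 f x))) :
    S'.B0 ⊆ pushCoframe f '' S.B0 := by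
  rintro ⟨y, c⟩ hc
  obtain ⟨x, rfl⟩ := f.surjective y
  exact ⟨⟨x, ContinuousLinearMap.comp c (mfderiv I4 I4 f x)⟩,
    mem_B0_iff.2 (h x c (mem_B0_iff.1 hc)),
    (pushCoframe_eq_iff (f.isInvertible_mfderiv x) c).2 rfl⟩

/-- `B_final` is defined from `B₀` and torsion alone, and both are preserved by pull-back. -/
theorem Bfinal_subset_of_B0_subset (f : Q ≃ₘ^∞⟮I4, I4⟯ Q') (h : S'.B0 ⊆ pushCoframe f '' S.B0) :
    S'.Bfinal ⊆ pushCoframe f '' S.Bfinal := by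
  rintro ⟨y, c⟩ hc
  obtain ⟨x, rfl⟩ := f.surjective y
  obtain ⟨U, hU, η, hη, hcη⟩ := mem_Bfinal_iff.1 hc
  obtain rfl : c = η (f x) := hcη
  have h1 := hη.pullForm f.contMDiff f.isInvertible_mfderiv (isAdapted_of_B0_subset f h)
  exact ⟨_, h1.mem_Bfinal (y := x) hU, (pushCoframe_eq_iff (f.isInvertible_mfderiv x) _).2 rfl⟩

/-- Every adapted coframe is a `G₀`-multiple of a coframe in `B_final`, and left multiplication
commutes with pull-back. -/
theorem B0_subset_of_Bfinal_subset (f : Q ≃ₘ^∞⟮I4, I4⟯ Q')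
    (h : S'.Bfinal ⊆ pushCoframe f '' S.Bfinal) : S'.B0 ⊆ pushCoframe f '' S.B0 := by
  refine B0_subset_of_isAdapted f fun x c hc => ?_
  obtain ⟨U, η, hU, hη⟩ := S'.exists_isNormalized (f x)
  obtain ⟨b, hb, hbc⟩ := h (hη.mem_Bfinal hU)
  have hx : b.1 = x := f.injective (congrArg TotalSpace.proj hbc)
  obtain ⟨y, b⟩ := b
  obtain rfl : y = x := hx
  have h1 := (pushCoframe_eq_iff (f.isInvertible_mfderiv y) _).1 hbc
  obtain ⟨g, hg, rfl⟩ := (hη.adapted _ hU).exists_mem_G0 hc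
  have h2 := (mem_B0_iff.1 (S.Bfinal_subset_B0 hb)).matMul hg
  have h3 : b = ContinuousLinearMap.comp (η (f y)) (mfderiv I4 I4 f y) := h1
  rw [h3] at h2
  exact h2

theorem image_B0_iff_image_Bfinal (f : Q ≃ₘ^∞⟮I4, I4⟯ Q') :
    pushCoframe f '' S.B0 = S'.B0 ↔ pushCoframe f '' S.Bfinal = S'.Bfinal := by
  rw [image_pushCoframe_eq_iff, image_pushCoframe_eq_iff]
  exact and_congr ⟨Bfinal_subset_of_B0_subset f, B0_subset_of_Bfinal_subset f⟩
    ⟨Bfinal_subset_of_B0_subset f.symm, B0_subset_of_Bfinal_subset f.symm⟩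

theorem IsIsomorphism.symm {f : Q ≃ₘ^∞⟮I4, I4⟯ Q'} (h : S.IsIsomorphism S' f) :
    S'.IsIsomorphism S f.symm := by
  intro y
  have hy : f (f.symm y) = y := f.apply_symm_apply y
  have hAB : ∀ v : Model4, (mfderiv I4 I4 f (f.symm y) : Model4 →L[ℝ] Model4)
      ((mfderiv I4 I4 f.symm y : Model4 →L[ℝ] Model4) v) = v := by
    intro v
    have h1 := mfderiv_comp (I := I4) (I' := I4) (I'' := I4) y
      (f.contMDiff.mdifferentiableAt (by simp)) (f.symm.contMDiff.mdifferentiableAt (by simp))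
    have h2 : f ∘ f.symm = id := funext f.apply_symm_apply
    rw [h2, mfderiv_id] at h1
    exact (congrArg (fun L : Model4 →L[ℝ] Model4 => L v) h1).symm
  have hinj : Function.Injective (mfderiv I4 I4 f (f.symm y) : Model4 →L[ℝ] Model4) :=
    (f.isInvertible_mfderiv (f.symm y)).injective
  have hH : ∀ v : Model4, v ∈ (S'.H y : Submodule ℝ Model4) ↔
      ∃ u : Model4, u ∈ (S.H (f.symm y) : Submodule ℝ Model4) ∧
        (mfderiv I4 I4 f (f.symm y) : Model4 →L[ℝ] Model4) u = v := by
    intro v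
    have h1 : (S'.H : Q' → Submodule ℝ Model4) (f (f.symm y)) = (S'.H : Q' → Submodule ℝ Model4) y :=
      congrArg _ hy
    have h2 : (S'.H : Q' → Submodule ℝ Model4) (f (f.symm y)) = (S.H (f.symm y)).map
      (mfderiv I4 I4 f (f.symm y)).toLinearMap := (h (f.symm y)).2.symm
    rw [← h1, h2]
    rfl
  refine ⟨fun v w => ?_, ?_⟩
  · refine ((h (f.symm y)).1 _ _).symm.trans ?_
    refine (congrArg₂ (fun v w => (S'.metric.inner (f (f.symm y)) :
      Model4 →L[ℝ] Model4 →L[ℝ] ℝ) v w) (hAB v) (hAB w)).trans ?_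
    exact congrArg (fun z => (S'.metric.inner z : Model4 →L[ℝ] Model4 →L[ℝ] ℝ) v w) hy
  · ext u
    constructor
    · rintro ⟨w, hw, rfl⟩
      obtain ⟨k, hk, rfl⟩ := (hH w).1 hw
      have h1 := hinj (hAB ((mfderiv I4 I4 f (f.symm y) : Model4 →L[ℝ] Model4) k))
      exact h1.symm ▸ hk
    · intro hu
      exact ⟨(mfderiv I4 I4 f (f.symm y) : Model4 →L[ℝ] Model4) u, (hH _).2 ⟨u, hu, rfl⟩,
        hinj (hAB _)⟩

/-- Only `df(H¹) ⊆ H'¹` needs an argument. There `H'¹ = ker η³` for a normalized `η`, and `f*η³`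
kills `H¹` because it kills `H` and its derivative vanishes on `H`. -/
theorem IsIsomorphism.B0_subset {f : Q ≃ₘ^∞⟮I4, I4⟯ Q'} (h : S.IsIsomorphism S' f) :
    S'.B0 ⊆ pushCoframe f '' S.B0 := by
  refine B0_subset_of_isAdapted f fun x c hc => ?_
  have hH : ∀ z, ∀ v ∈ S.H z, mfderiv I4 I4 f z v ∈ S'.H (f z) := fun z v hv => by
    rw [← (h z).2]
    exact Submodule.mem_map_of_mem hv
  obtain ⟨U, η, hU, hη⟩ := S'.exists_isNormalized (f x)
  have hH1 : ∀ v ∈ S.H1 x, mfderiv I4 I4 f x v ∈ S'.H1 (f x) := by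
    intro v hv
    refine (hη.adapted _ hU).mem_H1 ?_
    have hf := f.contMDiff x
    refine annihilates_H1_of_deriv (k := 3) ((hη.smooth _ hU).pullForm hf) ?_ ?_ v hv
    · filter_upwards [hf.continuousAt.eventually (hη.isOpen.eventually_mem hU)] with z hz v hv
      exact ((hη.adapted _ hz).annihilates_H _ (hH z v hv)).2
    · intro v hv w hw
      rw [formDerivComp_pullForm hf (hη.smooth _ hU)]
      exact hη.formDerivComp_three hU (hH x v hv) (hH x w hw)
  refine ⟨hc.bijective.comp (f.isInvertible_mfderiv x).bijective,
    fun v hv => hc.annihilates_H _ (hH x v hv), fun v hv => hc.annihilates_H1 _ (hH1 v hv),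
    fun v hv w hw => ?_⟩
  rw [← (h x).1]
  exact hc.inner_eq _ (hH x v hv) _ (hH1 w hw)

theorem IsIsomorphism.image_B0 {f : Q ≃ₘ^∞⟮I4, I4⟯ Q'} (h : S.IsIsomorphism S' f) :
    pushCoframe f '' S.B0 = S'.B0 :=
  (image_pushCoframe_eq_iff f).2 ⟨h.B0_subset, h.symm.B0_subset⟩

end EngelStructure

/-! ### Manifold structures lifted along a local homeomorphism. -/

section PullbackManifold

variable {X : Type*} [TopologicalSpace X]
variable {M : Type*} [TopologicalSpace M] [ChartedSpace Model4 M]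

/-- The charts that a local homeomorphism to a manifold induces. -/
def IsLocalHomeomorph.pullChart {p : X → M} (hp : IsLocalHomeomorph p) (b : X) :
    OpenPartialHomeomorph X Model4 :=
  (hp b).choose.trans (chartAt Model4 (p b))

/-- The formula holds for every `c`, also outside the source, since the local inverse extends `p` as
a total function. In these charts `p` is the identity, from which all smoothness statements follow.
-/
theorem IsLocalHomeomorph.pullChart_apply {p : X → M} (hp : IsLocalHomeomorph p) (b c : X) :
    hp.pullChart b c = chartAt Model4 (p b) (p c) :=
  congrArg (chartAt Model4 (p b)) (congrFun (hp b).choose_spec.2 c).symm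

/-- The charted space structure that a local homeomorphism to a manifold induces. -/
@[reducible] def IsLocalHomeomorph.pullChartedSpace {p : X → M} (hp : IsLocalHomeomorph p) :
    ChartedSpace Model4 X where
  atlas := range hp.pullChart
  chartAt := hp.pullChart
  mem_chart_source b := by
    have h := (hp b).choose_spec
    rw [IsLocalHomeomorph.pullChart, OpenPartialHomeomorph.trans_source]
    refine ⟨h.1, ?_⟩
    rw [mem_preimage, ← h.2]
    exact mem_chart_source Model4 (p b)
  chart_mem_atlas b := mem_range_self b

theorem IsLocalHomeomorph.apply_pullChart_symm {p : X → M} (hp : IsLocalHomeomorph p) (b : X)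
    {u : Model4} (hu : u ∈ (hp.pullChart b).target) :
    (chartAt Model4 (p b)).symm u = p ((hp.pullChart b).symm u) := by
  have h := (hp b).choose_spec
  rw [IsLocalHomeomorph.pullChart, OpenPartialHomeomorph.trans_target] at hu
  refine ((hp b).choose.right_inv hu.2).symm.trans ?_
  exact (congrFun h.2 _).symm

theorem IsLocalHomeomorph.pullChart_target_subset {p : X → M} (hp : IsLocalHomeomorph p) (b : X) :
    (hp.pullChart b).target ⊆ (chartAt Model4 (p b)).target := fun u hu => by
  rw [IsLocalHomeomorph.pullChart, OpenPartialHomeomorph.trans_target] at hu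
  exact hu.1

theorem IsLocalHomeomorph.apply_mem_of_mem_source {p : X → M} (hp : IsLocalHomeomorph p) (b : X)
    {c : X} (hc : c ∈ (hp.pullChart b).source) : p c ∈ (chartAt Model4 (p b)).source := by
  have h := (hp b).choose_spec
  rw [IsLocalHomeomorph.pullChart, OpenPartialHomeomorph.trans_source, ← h.2] at hc
  exact hc.2

variable [IsManifold I4 ∞ M]

/-- The transition maps are restrictions of transition maps of `M`. -/
theorem IsLocalHomeomorph.isManifold_pullChartedSpace {p : X → M} (hp : IsLocalHomeomorph p) :
    letI := hp.pullChartedSpace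
    IsManifold I4 ∞ X := by
  let := hp.pullChartedSpace
  refine isManifold_of_contDiffOn I4 ∞ X ?_
  rintro _ _ ⟨b, rfl⟩ ⟨b', rfl⟩
  have h1 := (contDiffGroupoid ∞ I4).compatible (chart_mem_atlas Model4 (p b))
    (chart_mem_atlas Model4 (p b'))
  have h2 := (mem_groupoid_of_pregroupoid.1 h1).1
  refine (h2.mono ?_).congr ?_
  · rintro u ⟨hu, hu'⟩
    refine ⟨?_, hu'⟩
    rw [mem_preimage, OpenPartialHomeomorph.trans_source, OpenPartialHomeomorph.symm_source] at hu ⊢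
    refine ⟨hp.pullChart_target_subset b hu.1, ?_⟩
    rw [mem_preimage, hp.apply_pullChart_symm b hu.1]
    exact hp.apply_mem_of_mem_source b' hu.2
  · rintro u ⟨hu, hu'⟩
    rw [mem_preimage, OpenPartialHomeomorph.trans_source, OpenPartialHomeomorph.symm_source] at hu
    refine (hp.pullChart_apply b' _).trans ?_
    exact congrArg (chartAt Model4 (p b')) (hp.apply_pullChart_symm b hu.1).symm

variable {N E H : Type*} [NormedAddCommGroup E] [NormedSpace ℝ E] [TopologicalSpace H]
  {J : ModelWithCorners ℝ E H} [TopologicalSpace N] [ChartedSpace H N]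

omit [IsManifold I4 ∞ M] in
-- A continuous lift has the same chart expression as the map it lifts.
theorem IsLocalHomeomorph.contMDiffAt_of_comp {p : X → M} (hp : IsLocalHomeomorph p) {g : N → X}
    {y : N} (hg : ContinuousAt g y) (hpg : ContMDiffAt J I4 ∞ (p ∘ g) y) :
    letI := hp.pullChartedSpace
    ContMDiffAt J I4 ∞ g y := by
  let := hp.pullChartedSpace
  rw [contMDiffAt_iff_target] at hpg ⊢
  refine ⟨hg, ?_⟩
  have h : extChartAt I4 (g y) ∘ g = extChartAt I4 ((p ∘ g) y) ∘ (p ∘ g) :=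
    funext fun z => hp.pullChart_apply (g y) (g z)
  rw [h]
  exact hpg.2

theorem IsLocalHomeomorph.contMDiff_pull {p : X → M} (hp : IsLocalHomeomorph p) :
    letI := hp.pullChartedSpace
    ContMDiff I4 I4 ∞ p := by
  let := hp.pullChartedSpace
  have := hp.isManifold_pullChartedSpace
  intro b
  rw [contMDiffAt_iff_target]
  refine ⟨hp.continuous.continuousAt, ?_⟩
  have h : extChartAt I4 (p b) ∘ p = extChartAt I4 b :=
    funext fun z => (hp.pullChart_apply b z).symm
  rw [h]
  exact contMDiffAt_extChartAt

theorem IsLocalHomeomorph.isLocalDiffeomorph_pull {p : X → M} (hp : IsLocalHomeomorph p) :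
    letI := hp.pullChartedSpace
    IsLocalDiffeomorph I4 I4 ∞ p := by
  let := hp.pullChartedSpace
  intro b
  obtain ⟨e, hb, rfl⟩ := hp b
  refine ⟨⟨e.toPartialEquiv, e.open_source, e.open_target, hp.contMDiff_pull.contMDiffOn, ?_⟩, hb,
    fun _ _ => rfl⟩
  intro y hy
  refine (hp.contMDiffAt_of_comp (e.continuousAt_symm hy) ?_).contMDiffWithinAt
  refine contMDiffAt_id.congr_of_eventuallyEq ?_
  filter_upwards [e.open_target.mem_nhds hy] with z hz using e.right_inv hz

end PullbackManifold

/-! ### Dependence on germs, and continuity of evaluation. -/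

section Congr

variable {M : Type*} [TopologicalSpace M] [ChartedSpace Model4 M]

theorem formInChart_congr {θ θ' : ∀ x : M, HomBundle M x} {x : M} (h : ∀ᶠ y in 𝓝 x, θ y = θ' y) :
    formInChart θ x =ᶠ[𝓝 (extChartAt I4 x x)] formInChart θ' x := by
  have hc : ContinuousAt (extChartAt I4 x).symm (extChartAt I4 x x) :=
    continuousAt_extChartAt_symm x
  rw [ContinuousAt, extChartAt_to_inv] at hc
  filter_upwards [hc.eventually h] with u hu
  exact congrArg (fun A : Model4 →L[ℝ] Col4 => A.comp
    (mfderiv 𝓘(ℝ, Model4) I4 (extChartAt I4 x).symm u : Model4 →L[ℝ] Model4)) hu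

variable [IsManifold I4 ∞ M]

theorem SmoothFormAt.congr {θ θ' : ∀ x : M, HomBundle M x} {x : M} (hθ : SmoothFormAt θ' x)
    (h : ∀ᶠ y in 𝓝 x, θ y = θ' y) : SmoothFormAt θ x := by
  rw [smoothFormAt_iff] at hθ ⊢
  exact hθ.congr_of_eventuallyEq (formInChart_congr h)

theorem torsion_congr {θ θ' : ∀ x : M, HomBundle M x} {x : M} (hθ : SmoothFormAt θ' x)
    (h : ∀ᶠ y in 𝓝 x, θ y = θ' y) (k i j : Fin 4) : torsion θ k i j x = torsion θ' k i j x := by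
  have h1 : ∀ i, dualFrame θ i x = dualFrame θ' i x := fun i => by
    unfold dualFrame
    rw [h.self_of_nhds]
  unfold torsion
  rw [h1, h1, formDeriv_eq ((smoothFormAt_iff.1 hθ).differentiableAt (by simp)),
    formDeriv_eq ((smoothFormAt_iff.1 (hθ.congr h)).differentiableAt (by simp)),
    (formInChart_congr h).fderiv_eq]

/-- The evaluation of covectors on a smooth vector field is continuous. -/
theorem continuousAt_apply_field {V : ∀ x : M, TangentSpace I4 x} {b : HomTotal M}
    (hV : SmoothFieldAt V b.1) (k : Fin 4) :
    ContinuousAt (fun c : HomTotal M => (c.2 (V c.1) : Col4) k) b := by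
  have h1 : ContMDiffAt (I4.prod 𝓘(ℝ, Model4 →L[ℝ] Col4)) I4 ∞
      (TotalSpace.proj : HomTotal M → M) b := Bundle.contMDiffAt_proj _
  have h2 := ContMDiffAt.comp b hV h1
  have h3 : ContMDiffAt (I4.prod 𝓘(ℝ, Model4 →L[ℝ] Col4)) (I4.prod 𝓘(ℝ, Model4 →L[ℝ] Col4)) ∞
      (fun c : HomTotal M => (⟨c.1, c.2⟩ : HomTotal M)) b := contMDiffAt_id
  have h4 := ContMDiffAt.clm_bundle_apply (F₁ := Model4) (F₂ := Col4)
    (E₁ := fun x : M => TangentSpace I4 x) (E₂ := Bundle.Trivial M Col4) h3 h2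
  have h5 := (Bundle.contMDiffAt_totalSpace.1 h4).2.continuousAt
  exact (continuous_apply k).continuousAt.comp h5

end Congr

/-! ### The smooth structure and the structure equations of `B_final`. -/

namespace EngelStructure

variable {Q : Type*} [TopologicalSpace Q] [ChartedSpace Model4 Q] [IsManifold I4 ∞ Q]
variable {S : EngelStructure Q} {η : ∀ y : Q, HomBundle Q y} {U : Set Q}

theorem continuous_projOn (S : EngelStructure Q) : Continuous (projOn S.Bfinal) :=
  (FiberBundle.continuous_proj (Model4 →L[ℝ] Col4) (HomBundle Q)).comp continuous_subtype_val

/-- Every coframe of `B_final` over a point of `U` is a sign multiple of `η`. Its values on `e₁` and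
`e₂` in components 1 and 2 are `ε₂` and `ε₁`; positivity of both is an open condition that forces
the coframe to be `η`. -/
theorem IsNormalized.isOpen_range (h : S.IsNormalized η U) :
    IsOpen {b : S.Bfinal | b.1.1 ∈ U ∧ b.1.2 = η b.1.1} := by
  rw [isOpen_iff_mem_nhds]
  rintro ⟨⟨x, b⟩, hb⟩ ⟨hx, hbη⟩
  obtain rfl : b = η x := hbη
  have hc : ∀ j : Fin 4, ∀ᶠ c : S.Bfinal in 𝓝 ⟨⟨x, η x⟩, hb⟩,
      0 < (c.1.2 (dualFrame η j c.1.1) : Col4) j := by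
    intro j
    have h1 := (continuousAt_apply_field (b := ⟨x, η x⟩) (h.smooth_dualFrame hx j) j).comp
      (f := (Subtype.val : S.Bfinal → HomTotal Q)) (x := ⟨⟨x, η x⟩, hb⟩)
      continuous_subtype_val.continuousAt
    refine h1.eventually (lt_mem_nhds ?_)
    change 0 < (η x (dualFrame η j x) : Col4) j
    rw [apply_dualFrame (h.adapted x hx).bijective]
    simp
  have hU : ∀ᶠ c : S.Bfinal in 𝓝 ⟨⟨x, η x⟩, hb⟩, c.1.1 ∈ U :=
    S.continuous_projOn.continuousAt.eventually (h.isOpen.eventually_mem hx)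
  filter_upwards [hU, hc 1, hc 2] with c hcU h1 h2
  refine ⟨hcU, ?_⟩
  obtain ⟨V, hV, η', h', he⟩ := mem_Bfinal_iff.1 c.2
  obtain ⟨ε₁, ε₂, hε⟩ := h'.exists_eventually_eq h hV hcU
  rw [he, hε.self_of_nhds] at h1 h2 ⊢
  rw [matMul_apply, apply_dualFrame (h.adapted _ hcU).bijective] at h1 h2
  have e1 : ε₁ = 1 := by
    rcases Int.units_eq_one_or ε₁ with h0 | h0
    · exact h0
    · rw [h0] at h2
      simp [_root_.signMatrix] at h2
      norm_num at h2
  have e2 : ε₂ = 1 := by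
    rcases Int.units_eq_one_or ε₂ with h0 | h0
    · exact h0
    · rw [h0] at h1
      simp [_root_.signMatrix] at h1
      norm_num at h1
  rw [e1, e2, signMatrix_one, matMul_one]

open Classical in
/-- The local homeomorphism from `B_final` to the manifold defined by a normalized section. -/
def IsNormalized.localHomeomorph (h : S.IsNormalized η U) (b : S.Bfinal) :
    OpenPartialHomeomorph S.Bfinal Q where
  toFun := projOn S.Bfinal
  -- `b` is a mere default value outside the target.
  invFun y := if hy : y ∈ U then ⟨⟨y, η y⟩, h.mem_Bfinal hy⟩ else b
  source := {b : S.Bfinal | b.1.1 ∈ U ∧ b.1.2 = η b.1.1}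
  target := U
  map_source' _ hc := hc.1
  map_target' y hy := by
    rw [dif_pos hy]
    exact ⟨hy, rfl⟩
  left_inv' c hc := by
    change (if hy : c.1.1 ∈ U then (⟨⟨c.1.1, η c.1.1⟩, h.mem_Bfinal hy⟩ : S.Bfinal) else b) = c
    rw [dif_pos hc.1]
    exact Subtype.ext (HomTotal.ext rfl hc.2.symm)
  right_inv' y hy := by
    rw [dif_pos hy]
    rfl
  open_source := h.isOpen_range
  open_target := h.isOpen
  continuousOn_toFun := S.continuous_projOn.continuousOn
  continuousOn_invFun := by
    rw [continuousOn_iff_continuous_domRestrict, continuous_induced_rng]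
    have h1 : ContinuousOn (fun y => (⟨y, η y⟩ : HomTotal Q)) U := fun y hy =>
      (h.smooth y hy).continuousAt.continuousWithinAt
    rw [continuousOn_iff_continuous_domRestrict] at h1
    convert h1 using 1
    funext y
    simp only [Function.comp, Set.domRestrict_apply, dif_pos y.2]

theorem isLocalHomeomorph_projOn (S : EngelStructure Q) :
    IsLocalHomeomorph (projOn S.Bfinal) := by
  intro b
  obtain ⟨U, hU, η, h, he⟩ := mem_Bfinal_iff.1 b.2
  exact ⟨h.localHomeomorph b, ⟨hU, he⟩, rfl⟩

/-- The smooth structure of `B_final`. -/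
@[reducible] def chartedSpaceBfinal (S : EngelStructure Q) : ChartedSpace Model4 S.Bfinal :=
  S.isLocalHomeomorph_projOn.pullChartedSpace

theorem eventually_eq_section (h : S.IsNormalized η U) {b : S.Bfinal} (hU : b.1.1 ∈ U)
    (hb : b.1.2 = η b.1.1) : ∀ᶠ c : S.Bfinal in 𝓝 b, c.1.1 ∈ U ∧ c.1.2 = η c.1.1 :=
  h.isOpen_range.mem_nhds ⟨hU, hb⟩

theorem contMDiff_val_Bfinal (S : EngelStructure Q) :
    letI := S.chartedSpaceBfinal
    ContMDiff I4 (I4.prod 𝓘(ℝ, Model4 →L[ℝ] Col4)) ∞ (Subtype.val : S.Bfinal → HomTotal Q) := by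
  let := S.chartedSpaceBfinal
  intro b
  obtain ⟨U, hU, η, h, he⟩ := mem_Bfinal_iff.1 b.2
  have h1 : ContMDiffAt I4 I4 ∞ (projOn S.Bfinal) b := S.isLocalHomeomorph_projOn.contMDiff_pull b
  refine (ContMDiffAt.comp b (h.smooth _ hU) h1).congr_of_eventuallyEq ?_
  filter_upwards [eventually_eq_section h hU he] with c hc
  exact HomTotal.ext rfl hc.2

/-- Near `b` the set `B_final` is the graph of `η`. Hence smoothness and torsion of the tautological
form are those of a normalized section. -/
theorem eventually_tautological_eq (h : S.IsNormalized η U) {b : S.Bfinal} (hU : b.1.1 ∈ U)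
    (hb : b.1.2 = η b.1.1) :
    letI := S.chartedSpaceBfinal
    ∀ᶠ c : S.Bfinal in 𝓝 b, tautological S.Bfinal c = pullForm (projOn S.Bfinal) η c := by
  let := S.chartedSpaceBfinal
  filter_upwards [eventually_eq_section h hU hb] with c hc
  unfold tautological pullForm
  exact congrArg (fun A : HomBundle Q c.1.1 => ContinuousLinearMap.comp A
    (mfderiv I4 I4 (projOn S.Bfinal) c)) hc.2

theorem isInvertible_mfderiv_projOn (S : EngelStructure Q) (b : S.Bfinal) :
    letI := S.chartedSpaceBfinal
    (mfderiv I4 I4 (projOn S.Bfinal) b).IsInvertible :=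
  letI := S.chartedSpaceBfinal
  ⟨S.isLocalHomeomorph_projOn.isLocalDiffeomorph_pull.mfderivToContinuousLinearEquiv (by simp) b,
    rfl⟩

theorem tautological_bijective (S : EngelStructure Q) (b : S.Bfinal) :
    letI := S.chartedSpaceBfinal
    Function.Bijective (tautological S.Bfinal b) :=
  letI := S.chartedSpaceBfinal
  (mem_B0_iff.1 (S.Bfinal_subset_B0 b.2)).bijective.comp (S.isInvertible_mfderiv_projOn b).bijective

theorem smoothFormAt_tautological (S : EngelStructure Q) (b : S.Bfinal) :
    letI := S.chartedSpaceBfinal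
    letI := S.isLocalHomeomorph_projOn.isManifold_pullChartedSpace
    SmoothFormAt (tautological S.Bfinal) b := by
  let := S.chartedSpaceBfinal
  let := S.isLocalHomeomorph_projOn.isManifold_pullChartedSpace
  obtain ⟨U, hU, η, h, he⟩ := mem_Bfinal_iff.1 b.2
  exact ((h.smooth _ hU).pullForm (S.isLocalHomeomorph_projOn.contMDiff_pull b)).congr
    (eventually_tautological_eq h hU he)

theorem torsion_tautological (h : S.IsNormalized η U) {b : S.Bfinal} (hU : b.1.1 ∈ U)
    (hb : b.1.2 = η b.1.1) (k i j : Fin 4) :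
    letI := S.chartedSpaceBfinal
    torsion (tautological S.Bfinal) k i j b = torsion η k i j b.1.1 := by
  let := S.chartedSpaceBfinal
  let := S.isLocalHomeomorph_projOn.isManifold_pullChartedSpace
  have hp := S.isLocalHomeomorph_projOn.contMDiff_pull b
  rw [torsion_congr ((h.smooth _ hU).pullForm hp) (eventually_tautological_eq h hU hb)]
  exact torsion_pullForm hp (S.isInvertible_mfderiv_projOn b) (h.smooth _ hU)
    (h.adapted _ hU).bijective k i j

theorem exists_structure_equations (S : EngelStructure Q) :
    letI := S.chartedSpaceBfinal
    ∃ T : Fin 4 → Fin 4 → Fin 4 → S.Bfinal → ℝ,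
      (∀ k i j, ContMDiff I4 𝓘(ℝ, ℝ) ∞ (T k i j)) ∧
      ∀ (b : S.Bfinal) (x y : TangentSpace I4 b),
        formDeriv (tautological S.Bfinal) b x y =
          !![T 0 0 1 b, T 0 0 2 b, T 0 0 3 b,             0, T 0 1 3 b, T 0 2 3 b;
             T 1 0 1 b, T 1 0 2 b, T 1 0 3 b,             0, T 1 1 3 b, T 1 2 3 b;
             1,         T 2 0 2 b, T 2 0 3 b,             0, T 2 1 3 b, T 2 2 3 b;
             0,         0,         T 1 0 1 b + T 2 0 2 b, 1, T 3 1 3 b, T 3 2 3 b] *ᵥ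
            ![wedge (tautological S.Bfinal b) 0 1 x y,
              wedge (tautological S.Bfinal b) 0 2 x y,
              wedge (tautological S.Bfinal b) 0 3 x y,
              wedge (tautological S.Bfinal b) 1 2 x y,
              wedge (tautological S.Bfinal b) 1 3 x y,
              wedge (tautological S.Bfinal b) 2 3 x y] := by
  let := S.chartedSpaceBfinal
  let := S.isLocalHomeomorph_projOn.isManifold_pullChartedSpace
  refine ⟨torsion (tautological S.Bfinal), fun k i j b => ?_, fun b x y => ?_⟩
  · exact contMDiffAt_torsion (.of_forall S.smoothFormAt_tautological)
      (.of_forall S.tautological_bijective) k i j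
  · have h0 := (isTorsionOn_iff isOpen_univ
      (fun b _ => (S.smoothFormAt_tautological b).contMDiffWithinAt)
      (fun b _ => S.tautological_bijective b) (torsion (tautological S.Bfinal))).2
      (fun _ _ _ _ _ _ => rfl) b (mem_univ b) x y
    obtain ⟨U, hU, η, h, he⟩ := mem_Bfinal_iff.1 b.2
    have ht := torsion_tautological h hU he
    obtain ⟨t1, t2, t3, t4, t5, t6⟩ := h.torsion_eq _ hU
    have t7 := h.torsion_three_zero_one hU
    have t8 := h.torsion_three_zero_three hU
    rw [← ht] at t1 t2 t3 t4 t5 t6 t7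
    rw [← ht, ← ht, ← ht] at t8
    have i0 : (Finset.Ioi (0 : Fin 4)) = {1, 2, 3} := by decide
    funext k
    rw [h0 k]
    fin_cases k <;>
      · simp [i0, Matrix.mulVec, dotProduct, Fin.sum_univ_succ, t1,
          t2, t3, t4, t5, t6, t7, t8]
        try ring

end EngelStructure

/-! ### Rigidity of maps that preserve a coframing. -/

/-- A map that fixes a point and preserves a coframing is the identity near this point. -/
theorem eventually_eq_self_of_coframe_comp_fderiv {E F : Type*} [NormedAddCommGroup E]
    [NormedSpace ℝ E] [CompleteSpace E] [NormedAddCommGroup F] [NormedSpace ℝ F]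
    {A : E → E →L[ℝ] F} {g : E → E} {x : E}
    (hA : ContDiffAt ℝ 1 A x) (hAx : (A x).IsInvertible) (hg : ContDiffAt ℝ 1 g x) (hgx : g x = x)
    (h : ∀ᶠ u in 𝓝 x, (A (g u)).comp (fderiv ℝ g u) = A u) : ∀ᶠ u in 𝓝 x, g u = u := by
  obtain ⟨K, t, ht, hK⟩ := hA.exists_lipschitzOnWith
  have hgt : Filter.Tendsto g (𝓝 x) (𝓝 x) := by
    have := hg.continuousAt
    rwa [ContinuousAt, hgx] at this
  have hinv : ∀ᶠ u in 𝓝 x, (A u).IsInvertible :=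
    hA.continuousAt.eventually (ContinuousLinearEquiv.isOpen.mem_nhds hAx)
  have hbd : ∀ᶠ u in 𝓝 x, ‖(A u).inverse‖ ≤ ‖(A x).inverse‖ + 1 := by
    have hc : ContinuousAt (fun u => ‖(A u).inverse‖) x :=
      ((hAx.contDiffAt_map_inverse (n := 1)).continuousAt.comp hA.continuousAt).norm
    filter_upwards [hc.eventually (gt_mem_nhds (lt_add_one _))] with u hu using hu.le
  have hd : ∀ᶠ u in 𝓝 x, DifferentiableAt ℝ g u := by
    filter_upwards [hg.eventually (by simp)] with u hu using hu.differentiableAt one_ne_zero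
  have hall := (((((Filter.eventually_mem_set.2 ht).and (hgt.eventually ht)).and
    (hgt.eventually hinv)).and (hgt.eventually hbd)).and hd).and h
  obtain ⟨r, hr, hball⟩ := Metric.eventually_nhds_iff_ball.1 hall
  filter_upwards [Metric.ball_mem_nhds x hr] with u hu
  have hmem : ∀ s ∈ Icc (0 : ℝ) 1, x + s • (u - x) ∈ Metric.ball x r := by
    intro s hs
    have := (convex_ball x r).add_smul_sub_mem (Metric.mem_ball_self hr) hu hs
    exact this
  have hder : ∀ s ∈ Icc (0 : ℝ) 1, HasDerivAt (fun s : ℝ => g (x + s • (u - x)) - (x + s • (u - x)))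
      (fderiv ℝ g (x + s • (u - x)) (u - x) - (u - x)) s := by
    intro s hs
    have h1 : HasDerivAt (fun s : ℝ => x + s • (u - x)) (u - x) s := by
      simpa using ((hasDerivAt_id s).smul_const (u - x)).const_add x
    have h2 := (hball _ (hmem s hs)).1.2.hasFDerivAt.comp_hasDerivAt s h1
    exact h2.sub h1
  -- Grönwall along the segment from `x` to `u` for the displacement `g z - z`. The hypothesis gives
  -- `dg - 1 = A(g z)⁻¹ (A z - A(g z))`, and since `A` is Lipschitz near `x` the derivative of the
  -- displacement is bounded by a multiple of the displacement.
  have hzero := eq_zero_of_abs_deriv_le_mul_abs_self_of_eq_zero_right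
    (K := (‖(A x).inverse‖ + 1) * K * ‖u - x‖) (a := 0) (b := 1)
    (fun s hs => (hder s hs).continuousAt.continuousWithinAt)
    (fun s hs => (hder s (Ico_subset_Icc_self hs)).hasDerivWithinAt)
    (by simp [hgx]) (fun s hs => by
      obtain ⟨⟨⟨⟨⟨h1, h2⟩, h3⟩, h4⟩, -⟩, h5⟩ := hball _ (hmem s (Ico_subset_Icc_self hs))
      set z := x + s • (u - x)
      have e1 : fderiv ℝ g z (u - x) - (u - x) =
          (A (g z)).inverse ((A z - A (g z)) (u - x)) := by
        have e2 := congrArg (fun L : E →L[ℝ] F => L (u - x)) h5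
        simp only [ContinuousLinearMap.comp_apply] at e2
        rw [_root_.sub_apply, map_sub (A (g z)).inverse, ← e2, h3.inverse_apply_self, h3.inverse_apply_self]
      rw [e1]
      have e3 : ‖A z - A (g z)‖ ≤ K * ‖g z - z‖ := by
        rw [norm_sub_rev (g z) z]
        exact hK.norm_sub_le h1 h2
      calc ‖(A (g z)).inverse ((A z - A (g z)) (u - x))‖
          ≤ ‖(A (g z)).inverse‖ * (‖A z - A (g z)‖ * ‖u - x‖) :=
            (ContinuousLinearMap.le_opNorm _ _).trans (by
              gcongr; exact ContinuousLinearMap.le_opNorm _ _)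
        _ ≤ (‖(A x).inverse‖ + 1) * ((K * ‖g z - z‖) * ‖u - x‖) := by gcongr
        _ = _ := by ring)
  have := hzero 1 (by simp)
  simpa [sub_eq_zero] using this

section Manifold

variable {M : Type*} [TopologicalSpace M] [ChartedSpace Model4 M] [IsManifold I4 ∞ M]

theorem eventually_eq_self_of_pullForm_eq {f : M → M} {x : M} {θ : ∀ y : M, HomBundle M y}
    (hf : ContMDiffAt I4 I4 ∞ f x) (hfx : f x = x) (hθ : SmoothFormAt θ x)
    (hb : Function.Bijective (θ x)) (h : ∀ᶠ y in 𝓝 x, pullForm f θ y = θ y) :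
    ∀ᶠ y in 𝓝 x, f y = y := by
  have h1 := (formInChart_pullForm hf θ).symm.trans (formInChart_congr h)
  have h2 := chartRep_self f x
  rw [hfx] at h1 h2
  have h3 := eventually_eq_self_of_coframe_comp_fderiv ((smoothFormAt_iff.1 hθ).of_le (by norm_cast))
    (isInvertible_formInChart (mem_extChartAt_source (I := I4) x) hb)
    ((contDiffAt_chartRep hf).of_le (by norm_cast)) h2 h1
  have h4 : ∀ᶠ y in 𝓝 x, f y ∈ (extChartAt I4 (f x)).source :=
    hf.continuousAt.eventually (extChartAt_source_mem_nhds (I := I4) (f x))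
  filter_upwards [(continuousAt_extChartAt (I := I4) x).eventually h3, h4,
    extChartAt_source_mem_nhds (I := I4) x] with y hy hy1 hy2
  rw [hfx] at hy1
  unfold chartRep at hy
  rw [(extChartAt I4 x).left_inv hy2, hfx] at hy
  exact (extChartAt I4 x).injOn hy1 hy2 hy

end Manifold

/-! ### Free action of the symmetries. -/

namespace EngelStructure

variable {Q : Type*} [TopologicalSpace Q] [ChartedSpace Model4 Q] [IsManifold I4 ∞ Q]
variable {S : EngelStructure Q}

theorem IsSymmetry.isNormalized_pullForm {f : Q ≃ₘ^∞⟮I4, I4⟯ Q} (hf : S.IsSymmetry f)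
    {η : ∀ y : Q, HomBundle Q y} {U : Set Q} (h : S.IsNormalized η U) :
    S.IsNormalized (pullForm f η) (f ⁻¹' U) :=
  h.pullForm f.contMDiff f.isInvertible_mfderiv
    (isAdapted_of_B0_subset f ((image_pushCoframe_eq_iff f).1 hf).1)

/-- Near `x` the pull-back of `η` is a constant sign multiple of `η`, so agreement at a single
nearby point makes the sign matrix 1. Asking for agreement only frequently allows `x` to be a limit
of points where it is known. -/
theorem IsSymmetry.eventually_eq_self {f : Q ≃ₘ^∞⟮I4, I4⟯ Q} (hf : S.IsSymmetry f)
    {η : ∀ y : Q, HomBundle Q y} {U : Set Q} (h : S.IsNormalized η U) {x : Q} (hx : x ∈ U)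
    (hfx : f x = x) (hfr : ∃ᶠ y in 𝓝 x, pullForm f η y = η y) : ∀ᶠ y in 𝓝 x, f y = y := by
  refine eventually_eq_self_of_pullForm_eq (f.contMDiff x) hfx (h.smooth x hx)
    (h.adapted x hx).bijective ?_
  have hx' : x ∈ f ⁻¹' U := by rwa [mem_preimage, hfx]
  obtain ⟨ε₁, ε₂, hε⟩ := (hf.isNormalized_pullForm h).exists_eventually_eq h hx' hx
  obtain ⟨y, hy, hy1, hyU⟩ := (hfr.and_eventually (hε.and (h.isOpen.eventually_mem hx))).exists
  have h1 : signMatrix ε₁ ε₂ = 1 := by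
    refine matMul_injective (h.adapted y hyU).bijective ?_
    rw [← hy1, hy, matMul_one]
  filter_upwards [hε] with z hz
  rw [hz, h1, matMul_one]

/-- The symmetries of a connected manifold act freely on `B_final`. -/
theorem IsSymmetry.eq_self_of_pushCoframe_eq [T2Space Q] [PreconnectedSpace Q]
    {f : Q ≃ₘ^∞⟮I4, I4⟯ Q} (hf : S.IsSymmetry f) {b : HomTotal Q} (hb : b ∈ S.Bfinal)
    (hfb : pushCoframe f b = b) (x : Q) : f x = x := by
  -- The interior of the fixed point set is shown to be clopen.
  let E : Set Q := {x | ∀ᶠ y in 𝓝 x, f y = y}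
  suffices hE : E = univ from (hE.symm ▸ mem_univ x : x ∈ E).self_of_nhds
  refine IsClopen.eq_univ ⟨?_, ?_⟩ ⟨b.1, ?_⟩
  · refine isClosed_of_closure_subset fun x hx => ?_
    have hfx : f x = x := by
      have hc : IsClosed {y | f y = y} := isClosed_eq f.contMDiff.continuous continuous_id
      exact closure_minimal (fun y hy =>
        (show ∀ᶠ z in 𝓝 y, f z = z from hy).self_of_nhds) hc hx
    obtain ⟨U, η, hU, h⟩ := S.exists_isNormalized x
    refine hf.eventually_eq_self h hU hfx ?_
    -- At points of `E` the map is locally the identity, so its derivative is the identity and `η`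
    -- is preserved there.
    refine (mem_closure_iff_frequently.1 hx).mono fun y hy => ?_
    have h1 : (mfderiv I4 I4 f y : Model4 →L[ℝ] Model4) = mfderiv I4 I4 (id : Q → Q) y :=
      Filter.EventuallyEq.mfderiv_eq hy
    rw [mfderiv_id] at h1
    have h2 : f y = y := (show ∀ᶠ z in 𝓝 y, f z = z from hy).self_of_nhds
    let η' : Q → Model4 →L[ℝ] Col4 := η
    have h3 : η' (f y) = η' y := congrArg η' h2
    exact congrArg₂ (fun (A : Model4 →L[ℝ] Col4) (B : Model4 →L[ℝ] Model4) => A.comp B) h3 h1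
  · exact isOpen_iff_mem_nhds.2 fun x hx => Filter.Eventually.eventually_nhds hx
  · obtain ⟨U, hU, η, h, he⟩ := mem_Bfinal_iff.1 hb
    have hfx : f b.1 = b.1 := congrArg TotalSpace.proj hfb
    have h1 : pushCoframe f b = ⟨f b.1, η (f b.1)⟩ := by
      rw [hfb]
      refine HomTotal.ext hfx.symm ?_
      let η' : Q → Model4 →L[ℝ] Col4 := η
      exact he.trans (congrArg η' hfx).symm
    rw [pushCoframe_eq_iff (f.isInvertible_mfderiv _), he] at h1
    exact hf.eventually_eq_self h hU hfx fun h0 => h0.self_of_nhds h1.symm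

/-- The left multiplication of the coframes over a manifold by a matrix. -/
def _root_.matMulTotal (g : Matrix (Fin 4) (Fin 4) ℝ) (b : HomTotal Q) : HomTotal Q :=
  ⟨b.1, matMul g b.2⟩

/-- A symmetry that fixes a point acts on the coframes in `B_final` over it as an involution. -/
theorem IsSymmetry.pushCoframe_pushCoframe {f : Q ≃ₘ^∞⟮I4, I4⟯ Q} (hf : S.IsSymmetry f)
    {b : HomTotal Q} (hb : b ∈ S.Bfinal) (hfb : f b.1 = b.1) :
    pushCoframe f (pushCoframe f b) = b := by
  have h1 : pushCoframe f b ∈ S.Bfinal :=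
    ((image_B0_iff_image_Bfinal f).1 hf) ▸ mem_image_of_mem _ hb
  obtain ⟨c, hc⟩ : ∃ c : HomBundle Q b.1, pushCoframe f b = ⟨b.1, c⟩ := by
    generalize hd : pushCoframe f b = d
    have hd1 : d.1 = b.1 := (congrArg TotalSpace.proj hd).symm.trans hfb
    obtain ⟨x, b⟩ := b
    obtain ⟨x', d⟩ := d
    obtain rfl : x' = x := hd1
    exact ⟨d, rfl⟩
  obtain ⟨g, ⟨ε₁, ε₂, hg⟩, hgc⟩ := S.isGStructure_Bfinal.transitive b.1 b.2 c hb (hc ▸ h1)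
  have h2 : pushCoframe f b = matMulTotal (signMatrix ε₁ ε₂) b := by
    rw [hc, hgc, hg]
    rfl
  -- Left multiplication and precomposition with the inverse derivative commute, so the sign matrix
  -- enters squared.
  have h3 : pushCoframe f (matMulTotal (signMatrix ε₁ ε₂) b) =
    matMulTotal (signMatrix ε₁ ε₂) (pushCoframe f b) := rfl
  rw [h2, h3, h2]
  refine HomTotal.ext rfl ?_
  change matMul _ (matMul _ b.2) = b.2
  rw [matMul_matMul, signMatrix_mul_self, matMul_one]

end EngelStructure

/-! ### Curves with zero velocity. -/

section Curves

variable {M : Type*} [TopologicalSpace M] [ChartedSpace Model4 M] [IsManifold I4 ∞ M]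

theorem eventually_eq_of_hasMFDerivAt_zero {c : ℝ → M} {t₀ : ℝ}
    (h : ∀ᶠ t in 𝓝 t₀, HasMFDerivAt 𝓘(ℝ, ℝ) I4 c t 0) : ∀ᶠ t in 𝓝 t₀, c t = c t₀ := by
  have hc : ContinuousAt c t₀ := h.self_of_nhds.continuousAt
  have hs : ∀ᶠ t in 𝓝 t₀, c t ∈ (chartAt Model4 (c t₀)).source :=
    hc.eventually ((chartAt Model4 (c t₀)).open_source.eventually_mem (mem_chart_source _ _))
  obtain ⟨r, hr, hball⟩ := Metric.eventually_nhds_iff_ball.1 (h.and hs)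
  have hd : ∀ t ∈ Metric.ball t₀ r,
      HasFDerivAt (fun t => extChartAt I4 (c t₀) (c t)) (0 : ℝ →L[ℝ] Model4) t := by
    intro t ht
    have h1 := (mdifferentiableAt_extChartAt (I := I4) (hball t ht).2).hasMFDerivAt
    have h2 := h1.comp t (hball t ht).1
    rw [ContinuousLinearMap.comp_zero] at h2
    exact h2.hasFDerivAt
  filter_upwards [Metric.ball_mem_nhds t₀ hr] with t ht
  have h3 := Metric.isOpen_ball.is_const_of_fderiv_eq_zero
    (convex_ball t₀ r).isPreconnected
    (fun s hs => (hd s hs).differentiableAt.differentiableWithinAt)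
    (fun s hs => (hd s hs).fderiv) ht (Metric.mem_ball_self hr)
  refine (extChartAt I4 (c t₀)).injOn ?_ ?_ h3
  · rw [extChartAt_source]
    exact (hball t ht).2
  · exact mem_extChartAt_source (I := I4) (c t₀)

end Curves

/-! ### Involutions in a Lie group. -/

section LieGroup

variable {E : Type*} [NormedAddCommGroup E] [NormedSpace ℝ E]
variable {G : Type*} [TopologicalSpace G] [ChartedSpace E G] [Group G] [LieGroup 𝓘(ℝ, E) ∞ G]

/-- A curve of involutions through the identity is stationary. -/
theorem velocity_eq_zero_of_mul_self_eq_one {γ : ℝ → G} {v : E} (hγ : γ 0 = 1)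
    (hd : HasMFDerivAt 𝓘(ℝ, ℝ) 𝓘(ℝ, E) γ 0 ((1 : ℝ →L[ℝ] ℝ).smulRight v))
    (hsq : ∀ᶠ t in 𝓝 0, γ t * γ t = 1) : v = 0 := by
  have hm : MDifferentiableAt (𝓘(ℝ, E).prod 𝓘(ℝ, E)) 𝓘(ℝ, E) (fun p : G × G => p.1 * p.2)
      (γ 0, γ 0) := (contMDiff_mul 𝓘(ℝ, E) ∞).mdifferentiableAt (by simp)
  have h1 := hm.hasMFDerivAt.comp (0 : ℝ) (hd.prodMk hd)
  have h2 : HasMFDerivAt 𝓘(ℝ, ℝ) 𝓘(ℝ, E) (fun _ : ℝ => (1 : G)) 0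
      (0 : ℝ →L[ℝ] E) := hasMFDerivAt_const _ _
  have h3 := h2.congr_of_eventuallyEq (f₁ := fun t => γ t * γ t) hsq
  have h4 : (mfderiv (𝓘(ℝ, E).prod 𝓘(ℝ, E)) 𝓘(ℝ, E) (fun p : G × G => p.1 * p.2) (γ 0, γ 0) :
      E × E →L[ℝ] E) (v, v) = 0 := by
    have h5 := congrArg (fun L : ℝ →L[ℝ] E => L 1) (hasMFDerivAt_unique h1 h3)
    refine Eq.trans ?_ h5
    change _ = (mfderiv (𝓘(ℝ, E).prod 𝓘(ℝ, E)) 𝓘(ℝ, E) (fun p : G × G => p.1 * p.2) (γ 0, γ 0) :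
      E × E →L[ℝ] E) ((1 : ℝ) • v, (1 : ℝ) • v)
    rw [one_smul]
  -- The derivative of multiplication at `(1, 1)` is addition, so differentiating `γ · γ = 1` gives
  -- `v + v = 0`. The element `g` is generalized because `γ 0` occurs in the types of the
  -- derivatives.
  have h6 : ∀ g : G, g = 1 →
      (mfderiv 𝓘(ℝ, E) 𝓘(ℝ, E) (fun z : G => z * g) g : E →L[ℝ] E) v = v := by
    rintro _ rfl
    have : (fun z : G => z * 1) = id := funext mul_one
    rw [this, mfderiv_id]
    rfl
  have h7 : ∀ g : G, g = 1 →
      (mfderiv 𝓘(ℝ, E) 𝓘(ℝ, E) (fun z : G => g * z) g : E →L[ℝ] E) v = v := by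
    rintro _ rfl
    have : (fun z : G => 1 * z) = id := funext one_mul
    rw [this, mfderiv_id]
    rfl
  have h8 := (mfderiv_prod_eq_add_apply (v := (v, v)) hm).symm.trans h4
  have h9 : v + v = 0 := (congrArg₂ (· + ·) (h6 _ hγ) (h7 _ hγ)).symm.trans h8
  rwa [← two_smul ℝ, smul_eq_zero, or_iff_right two_ne_zero] at h9

end LieGroup

/-! ### Orbit maps of smooth actions. -/

section Action

variable {E : Type*} [NormedAddCommGroup E] [NormedSpace ℝ E]
variable {G : Type*} [TopologicalSpace G] [ChartedSpace E G] [Group G] [LieGroup 𝓘(ℝ, E) ∞ G]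
variable {M : Type*} [TopologicalSpace M] [ChartedSpace Model4 M] [IsManifold I4 ∞ M]
  [MulAction G M]

omit [LieGroup 𝓘(ℝ, E) ∞ G] [IsManifold I4 ∞ M] in
theorem contMDiff_smul_left (h : ContMDiff (𝓘(ℝ, E).prod I4) I4 ∞ (fun p : G × M => p.1 • p.2))
    (g : G) : ContMDiff I4 I4 ∞ (fun x : M => g • x) :=
  h.comp (contMDiff_const.prodMk contMDiff_id)

omit [LieGroup 𝓘(ℝ, E) ∞ G] [IsManifold I4 ∞ M] in
theorem contMDiff_orbit (h : ContMDiff (𝓘(ℝ, E).prod I4) I4 ∞ (fun p : G × M => p.1 • p.2))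
    (x : M) : ContMDiff 𝓘(ℝ, E) I4 ∞ (fun g : G => g • x) :=
  h.comp (contMDiff_id.prodMk contMDiff_const)

/-- The diffeomorphism defined by an element of a Lie group that acts smoothly. -/
def smulDiffeomorph (h : ContMDiff (𝓘(ℝ, E).prod I4) I4 ∞ (fun p : G × M => p.1 • p.2)) (g : G) :
    M ≃ₘ^∞⟮I4, I4⟯ M where
  toEquiv := MulAction.toPerm g
  contMDiff_toFun := contMDiff_smul_left h g
  contMDiff_invFun := contMDiff_smul_left h g⁻¹

omit [IsManifold I4 ∞ M] in
/-- The derivative of an orbit map annihilates a left-invariant field that it annihilates at the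
identity. -/
theorem mfderiv_orbit_mulInvariantVectorField
    (h : ContMDiff (𝓘(ℝ, E).prod I4) I4 ∞ (fun p : G × M => p.1 • p.2)) (x : M)
    {v : GroupLieAlgebra 𝓘(ℝ, E) G} (hv : mfderiv 𝓘(ℝ, E) I4 (fun g : G => g • x) 1 v = 0) (g : G) :
    mfderiv 𝓘(ℝ, E) I4 (fun g : G => g • x) g (mulInvariantVectorField v g) = 0 := by
  let o : G → M := fun g => g • x
  have ho : ∀ g, MDifferentiableAt 𝓘(ℝ, E) I4 o g := fun g =>
    (contMDiff_orbit h x).mdifferentiableAt (by simp)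
  have hg : MDifferentiableAt 𝓘(ℝ, E) 𝓘(ℝ, E) (fun k : G => g * k) 1 :=
    (contMDiff_mul_left (n := ∞)).mdifferentiableAt (by simp)
  have h1 := mfderiv_comp (I := 𝓘(ℝ, E)) (I' := 𝓘(ℝ, E)) (I'' := I4) 1 (ho (g * 1)) hg
  have h2 := mfderiv_comp (I := 𝓘(ℝ, E)) (I' := I4) (I'' := I4) 1
    ((contMDiff_smul_left h g).mdifferentiableAt (x := o 1) (by simp)) (ho 1)
  -- Equivariance of the orbit map carries the vanishing from the identity to `g`.
  have h3 : o ∘ (fun k : G => g * k) = (fun y : M => g • y) ∘ o := funext fun k => mul_smul g k x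
  rw [h3, h2] at h1
  have h4 := congrArg (fun L : E →L[ℝ] Model4 => L v) h1
  have h5 : (mfderiv 𝓘(ℝ, E) I4 o : G → E →L[ℝ] Model4) (g * 1) =
      (mfderiv 𝓘(ℝ, E) I4 o : G → E →L[ℝ] Model4) g := congrArg _ (mul_one g)
  have h6 := congrArg (fun L : E →L[ℝ] Model4 =>
    L (mfderiv 𝓘(ℝ, E) 𝓘(ℝ, E) (fun k : G => g * k) 1 v)) h5
  refine (h6.symm.trans h4.symm).trans ?_
  refine (congrArg (mfderiv I4 I4 (fun y : M => g • y) (o 1)) hv).trans ?_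
  exact map_zero _

/-- The orbit map of a point is an immersion if the elements of the stabilizer are involutions. -/
theorem injective_mfderiv_orbit [CompleteSpace E]
    (h : ContMDiff (𝓘(ℝ, E).prod I4) I4 ∞ (fun p : G × M => p.1 • p.2)) (x : M)
    (hx : ∀ g : G, g • x = x → g * g = 1) :
    Function.Injective (mfderiv 𝓘(ℝ, E) I4 (fun g : G => g • x) 1) := by
  have hL : LieGroup 𝓘(ℝ, E) (minSmoothness ℝ 3) G := by
    rw [minSmoothness_of_isRCLikeNormedField]
    exact LieGroup.of_le (n := ∞) (WithTop.coe_le_coe.2 le_top)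
  rw [injective_iff_map_eq_zero]
  intro v hv
  have hM : IsManifold 𝓘(ℝ, E) 1 G := IsManifold.of_le (n := ∞) (by simp)
  have hV := contMDiffAt_mulInvariantVectorField (I := 𝓘(ℝ, E)) v (g := (1 : G))
  have h12 : 1 ≤ minSmoothness ℝ 2 := by
    rw [minSmoothness_of_isRCLikeNormedField]
    exact one_le_two
  -- A local integral curve of the left-invariant field replaces the exponential map. Its orbit
  -- through `x` has zero velocity, so `γ` stays in the stabilizer, whose elements are involutions.
  obtain ⟨γ, hγ, hint⟩ := exists_isMIntegralCurveAt_of_contMDiffAt_boundaryless (t₀ := 0)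
    (hV.of_le h12)
  have h1 : ∀ᶠ t in 𝓝 (0 : ℝ), HasMFDerivAt 𝓘(ℝ, ℝ) I4 (fun t => γ t • x) t 0 := by
    filter_upwards [hint] with t ht
    have h2 := ((contMDiff_orbit h x).mdifferentiableAt (x := γ t) (by simp)).hasMFDerivAt.comp t ht
    let L : E →L[ℝ] Model4 := mfderiv 𝓘(ℝ, E) I4 (fun g : G => g • x) (γ t)
    let w : E := mulInvariantVectorField v (γ t)
    have h13 : L w = 0 := mfderiv_orbit_mulInvariantVectorField h x hv (γ t)
    have h14 : L.comp ((1 : ℝ →L[ℝ] ℝ).smulRight w) = 0 := by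
      ext
      simp [h13]
    have h15 : ∀ D : ℝ →L[ℝ] Model4, D = 0 → HasMFDerivAt 𝓘(ℝ, ℝ) I4 (fun t => γ t • x) t D →
        HasMFDerivAt 𝓘(ℝ, ℝ) I4 (fun t => γ t • x) t (0 : ℝ →L[ℝ] Model4) := by
      rintro _ rfl h0
      exact h0
    exact h15 _ h14 h2
  have h3 := eventually_eq_of_hasMFDerivAt_zero h1
  rw [hγ, one_smul] at h3
  have h4 := hint.self_of_nhds
  have h5 : ∀ g : G, g = 1 → (mulInvariantVectorField v g : E) = v := by
    rintro _ rfl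
    have : (fun z : G => 1 * z) = id := funext one_mul
    unfold mulInvariantVectorField
    rw [this, mfderiv_id]
    rfl
  have h6 : HasMFDerivAt 𝓘(ℝ, ℝ) 𝓘(ℝ, E) γ 0
    ((1 : ℝ →L[ℝ] ℝ).smulRight (mulInvariantVectorField v (γ 0) : E)) := h4
  rw [h5 _ hγ] at h6
  exact velocity_eq_zero_of_mul_self_eq_one (E := E) hγ h6 (h3.mono fun t ht => hx _ ht)

end Action

/-! ### The bound on the dimension. -/

namespace EngelStructure

variable {Q : Type*} [TopologicalSpace Q] [ChartedSpace Model4 Q] [IsManifold I4 ∞ Q]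
variable {S : EngelStructure Q}

/-- The square of an element that stabilizes `x` fixes a coframe over `x`, so it acts as the
identity by freeness and equals 1 by effectiveness. The derivative of the orbit map at 1 then embeds
the Lie algebra into a tangent space of `Q`. -/
theorem dimension_le_four [T2Space Q] [ConnectedSpace Q] (S : EngelStructure Q) {n : ℕ}
    {G : Type*} [TopologicalSpace G] [ChartedSpace (EuclideanSpace ℝ (Fin n)) G] [Group G]
    [LieGroup 𝓘(ℝ, EuclideanSpace ℝ (Fin n)) ∞ G] [MulAction G Q] [FaithfulSMul G Q]
    (h : ContMDiff (𝓘(ℝ, EuclideanSpace ℝ (Fin n)).prod I4) I4 ∞ (fun p : G × Q => p.1 • p.2))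
    (hS : ∀ g : G, S.IsSymmetry (fun x => g • x)) : n ≤ 4 := by
  obtain ⟨x⟩ : Nonempty Q := inferInstance
  obtain ⟨U, η, hU, hη⟩ := S.exists_isNormalized x
  have hb := hη.mem_Bfinal hU
  have hx : ∀ g : G, g • x = x → g * g = 1 := by
    intro g hg
    let f := smulDiffeomorph h g
    let f2 := smulDiffeomorph h (g * g)
    have hf : S.IsSymmetry f := hS g
    have hf2 : S.IsSymmetry f2 := hS (g * g)
    have h1 := hf.pushCoframe_pushCoframe hb hg
    rw [← pushCoframe_comp (f.contMDiff.mdifferentiableAt (by simp))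
      (f.contMDiff.mdifferentiableAt (by simp)) (f.isInvertible_mfderiv _)] at h1
    have h2 : f ∘ f = f2 := funext fun y => (mul_smul g g y).symm
    rw [h2] at h1
    refine FaithfulSMul.eq_of_smul_eq_smul (α := Q) fun y => ?_
    rw [one_smul]
    exact hf2.eq_self_of_pushCoframe_eq hb h1 y
  have h1 := injective_mfderiv_orbit h x hx
  let A : EuclideanSpace ℝ (Fin n) →L[ℝ] Model4 :=
    mfderiv 𝓘(ℝ, EuclideanSpace ℝ (Fin n)) I4 (fun g : G => g • x) 1
  have h2 := LinearMap.finrank_le_finrank_of_injective (f := A.toLinearMap) h1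
  simpa using h2

end EngelStructure

end

theorem theorem1 {Q : Type u} [TopologicalSpace Q] [T2Space Q] [ChartedSpace Model4 Q]
    [IsManifold I4 ∞ Q] (S : EngelStructure Q) :
    -- `B_final` is a reduction of `B₀` to a group isomorphic to `ℤ₂ × ℤ₂`
    (S.Bfinal ⊆ S.B0 ∧ IsGStructure Gfinal S.Bfinal ∧
      Nonempty (Gfinal ≃* Multiplicative (ZMod 2 × ZMod 2))) ∧
    -- it is canonical, and equivalences of the structures are those of the reductions
    (∀ (Q' : Type w) [TopologicalSpace Q'] [ChartedSpace Model4 Q'] [IsManifold I4 ∞ Q']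
      (S' : EngelStructure Q') (f : Q ≃ₘ^∞⟮I4, I4⟯ Q'),
      (S.IsIsomorphism S' f → pushCoframe f '' S.B0 = S'.B0) ∧
      (pushCoframe f '' S.B0 = S'.B0 ↔ pushCoframe f '' S.Bfinal = S'.Bfinal)) ∧
    -- it is a smooth manifold, locally diffeomorphic to `Q`, on which the tautological one-form
    -- is a coframing with the following structure equations
    (∃ (_ : ChartedSpace Model4 S.Bfinal) (_ : IsManifold I4 ∞ S.Bfinal),
      IsLocalDiffeomorph I4 I4 ∞ (projOn S.Bfinal) ∧
      ContMDiff I4 (I4.prod 𝓘(ℝ, Model4 →L[ℝ] Col4)) ∞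
        (Subtype.val : S.Bfinal → HomTotal Q) ∧
      SmoothFormOn (tautological S.Bfinal) univ ∧
      (∀ b, Function.Bijective (tautological S.Bfinal b)) ∧
      ∃ T : Fin 4 → Fin 4 → Fin 4 → S.Bfinal → ℝ,
        (∀ k i j, ContMDiff I4 𝓘(ℝ, ℝ) ∞ (T k i j)) ∧
        ∀ (b : S.Bfinal) (x y : TangentSpace I4 b),
          formDeriv (tautological S.Bfinal) b x y =
            !![T 0 0 1 b, T 0 0 2 b, T 0 0 3 b,             0, T 0 1 3 b, T 0 2 3 b;
               T 1 0 1 b, T 1 0 2 b, T 1 0 3 b,             0, T 1 1 3 b, T 1 2 3 b;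
               1,         T 2 0 2 b, T 2 0 3 b,             0, T 2 1 3 b, T 2 2 3 b;
               0,         0,         T 1 0 1 b + T 2 0 2 b, 1, T 3 1 3 b, T 3 2 3 b] *ᵥ
              ![wedge (tautological S.Bfinal b) 0 1 x y,
                wedge (tautological S.Bfinal b) 0 2 x y,
                wedge (tautological S.Bfinal b) 0 3 x y,
                wedge (tautological S.Bfinal b) 1 2 x y,
                wedge (tautological S.Bfinal b) 1 3 x y,
                wedge (tautological S.Bfinal b) 2 3 x y]) ∧
    -- if `Q` is connected, then the symmetries act freely on `B_final`, and every Lie group that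
    -- acts smoothly and effectively on `Q` by symmetries has dimension at most four
    (ConnectedSpace Q →
      (∀ f : Q ≃ₘ^∞⟮I4, I4⟯ Q, S.IsSymmetry f →
        ∀ b ∈ S.Bfinal, pushCoframe f b = b → ∀ x, f x = x) ∧
      ∀ (n : ℕ) (G : Type v) [TopologicalSpace G] [ChartedSpace (EuclideanSpace ℝ (Fin n)) G]
        [Group G] [LieGroup 𝓘(ℝ, EuclideanSpace ℝ (Fin n)) ∞ G] [MulAction G Q]
        [FaithfulSMul G Q],
        ContMDiff (𝓘(ℝ, EuclideanSpace ℝ (Fin n)).prod I4) I4 ∞ (fun p : G × Q => p.1 • p.2) →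
        (∀ g : G, S.IsSymmetry (fun x => g • x)) → n ≤ 4) := by
  let := S.chartedSpaceBfinal
  let := S.isLocalHomeomorph_projOn.isManifold_pullChartedSpace
  refine ⟨⟨S.Bfinal_subset_B0, S.isGStructure_Bfinal, nonempty_Gfinal_mulEquiv⟩, ?_,
    ⟨S.chartedSpaceBfinal, S.isLocalHomeomorph_projOn.isManifold_pullChartedSpace,
      S.isLocalHomeomorph_projOn.isLocalDiffeomorph_pull, S.contMDiff_val_Bfinal,
      fun b _ => (S.smoothFormAt_tautological b).contMDiffWithinAt, S.tautological_bijective,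
      S.exists_structure_equations⟩, ?_⟩
  · intro Q' _ _ _ S' f
    exact ⟨EngelStructure.IsIsomorphism.image_B0, EngelStructure.image_B0_iff_image_Bfinal f⟩
  · intro _
    refine ⟨fun f hf b hb hfb => hf.eq_self_of_pushCoframe_eq hb hfb, ?_⟩
    intro n G _ _ _ _ _ _ h hS
    exact S.dimension_le_four h hS
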